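/- Let $G=(V,E)$ be a finite connected graph with $V=\{0,\dots,n-1\}$, let $\beta>0$, $x=\tanh\beta\in(0,1)$, $m=|E|$, and let $\langle\,\cdot\,\rangle$ be the expectation in the zero-field ferromagnetic Ising model on $G$, with weights $\exp(\beta\sum_{ab\in E}\sigma_a\sigma_b)$, $\sigma\in\{-1,1\}^V$. For $A\subseteq E$ let $\partial A$ be the set of vertices of odd degree in $(V,A)$. Put $\mathcal C_{uv}=\{A\subseteq E:\partial A=\{u,v\}\}$, $\mathcal C_0=\{A\subseteq E:\partial A=\emptyset\}$, $\mathcal C_2=\{A\subseteq E:|\partial A|=2\}$, $\mathcal W=\mathcal C_0\cup\mathcal C_2$, and let $\pi$ be the probability measure on $\mathcal W$ with $\pi(A)\propto n\,x^{|A|}$ for $A\in\mathcal C_0$ and $\pi(A)\propto 2\,x^{|A|}$ for $A\in\mathcal C_2$. The Prokof'ev--Svistunov (PS) chain on $\mathcal W$ makes the following step from $A$: choose $u$ uniformly from $V$ if $A\in\mathcal C_0$, and uniformly from $\partial A$ if $A\in\mathcal C_2$; choose a uniformly random neighbour $v$ of $u$; with probability $a(A,A\triangle uv)$ move to $A\triangle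 uv$, and otherwise stay at $A$. Here $a(A,A\triangle uv)=\frac12\min\bigl(1,\frac{d(u)}{d(v)}x^{\pm}\bigr)$ if $A,A\triangle uv\in\mathcal C_2$ and $a(A,A\triangle uv)=\frac12\min(1,x^{\pm})$ otherwise, where $d$ is the degree in $G$, and $x^{\pm}$ is $x$ if the edge $uv$ is added and $1/x$ if it is removed. For $\mathcal A\subseteq\mathcal W$, $S>0$ and $\epsilon,\eta\in(0,1/4)$, the sampling scheme outputs the median of $7\lceil\log\eta^{-1}\rceil+1$ independent sample means, each of $20\lceil S\epsilon^{-2}+1\rceil$ independent indicators of the event that the PS chain, run from a given initial state for $\lceil R\rceil$ steps, ends in $\mathcal A$, where, with $\delta=\epsilon/(16S)$ and $\Delta(G)$ the maximum degree, $$R=\frac1{2x}\Bigl(\log\frac8x-\frac{\log\delta}{m}\Bigr)\Bigl(3+\frac1{mx}\Bigr)\Delta(G)\,n^6m^2 .$$ Fix $k\in\mathbb N$. An fpras for a quantity $q=q(G,\beta,u,v)$ is a randomised program that, given $G$, $x$, $u$, $v$, $\epsilon$, $\eta$, where $\beta>0$ and $u\ne v$ are vertices of the finite connected graph $G$ at graph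 distance $d(u,v)\le k$, and where $\epsilon,\eta\in(0,1/4)$, always halts within a number of steps that is bounded by a polynomial in $n,x^{-1},\epsilon^{-1},\eta^{-1}$ (program and polynomial may depend only on $k$; thus for fixed $\beta$ the bound is polynomial in $n,\epsilon^{-1},\eta^{-1}$), and whose output $Y$ satisfies $\mathbb P[(1-\epsilon)q\le Y\le(1+\epsilon)q]\ge 1-\eta$. Programs use random access arrays of natural and real numbers, sums and truncated differences of naturals, $+,-,\times,\div,\log$ on reals, comparisons, uniform random integers, biased coins, branching and counted loops. Each elementary operation takes one step, except that rounding a real up to a natural number $c$ takes $c$ additional steps. Then the following hold. 1. For all $G$, $\beta$, $u$, $v$ as above (with $u\neq v$ and $d(u,v)\le k$): - for every shortest path $p_{uv}$ from $u$ to $v$, the map $A\mapsto A\triangle p_{uv}$ is a bijection from $\mathcal C_{uv}$ to $\mathcal C_0$; - $\pi(\mathcal C_{uv})\ge \dfrac{2x^k}{n(n+1)}$; - $\pi(\mathcal C_0)>0$ and $\langle\sigma_u\sigma_v\rangle=\dfrac n2\,\dfrac{\pi(\mathcal C_{uv})}{\pi(\mathcal C_0)}$; - for all $\epsilon,\eta\in(0,1/4)$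 and every initial state in $\mathcal W$, the output $Y$ of the sampling scheme with $\mathcal A=\mathcal C_{uv}$ and $S=n(n+1)x^{-k}/2$ satisfies $\mathbb P[(1-\epsilon)\pi(\mathcal C_{uv})\le Y\le(1+\epsilon)\pi(\mathcal C_{uv})]\ge1-\eta$. 2. There is a program whose output on every such input has exactly the law of this sampling scheme, with initial state $\emptyset$, and which is an fpras for $\pi(\mathcal C_{uv})$. 3. There is an fpras for the two-point correlation function $\langle\sigma_u\sigma_v\rangle$. -/

import Mathlib

open scoped symmDiff

noncomputable section

/-! ### The Ising model and its high-temperature graphs -/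

/-- The zero-field ferromagnetic Ising correlation `⟨∏_{v ∈ W} σ_v⟩` on `G` at inverse temperature
`β`: the expectation under the Gibbs weight `exp (β ∑_{ab ∈ E} σ_a σ_b)`, `σ ∈ {-1, 1}^V`. -/
def isingCorr {V : Type*} [Fintype V] [DecidableEq V] (G : SimpleGraph V) [DecidableRel G.Adj]
    (β : ℝ) (W : Finset V) : ℝ :=
  let spin : (V → ℤˣ) → V → ℝ := fun σ v => ((σ v : ℤ) : ℝ)
  let gibbs : (V → ℤˣ) → ℝ := fun σ =>
    Real.exp (β * ∑ e ∈ G.edgeFinset,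
      Sym2.lift ⟨fun a b => spin σ a * spin σ b, fun _ _ => mul_comm _ _⟩ e)
  (∑ σ, (∏ v ∈ W, spin σ v) * gibbs σ) / ∑ σ, gibbs σ

/-- `∂A`: the vertices of odd degree in the spanning subgraph `(V, A)`. -/
def oddVertices {V : Type*} [Fintype V] [DecidableEq V] (A : Finset (Sym2 V)) : Finset V :=
  Finset.univ.filter fun v => Odd (A.filter fun e => v ∈ e).card

/-- `𝒞_W = {A ⊆ E : ∂A = W}`; in particular `𝒞_∅` is the set `𝒞_0` of even subgraphs. -/
def graphsWithBoundary {V : Type*} [Fintype V] [DecidableEq V] (G : SimpleGraph V)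
    [DecidableRel G.Adj] (W : Finset V) : Finset (Finset (Sym2 V)) :=
  G.edgeFinset.powerset.filter fun A => oddVertices A = W

/-- The configuration space `𝒲 = 𝒞_0 ∪ 𝒞_2`: edge sets with no or exactly two odd vertices. -/
def wormSpace {V : Type*} [Fintype V] [DecidableEq V] (G : SimpleGraph V)
    [DecidableRel G.Adj] : Finset (Finset (Sym2 V)) :=
  G.edgeFinset.powerset.filter fun A => (oddVertices A).card = 0 ∨ (oddVertices A).card = 2

/-- The unnormalised stationary weight: `n x^|A|` on `𝒞_0` and `2 x^|A|` on `𝒞_2`. -/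
def wormWeight {V : Type*} [Fintype V] [DecidableEq V] (x : ℝ) (A : Finset (Sym2 V)) : ℝ :=
  (if (oddVertices A).card = 0 then (Fintype.card V : ℝ)
    else if (oddVertices A).card = 2 then 2 else 0) * x ^ A.card

/-- `π(𝒜)` for an event `𝒜`. -/
def wormProb {V : Type*} [Fintype V] [DecidableEq V] (G : SimpleGraph V) [DecidableRel G.Adj]
    (x : ℝ) (𝒜 : Finset (Finset (Sym2 V))) : ℝ :=
  (∑ A ∈ 𝒜 ∩ wormSpace G, wormWeight x A) / ∑ A ∈ wormSpace G, wormWeight x A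

/-! ### The Prokof'ev–Svistunov (worm) chain -/

/-- A uniformly random element of `s` (and `d` if `s` is empty). -/
def uniformOr {α : Type*} (s : Finset α) (d : α) : PMF α :=
  if h : s.Nonempty then PMF.uniformOfFinset s h else PMF.pure d

/-- A coin that shows `true` with probability `p` (truncated to `[0, 1]`). -/
def coin (p : ℝ) : PMF Bool :=
  PMF.bernoulli (min p.toNNReal 1) (min_le_right _ _)

/-- The lazy Metropolis acceptance probability `a(A, A ∆ uv)`. -/
def acceptance {V : Type*} [Fintype V] [DecidableEq V] (G : SimpleGraph V) [DecidableRel G.Adj]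
    (x : ℝ) (A : Finset (Sym2 V)) (u v : V) : ℝ :=
  let xpm : ℝ := if s(u, v) ∈ A then 1 / x else x
  (1 / 2) *
    (if (oddVertices A).card = 2 ∧ (oddVertices (A ∆ {s(u, v)})).card = 2 ∧ u ∈ oddVertices A
      then min 1 ((G.degree u : ℝ) / (G.degree v : ℝ) * xpm)
      else min 1 xpm)

/-- One step of the chain from `A`. -/
def psStep {V : Type*} [Fintype V] [DecidableEq V] [Nonempty V] (G : SimpleGraph V)
    [DecidableRel G.Adj] (x : ℝ) (A : Finset (Sym2 V)) : PMF (Finset (Sym2 V)) :=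
  (uniformOr (if (oddVertices A).card = 0 then Finset.univ else oddVertices A)
      (Classical.arbitrary V)).bind fun u =>
    (uniformOr (G.neighborFinset u) u).bind fun v =>
      (coin (acceptance G x A u v)).map fun b => if b then A ∆ {s(u, v)} else A

/-- The law of the state after `t` steps from `A`. -/
def psRun {V : Type*} [Fintype V] [DecidableEq V] [Nonempty V] (G : SimpleGraph V)
    [DecidableRel G.Adj] (x : ℝ) : ℕ → Finset (Sym2 V) → PMF (Finset (Sym2 V))
  | 0, A => PMF.pure A
  | t + 1, A => (psStep G x A).bind (psRun G x t)

/-! ### The sampling scheme -/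

/-- The explicit mixing time bound
`(2x)⁻¹ (log (8/x) - log δ / m) (3 + 1/(m x)) Δ(G) n⁶ m²`. -/
def mixingBound {V : Type*} [Fintype V] [DecidableEq V] (G : SimpleGraph V) [DecidableRel G.Adj]
    (x δ : ℝ) : ℝ :=
  let n : ℝ := Fintype.card V
  let m : ℝ := G.edgeFinset.card
  1 / (2 * x) * (Real.log (8 / x) - Real.log δ / m) * (3 + 1 / (m * x)) * (G.maxDegree : ℝ)
    * n ^ 6 * m ^ 2

/-- `N` independent draws from `μ`. -/
def iidDraws {α : Type*} (μ : PMF α) : ℕ → PMF (List α)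
  | 0 => PMF.pure []
  | N + 1 => μ.bind fun a => (iidDraws μ N).map fun l => a :: l

/-- The arithmetic mean of a list of reals. -/
def listMean (l : List ℝ) : ℝ := l.sum / l.length

/-- The median of a list of reals (the average of the two middle values for even length). -/
def listMedian (l : List ℝ) : ℝ :=
  let s := l.insertionSort (· ≤ ·)
  (s.getD ((l.length - 1) / 2) 0 + s.getD (l.length / 2) 0) / 2

/-- The output law of the sampling scheme for the event `𝒜` with `S` such that `π(𝒜) ≥ 1/S`:
the median of `7 ⌈log η⁻¹⌉ + 1` independent sample means, each of `20 ⌈S ε⁻² + 1⌉` independent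
indicators of the event that the chain, started in `A₀` and run for the number of steps given by
`mixingBound` with `δ = ε / (16 S)`, ends in `𝒜`. -/
def samplingScheme {V : Type*} [Fintype V] [DecidableEq V] [Nonempty V] (G : SimpleGraph V)
    [DecidableRel G.Adj] (x : ℝ) (𝒜 : Finset (Finset (Sym2 V))) (S ε η : ℝ)
    (A₀ : Finset (Sym2 V)) : PMF ℝ :=
  let Y : PMF ℝ := (psRun G x ⌈mixingBound G x (ε / (16 * S))⌉₊ A₀).map
    fun A => if A ∈ 𝒜 then 1 else 0
  let Ybar : PMF ℝ := (iidDraws Y (20 * ⌈S * (ε ^ 2)⁻¹ + 1⌉₊)).map listMean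
  (iidDraws Ybar (7 * ⌈Real.log η⁻¹⌉₊ + 1)).map listMedian

/-! ### Randomised programs and their running time

A program works on finitely many named two-dimensional arrays of natural numbers and finitely many
named arrays of real numbers, all with random access.  It has sums and truncated differences of
naturals, the four arithmetic operations, logarithm and comparison of reals, uniform integers and
biased coins, branching and counted loops.  Each elementary operation takes one step, except that
rounding a real up to a natural number takes as many steps as counting up to the result. -/

structure Mem where
  nat : ℕ → ℕ → ℕ → ℕ
  real : ℕ → ℕ → ℝ

namespace Mem

def writeNat (M : Mem) (a i j c : ℕ) : Mem :=
  { M with nat := fun a' i' j' => if a' = a ∧ i' = i ∧ j' = j then c else M.nat a' i' j' }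

def writeReal (M : Mem) (a i : ℕ) (y : ℝ) : Mem :=
  { M with real := fun a' i' => if a' = a ∧ i' = i then y else M.real a' i' }

end Mem

/-- Expressions of type `ℕ`; `cell a i j` is the entry `(i, j)` of array `a`. -/
inductive NExp where
  | const (c : ℕ)
  | cell (a : ℕ) (i j : NExp)
  | add (e f : NExp)
  | sub (e f : NExp)

namespace NExp

def val (M : Mem) : NExp → ℕ
  | const c => c
  | cell a i j => M.nat a (i.val M) (j.val M)
  | add e f => e.val M + f.val M
  | sub e f => e.val M - f.val M

def cost : NExp → ℕ
  | const _ => 1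
  | cell _ i j => i.cost + j.cost + 1
  | add e f => e.cost + f.cost + 1
  | sub e f => e.cost + f.cost + 1

end NExp

/-- Expressions of type `ℝ`. -/
inductive RExp where
  | ofNat (e : NExp)
  | cell (a : ℕ) (i : NExp)
  | add (e f : RExp)
  | sub (e f : RExp)
  | mul (e f : RExp)
  | div (e f : RExp)
  | log (e : RExp)

namespace RExp

def val (M : Mem) : RExp → ℝ
  | ofNat e => (e.val M : ℝ)
  | cell a i => M.real a (i.val M)
  | add e f => e.val M + f.val M
  | sub e f => e.val M - f.val M
  | mul e f => e.val M * f.val M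
  | div e f => e.val M / f.val M
  | log e => Real.log (e.val M)

def cost : RExp → ℕ
  | ofNat e => e.cost + 1
  | cell _ i => i.cost + 1
  | add e f => e.cost + f.cost + 1
  | sub e f => e.cost + f.cost + 1
  | mul e f => e.cost + f.cost + 1
  | div e f => e.cost + f.cost + 1
  | log e => e.cost + 1

end RExp

/-- The tests `e ≤ f`. -/
inductive Test where
  | natLe (e f : NExp)
  | realLe (e f : RExp)

namespace Test

def holds (M : Mem) : Test → Prop
  | natLe e f => e.val M ≤ f.val M
  | realLe e f => e.val M ≤ f.val M

def cost : Test → ℕ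
  | natLe e f => e.cost + f.cost + 1
  | realLe e f => e.cost + f.cost + 1

end Test

/-- Programs.  The first arguments of the five kinds of assignment name the cell that is written.
`setUniform` draws from `{0, …, e - 1}`, `setCoin` writes `1` with probability `e` and `0`
otherwise, and `loop e p` runs `p` as many times as `e` says on entry. -/
inductive Prog where
  | skip
  | setNat (a : ℕ) (i j : NExp) (e : NExp)
  | setReal (a : ℕ) (i : NExp) (e : RExp)
  | setCeil (a : ℕ) (i j : NExp) (e : RExp)
  | setUniform (a : ℕ) (i j : NExp) (e : NExp)
  | setCoin (a : ℕ) (i j : NExp) (e : RExp)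
  | seq (p q : Prog)
  | ite (c : Test) (p q : Prog)
  | loop (e : NExp) (p : Prog)

namespace Prog

/-- Run `f` repeatedly, adding up the steps, with one more step per round for the counter. -/
def iterate (f : Mem → PMF (Mem × ℕ)) : ℕ → Mem → PMF (Mem × ℕ)
  | 0, M => PMF.pure (M, 0)
  | r + 1, M => (f M).bind fun s => (iterate f r s.1).map fun s' => (s'.1, s.2 + 1 + s'.2)

open Classical in
/-- The joint law of the final memory and the number of steps. -/
def exec : Prog → Mem → PMF (Mem × ℕ)
  | skip, M => PMF.pure (M, 1)
  | setNat a i j e, M =>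
      PMF.pure (M.writeNat a (i.val M) (j.val M) (e.val M), i.cost + j.cost + e.cost + 1)
  | setReal a i e, M =>
      PMF.pure (M.writeReal a (i.val M) (e.val M), i.cost + e.cost + 1)
  | setCeil a i j e, M =>
      PMF.pure (M.writeNat a (i.val M) (j.val M) ⌈e.val M⌉₊,
        i.cost + j.cost + e.cost + ⌈e.val M⌉₊ + 1)
  | setUniform a i j e, M =>
      (uniformOr (Finset.range (e.val M)) 0).map fun c =>
        (M.writeNat a (i.val M) (j.val M) c, i.cost + j.cost + e.cost + 1)
  | setCoin a i j e, M =>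
      (coin (e.val M)).map fun b =>
        (M.writeNat a (i.val M) (j.val M) (if b then 1 else 0), i.cost + j.cost + e.cost + 1)
  | seq p q, M =>
      (p.exec M).bind fun s => (q.exec s.1).map fun s' => (s'.1, s.2 + s'.2)
  | ite c p q, M =>
      (if c.holds M then p.exec M else q.exec M).map fun s => (s.1, c.cost + s.2)
  | loop e p, M =>
      (iterate p.exec (e.val M) M).map fun s => (s.1, e.cost + 1 + s.2)

/-- The law of the output, read from entry `0` of real array `1`. -/
def output (p : Prog) (M : Mem) : PMF ℝ := (p.exec M).map fun s => s.1.real 1 0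

/-- Whatever the random choices, `p` started on `M` takes at most `T` steps. -/
def RunsWithin (p : Prog) (M : Mem) (T : ℝ) : Prop :=
  ∀ s ∈ (p.exec M).support, (s.2 : ℝ) ≤ T

end Prog

/-- The input: `n`, the adjacency matrix of `G`, `u` and `v` in natural arrays `0`, `1`, `2`, `3`,
and `x, ε, η` in real array `0`.  All other entries are `0`. -/
def inputMem {n : ℕ} (G : SimpleGraph (Fin n)) [DecidableRel G.Adj] (x : ℝ) (u v : Fin n)
    (ε η : ℝ) : Mem where
  nat := fun a i j => match a with
    | 0 => if i = 0 ∧ j = 0 then n else 0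
    | 1 => if h : i < n ∧ j < n then (if G.Adj ⟨i, h.1⟩ ⟨j, h.2⟩ then 1 else 0) else 0
    | 2 => if i = 0 ∧ j = 0 then u else 0
    | 3 => if i = 0 ∧ j = 0 then v else 0
    | _ => 0
  real := fun a i => match a, i with
    | 0, 0 => x
    | 0, 1 => ε
    | 0, 2 => η
    | _, _ => 0

/-! ### Fully polynomial randomised approximation schemes -/

/-- The problem instances for a given `k`: a finite connected graph, an inverse temperature
`β > 0`, and two distinct vertices at graph distance at most `k`. -/
structure IsInstance (k : ℕ) {n : ℕ} (G : SimpleGraph (Fin n)) (β : ℝ) (u v : Fin n) : Prop where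
  connected : G.Connected
  pos : 0 < β
  ne : u ≠ v
  dist_le : G.dist u v ≤ k

/-- The law `μ` approximates `q` within ratio `1 ± ε` with probability at least `1 - η`. -/
def Approximates (μ : PMF ℝ) (q ε η : ℝ) : Prop :=
  ENNReal.ofReal (1 - η) ≤ μ.toMeasure (Set.Icc ((1 - ε) * q) ((1 + ε) * q))

/-- `p` is an fpras for the quantity `q` on the instances with parameter `k`: on every instance and
for all `ε, η ∈ (0, 1/4)` it runs in time bounded by a fixed polynomial in `n`, `x⁻¹`, `ε⁻¹` and
`η⁻¹`, where `x = tanh β`, and its output approximates `q`. -/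
def IsFPRAS (k : ℕ) (p : Prog)
    (q : ∀ (n : ℕ) (G : SimpleGraph (Fin n)) [DecidableRel G.Adj], ℝ → Fin n → Fin n → ℝ) : Prop :=
  ∃ P : MvPolynomial (Fin 4) ℝ,
    ∀ (n : ℕ) (G : SimpleGraph (Fin n)) [DecidableRel G.Adj] (β : ℝ) (u v : Fin n),
      IsInstance k G β u v →
      ∀ ε ∈ Set.Ioo (0 : ℝ) (1 / 4), ∀ η ∈ Set.Ioo (0 : ℝ) (1 / 4),
        p.RunsWithin (inputMem G (Real.tanh β) u v ε η)
          (MvPolynomial.eval ![(n : ℝ), (Real.tanh β)⁻¹, ε⁻¹, η⁻¹] P) ∧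
        Approximates (p.output (inputMem G (Real.tanh β) u v ε η)) (q n G β u v) ε η

end

/-! There are three layers: the algebra of high-temperature graphs, rapid mixing of the chain, and
an implementation of the scheme in the program language.

Algebra. For a sign s, exp(βs) = cosh β (1 + x s). Expanding the Gibbs weight over the edges and
summing over the spins gives ⟨σ_W⟩ = Z_W / Z_∅, where Z_W = ∑_{∂A = W} x^|A| is `loopSum`. Since
correlations are at most 1, Z_W ≤ Z_∅ for every W (`loopSum_le`); this is the only correlation
inequality used. The normalisation of π is ∑_W c(W) Z_W with ∑_W c(W) = n + 2·C(n,2) = n², hence at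
most n² Z_∅. So π(𝒞_0) ≥ 1/n, and toggling a shortest path gives Z_uv ≥ x^k Z_∅, hence the lower
bound for π(𝒞_uv).

Mixing. Canonical paths join only pairs (F, I) with F even. Then D = F ∆ I has the boundary of I, so
D lies in 𝒲 and can be unwound edge by edge inside 𝒲. For fixed D and e, the state A at which e is
toggled determines F, and |F| + |F ∆ D| = |A ∪ e| + |D ∆ (A ∪ e)|. The sum over D costs ∑_D c(∂D)
x^|D ∆ (A ∪ e)| ≤ n² Z_∅, again because Z_W ≤ Z_∅. This yields `poincare` with constant 2Δmn². No
spectral theory is needed: the chain moves with probability at most 1/2, so by Cauchy–Schwarz each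
step lowers the variance by at least half the Dirichlet form (`wormVar_psStep_le`). Iterating, and
keeping one term of the variance, gives `abs_psRun_sub_le`.

Accuracy. By Chebyshev each sample mean fails with probability at most 1/16 (`pmfLE_listMean_le`);
an exponential moment shows that the median of K means fails with probability at most 2^(-K)
(`pmfLE_listMedian_le`). The correlation is n/2 times a quotient of two such probabilities, each
estimated to within ε/4 with failure probability η/2 (`Approximates.div`).

Programs. `Coupled` couples the execution of a program with a target law so that the memory
represents the drawn value and the step count is bounded surely. It composes along the syntax and
yields both the exact output law and the running time (`pairProg_spec`, `corrProg_spec`). All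
parameters are dominated by z = 4 n x⁻¹ ε⁻¹ η⁻¹, and the step counts by a power of z
(`le_timePoly`). -/

set_option linter.unusedSectionVars false
set_option linter.deprecated false

noncomputable section

/-! ### Boundaries of edge sets -/

section Boundary

variable {V : Type*} [Fintype V] [DecidableEq V]

theorem Finset.odd_card_symmDiff {α : Type*} [DecidableEq α] (s t : Finset α) :
    Odd (s ∆ t).card ↔ ¬ (Odd s.card ↔ Odd t.card) := by
  have h1 : (s ∆ t).card = (s \ t).card + (t \ s).card := by
    rw [symmDiff_def, Finset.sup_eq_union, Finset.card_union_of_disjoint disjoint_sdiff_sdiff]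
  have h2 := Finset.card_sdiff_add_card_inter s t
  have h3 := Finset.card_sdiff_add_card_inter t s
  rw [Finset.inter_comm t s] at h3
  rw [h1, ← h2, ← h3]
  simp only [Nat.odd_add, ← Nat.not_odd_iff_even]
  tauto

theorem mem_oddVertices {A : Finset (Sym2 V)} {v : V} :
    v ∈ oddVertices A ↔ Odd (A.filter fun e => v ∈ e).card := by
  simp [oddVertices]

/-- Degrees mod 2 are additive under symmetric difference. This makes ∂ a linear map over 𝔽₂ and
reduces every boundary computation below to set algebra. -/
theorem oddVertices_symmDiff (A B : Finset (Sym2 V)) :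
    oddVertices (A ∆ B) = oddVertices A ∆ oddVertices B := by
  ext v
  have : (A ∆ B).filter (fun e => v ∈ e) =
      (A.filter fun e => v ∈ e) ∆ (B.filter fun e => v ∈ e) := by
    ext e; simp only [Finset.mem_filter, Finset.mem_symmDiff]; tauto
  rw [Finset.mem_symmDiff, mem_oddVertices, mem_oddVertices, mem_oddVertices, this,
    Finset.odd_card_symmDiff]
  tauto

@[simp] theorem oddVertices_empty : oddVertices (∅ : Finset (Sym2 V)) = ∅ := by
  ext v; simp [mem_oddVertices]

theorem oddVertices_singleton (u v : V) :
    oddVertices ({s(u, v)} : Finset (Sym2 V)) = {u, v} := by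
  ext w
  rw [mem_oddVertices, Finset.filter_singleton]
  by_cases hw : w = u ∨ w = v
  · rw [if_pos (by simpa using hw)]; simpa using hw
  · rw [if_neg (by simpa using hw)]; simpa using hw

theorem oddVertices_toggle (A : Finset (Sym2 V)) (u v : V) :
    oddVertices (A ∆ {s(u, v)}) = oddVertices A ∆ {u, v} := by
  rw [oddVertices_symmDiff, oddVertices_singleton]

variable (G : SimpleGraph V) [DecidableRel G.Adj]

variable {G} in
-- A trail repeats no edge, so its edge set has the degrees counted along the walk: each passage
-- through a vertex uses two edges, and only the two ends are left with an odd number.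
theorem oddVertices_edges {u v : V} (huv : u ≠ v) {p : G.Walk u v} (hp : p.IsTrail) :
    oddVertices p.edges.toFinset = {u, v} := by
  ext w
  have h1 : (p.edges.toFinset.filter fun e => w ∈ e).card =
      p.edges.countP fun e => w ∈ e := by
    rw [List.countP_eq_length_filter,
      ← List.toFinset_card_of_nodup (hp.edges_nodup.filter _), List.toFinset_filter]
    simp
  rw [mem_oddVertices, h1, ← Nat.not_even_iff_odd, hp.even_countP_edges_iff w]
  simp only [Finset.mem_insert, Finset.mem_singleton]
  tauto

variable {G} in
theorem mem_graphsWithBoundary {W : Finset V} {A : Finset (Sym2 V)} :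
    A ∈ graphsWithBoundary G W ↔ A ⊆ G.edgeFinset ∧ oddVertices A = W := by
  simp [graphsWithBoundary]

variable {G} in
theorem mem_wormSpace {A : Finset (Sym2 V)} :
    A ∈ wormSpace G ↔
      A ⊆ G.edgeFinset ∧ ((oddVertices A).card = 0 ∨ (oddVertices A).card = 2) := by
  simp [wormSpace]

theorem empty_mem_wormSpace : ∅ ∈ wormSpace G := by
  simp [mem_wormSpace]

variable {G} in
theorem symmDiff_subset_edgeFinset {A B : Finset (Sym2 V)} (hA : A ⊆ G.edgeFinset)
    (hB : B ⊆ G.edgeFinset) : A ∆ B ⊆ G.edgeFinset := by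
  intro e he
  rcases Finset.mem_symmDiff.1 he with h | h
  exacts [hA h.1, hB h.1]

variable {G} in
theorem symmDiff_mem_graphsWithBoundary {A B : Finset (Sym2 V)} {W W' : Finset V}
    (hA : A ∈ graphsWithBoundary G W) (hB : B ∈ graphsWithBoundary G W') :
    A ∆ B ∈ graphsWithBoundary G (W ∆ W') := by
  rw [mem_graphsWithBoundary] at *
  exact ⟨symmDiff_subset_edgeFinset hA.1 hB.1, by rw [oddVertices_symmDiff, hA.2, hB.2]⟩

variable {G} in
theorem edges_mem_graphsWithBoundary {u v : V} (huv : u ≠ v) {p : G.Walk u v} (hp : p.IsTrail) :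
    p.edges.toFinset ∈ graphsWithBoundary G {u, v} := by
  rw [mem_graphsWithBoundary]
  refine ⟨fun e he => ?_, oddVertices_edges huv hp⟩
  rw [SimpleGraph.mem_edgeFinset]
  exact p.edges_subset_edgeSet (by simpa using he)

/-- Toggling a fixed edge set is an involution, and toggling a trail from u to v changes the
boundary by {u, v}. -/
theorem bijOn_symmDiff_path {u v : V} (huv : u ≠ v) {p : G.Walk u v} (hp : p.IsTrail) :
    Set.BijOn (fun A : Finset (Sym2 V) => A ∆ p.edges.toFinset)
      (graphsWithBoundary G {u, v}) (graphsWithBoundary G ∅) := by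
  have hP := edges_mem_graphsWithBoundary huv hp
  refine ⟨fun A hA => ?_, fun A _ B _ h => symmDiff_left_injective _ h, fun B hB => ?_⟩
  · have := symmDiff_mem_graphsWithBoundary (Finset.mem_coe.1 hA) hP
    rwa [symmDiff_self] at this
  · refine ⟨B ∆ p.edges.toFinset, ?_, symmDiff_symmDiff_cancel_right _ _⟩
    have := symmDiff_mem_graphsWithBoundary (Finset.mem_coe.1 hB) hP
    rwa [Finset.mem_coe, ← bot_symmDiff ({u, v} : Finset V)]

/-! ### The high-temperature expansion -/

/-- The high-temperature partition function `∑_{∂A = W} x^|A|`. -/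
def loopSum (x : ℝ) (W : Finset V) : ℝ := ∑ A ∈ graphsWithBoundary G W, x ^ A.card

/-- The value `±1` of a spin configuration at a vertex. -/
def spinVal (σ : V → ℤˣ) (v : V) : ℝ := ((σ v : ℤ) : ℝ)

/-- The interaction `σ_a σ_b` along an edge. -/
def bond (σ : V → ℤˣ) (e : Sym2 V) : ℝ :=
  Sym2.lift ⟨fun a b => spinVal σ a * spinVal σ b, fun _ _ => mul_comm _ _⟩ e

theorem isingCorr_eq (β : ℝ) (W : Finset V) :
    isingCorr G β W =
      (∑ σ : V → ℤˣ, (∏ v ∈ W, spinVal σ v) * Real.exp (β * ∑ e ∈ G.edgeFinset, bond σ e)) /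
        ∑ σ : V → ℤˣ, Real.exp (β * ∑ e ∈ G.edgeFinset, bond σ e) := rfl

theorem spinVal_eq_or (σ : V → ℤˣ) (v : V) : spinVal σ v = 1 ∨ spinVal σ v = -1 := by
  rcases Int.units_eq_one_or (σ v) with h | h <;> simp [spinVal, h]

theorem bond_eq_or (σ : V → ℤˣ) (e : Sym2 V) : bond σ e = 1 ∨ bond σ e = -1 := by
  induction e using Sym2.ind with
  | _ a b =>
    simp only [bond, Sym2.lift_mk]
    rcases spinVal_eq_or σ a with h | h <;> rcases spinVal_eq_or σ b with h' | h' <;> simp [h, h']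

/-- Every function of a sign is affine; here the even part is cosh β and the odd part sinh β. -/
theorem exp_mul_bond (β : ℝ) (σ : V → ℤˣ) (e : Sym2 V) :
    Real.exp (β * bond σ e) = Real.cosh β * (1 + Real.tanh β * bond σ e) := by
  have hc : Real.cosh β * Real.tanh β = Real.sinh β := by
    rw [Real.tanh_eq_sinh_div_cosh]; field_simp [(Real.cosh_pos β).ne']
  rw [mul_add, mul_one, ← mul_assoc, hc]
  rcases bond_eq_or σ e with h | h <;> rw [h]
  · rw [mul_one, mul_one, Real.cosh_add_sinh]
  · rw [mul_neg_one, mul_neg_one, ← sub_eq_add_neg, Real.cosh_sub_sinh]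

theorem bond_eq_prod (σ : V → ℤˣ) {e : Sym2 V} (he : ¬ e.IsDiag) :
    bond σ e = ∏ v, if v ∈ e then spinVal σ v else 1 := by
  induction e using Sym2.ind with
  | _ a b =>
    have hab : a ≠ b := by simpa using he
    rw [← Finset.prod_filter]
    have : (Finset.univ.filter fun v => v ∈ s(a, b)) = {a, b} := by ext; simp
    rw [this, Finset.prod_pair hab]; rfl

theorem sum_units_pow (k : ℕ) : ∑ s : ℤˣ, ((s : ℤ) : ℝ) ^ k = if Even k then 2 else 0 := by
  have : (Finset.univ : Finset ℤˣ) = {1, -1} := by decide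
  rw [this, Finset.sum_pair (by decide)]
  rcases Nat.even_or_odd k with h | h
  · rw [if_pos h]; simp [h.neg_one_pow]; norm_num
  · rw [if_neg (by simpa using h)]; simp [h.neg_one_pow]

/-- The spin at v occurs to the power [v ∈ W] + deg_A(v), so the sum factorises over the vertices. A
factor is 2 for an even exponent and 0 for an odd one; all are even exactly when ∂A = W. -/
theorem sum_spin_prod {A : Finset (Sym2 V)} (hA : ∀ e ∈ A, ¬ e.IsDiag) (W : Finset V) :
    ∑ σ : V → ℤˣ, (∏ v ∈ W, spinVal σ v) * ∏ e ∈ A, bond σ e =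
      if oddVertices A = W then 2 ^ Fintype.card V else 0 := by
  have h1 : ∀ σ : V → ℤˣ, (∏ v ∈ W, spinVal σ v) * ∏ e ∈ A, bond σ e =
      ∏ v, ((σ v : ℤ) : ℝ) ^ ((if v ∈ W then 1 else 0) + (A.filter fun e => v ∈ e).card) := by
    intro σ
    rw [Finset.prod_congr rfl fun e he => bond_eq_prod σ (hA e he), Finset.prod_comm]
    have : ∏ v ∈ W, spinVal σ v = ∏ v, spinVal σ v ^ (if v ∈ W then 1 else 0) := by
      rw [← Finset.prod_filter_mul_prod_filter_not Finset.univ (· ∈ W)]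
      rw [Finset.prod_congr (s₁ := Finset.univ.filter (· ∉ W)) rfl
        (g := fun _ => 1) (fun v hv => by simp [(Finset.mem_filter.1 hv).2])]
      simp only [Finset.prod_const_one, mul_one]
      rw [Finset.filter_mem_eq_inter, Finset.univ_inter]
      exact Finset.prod_congr rfl fun v hv => by simp [hv]
    rw [this, ← Finset.prod_mul_distrib]
    refine Finset.prod_congr rfl fun v _ => ?_
    rw [pow_add, ← Finset.prod_filter, Finset.prod_const]
    rfl
  rw [Finset.sum_congr rfl fun σ _ => h1 σ]
  have h2 := Finset.prod_univ_sum (fun _ : V => (Finset.univ : Finset ℤˣ))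
    (fun v s => ((s : ℤ) : ℝ) ^ ((if v ∈ W then 1 else 0) + (A.filter fun e => v ∈ e).card))
  -- A sum over all spin configurations of a product over vertices is a product of single-spin sums.
  rw [Fintype.piFinset_univ] at h2
  rw [← h2]
  simp only [sum_units_pow]
  have h3 : ∀ v, Even ((if v ∈ W then 1 else 0) + (A.filter fun e => v ∈ e).card) ↔
      (v ∈ oddVertices A ↔ v ∈ W) := by
    intro v
    rw [mem_oddVertices, Nat.even_add, ← Nat.not_even_iff_odd]
    by_cases hv : v ∈ W <;> simp [hv]
  simp only [h3]
  by_cases h : oddVertices A = W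
  · simp [h, Finset.prod_const, Finset.card_univ]
  · rw [if_neg h]
    obtain ⟨v, hv⟩ : ∃ v, ¬ (v ∈ oddVertices A ↔ v ∈ W) := by
      by_contra! hc; exact h (Finset.ext hc)
    exact Finset.prod_eq_zero (Finset.mem_univ v) (if_neg hv)

/-- Multiplying out ∏ (1 + x σ_a σ_b) over the edges gives a sum over edge sets A, of which
`sum_spin_prod` keeps those with boundary W. -/
theorem sum_spin_exp (β : ℝ) (W : Finset V) :
    ∑ σ : V → ℤˣ, (∏ v ∈ W, spinVal σ v) * Real.exp (β * ∑ e ∈ G.edgeFinset, bond σ e) =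
      Real.cosh β ^ G.edgeFinset.card * 2 ^ Fintype.card V * loopSum G (Real.tanh β) W := by
  have h1 : ∀ σ : V → ℤˣ, Real.exp (β * ∑ e ∈ G.edgeFinset, bond σ e) =
      Real.cosh β ^ G.edgeFinset.card *
        ∑ A ∈ G.edgeFinset.powerset, Real.tanh β ^ A.card * ∏ e ∈ A, bond σ e := by
    intro σ
    rw [Finset.mul_sum, Real.exp_sum, Finset.prod_congr rfl fun e _ => exp_mul_bond β σ e,
      Finset.prod_mul_distrib, Finset.prod_const, Finset.prod_one_add]
    simp only [Finset.prod_mul_distrib, Finset.prod_const]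
  simp_rw [h1, Finset.mul_sum]
  rw [Finset.sum_comm]
  have h2 : ∀ A ∈ G.edgeFinset.powerset, ∑ σ : V → ℤˣ, (∏ v ∈ W, spinVal σ v) *
      (Real.cosh β ^ G.edgeFinset.card * (Real.tanh β ^ A.card * ∏ e ∈ A, bond σ e)) =
      Real.cosh β ^ G.edgeFinset.card * 2 ^ Fintype.card V *
        if oddVertices A = W then Real.tanh β ^ A.card else 0 := by
    intro A hA
    have hd : ∀ e ∈ A, ¬ e.IsDiag := fun e he =>
      G.not_isDiag_of_mem_edgeFinset (Finset.mem_powerset.1 hA he)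
    calc _ = Real.cosh β ^ G.edgeFinset.card * Real.tanh β ^ A.card *
          ∑ σ : V → ℤˣ, (∏ v ∈ W, spinVal σ v) * ∏ e ∈ A, bond σ e := by
          rw [Finset.mul_sum]; exact Finset.sum_congr rfl fun σ _ => by ring
      _ = _ := by rw [sum_spin_prod hd]; split_ifs <;> ring
  rw [Finset.sum_congr rfl h2, ← Finset.mul_sum, ← Finset.sum_filter]
  rfl

variable {G}

theorem loopSum_pos {x : ℝ} (hx : 0 < x) : 0 < loopSum G x ∅ :=
  Finset.sum_pos (fun A _ => by positivity)
    ⟨∅, mem_graphsWithBoundary.2 ⟨Finset.empty_subset _, oddVertices_empty⟩⟩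

theorem loopSum_nonneg {x : ℝ} (hx : 0 < x) (W : Finset V) : 0 ≤ loopSum G x W :=
  Finset.sum_nonneg fun A _ => by positivity

theorem isingCorr_eq_loopSum_div (β : ℝ) (W : Finset V) :
    isingCorr G β W = loopSum G (Real.tanh β) W / loopSum G (Real.tanh β) ∅ := by
  have h0 := sum_spin_exp G β ∅
  simp only [Finset.prod_empty, one_mul] at h0
  rw [isingCorr_eq, h0, sum_spin_exp, mul_div_mul_left]
  have := Real.cosh_pos β
  positivity

theorem isingCorr_le_one (β : ℝ) (W : Finset V) : isingCorr G β W ≤ 1 := by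
  rw [isingCorr_eq]
  refine div_le_one_of_le₀ (Finset.sum_le_sum fun σ _ => ?_)
    (Finset.sum_nonneg fun σ _ => (Real.exp_pos _).le)
  refine mul_le_of_le_one_left (Real.exp_pos _).le ?_
  refine (le_abs_self _).trans ?_
  rw [Finset.abs_prod]
  refine Finset.prod_le_one (fun _ _ => abs_nonneg _) fun v _ => ?_
  rcases spinVal_eq_or σ v with h | h <;> simp [h]

theorem exists_tanh_eq {x : ℝ} (hx0 : 0 < x) (hx1 : x < 1) : ∃ β, 0 < β ∧ Real.tanh β = x :=
  ⟨Real.artanh x, Real.artanh_pos ⟨hx0, hx1⟩, Real.tanh_artanh ⟨by linarith, hx1⟩⟩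

/-- The quotient of the two sides is an Ising correlation at inverse temperature artanh x, hence at
most 1. This one inequality bounds both the normalisation of π and the congestion of the canonical
paths. -/
theorem loopSum_le {x : ℝ} (hx0 : 0 < x) (hx1 : x < 1) (W : Finset V) :
    loopSum G x W ≤ loopSum G x ∅ := by
  obtain ⟨β, -, rfl⟩ := exists_tanh_eq hx0 hx1
  have h := isingCorr_le_one (G := G) β W
  rwa [isingCorr_eq_loopSum_div, div_le_one (loopSum_pos hx0)] at h

end Boundary

/-! ### The stationary weights -/

section Weights

variable {V : Type*} [Fintype V] [DecidableEq V]

/-- The weight of a configuration with boundary `W`, apart from the factor `x^|A|`. -/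
def boundaryCoeff (W : Finset V) : ℝ :=
  if W.card = 0 then (Fintype.card V : ℝ) else if W.card = 2 then 2 else 0

theorem wormWeight_eq (x : ℝ) (A : Finset (Sym2 V)) :
    wormWeight x A = boundaryCoeff (oddVertices A) * x ^ A.card := rfl

theorem boundaryCoeff_nonneg (W : Finset V) : 0 ≤ boundaryCoeff W := by
  unfold boundaryCoeff; split_ifs <;> positivity

theorem wormWeight_nonneg {x : ℝ} (hx : 0 < x) (A : Finset (Sym2 V)) : 0 ≤ wormWeight x A :=
  mul_nonneg (boundaryCoeff_nonneg _) (by positivity)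

/-- The empty boundary contributes n and the C(n,2) pairs contribute 2 each. -/
theorem sum_boundaryCoeff : ∑ W : Finset V, boundaryCoeff W = (Fintype.card V : ℝ) ^ 2 := by
  have h : ∀ W : Finset V, boundaryCoeff W =
      (if W ∈ Finset.powersetCard 0 Finset.univ then (Fintype.card V : ℝ) else 0) +
        (if W ∈ Finset.powersetCard 2 Finset.univ then 2 else 0) := by
    intro W
    simp only [boundaryCoeff, Finset.mem_powersetCard_univ]
    split_ifs <;> first | omega | simp
  rw [Finset.sum_congr rfl fun W _ => h W, Finset.sum_add_distrib, ← Finset.sum_filter,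
    ← Finset.sum_filter, Finset.filter_mem_eq_inter, Finset.filter_mem_eq_inter,
    Finset.univ_inter, Finset.univ_inter, Finset.sum_const, Finset.sum_const,
    Finset.card_powersetCard, Finset.card_powersetCard, Finset.card_univ]
  simp only [Nat.choose_zero_right, one_smul, nsmul_eq_mul]
  rw [Nat.cast_choose_two]
  ring

variable (G : SimpleGraph V) [DecidableRel G.Adj]

theorem sum_powerset_boundary (c : Finset V → ℝ) (h : Finset (Sym2 V) → ℝ) :
    ∑ A ∈ G.edgeFinset.powerset, c (oddVertices A) * h A =
      ∑ W, c W * ∑ A ∈ graphsWithBoundary G W, h A := by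
  rw [← Finset.sum_fiberwise G.edgeFinset.powerset oddVertices]
  refine Finset.sum_congr rfl fun W _ => ?_
  rw [Finset.mul_sum]
  exact Finset.sum_congr rfl fun A hA => by rw [(Finset.mem_filter.1 hA).2]

theorem sum_wormSpace_boundary (h : Finset (Sym2 V) → ℝ) :
    ∑ A ∈ wormSpace G, boundaryCoeff (oddVertices A) * h A =
      ∑ W, boundaryCoeff W * ∑ A ∈ graphsWithBoundary G W, h A := by
  rw [← sum_powerset_boundary, wormSpace, Finset.sum_filter]
  refine Finset.sum_congr rfl fun A _ => ?_
  split_ifs with hA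
  · rfl
  · rw [not_or] at hA
    rw [boundaryCoeff, if_neg hA.1, if_neg hA.2, zero_mul]

variable {G}

/-- The substitution A ↦ A ∆ B permutes the edge sets and shifts the boundary by ∂B. -/
theorem loopSum_symmDiff {x : ℝ} (W : Finset V) {B : Finset (Sym2 V)} (hB : B ⊆ G.edgeFinset) :
    ∑ A ∈ graphsWithBoundary G W, x ^ (A ∆ B).card = loopSum G x (W ∆ oddVertices B) := by
  have hB' : B ∈ graphsWithBoundary G (oddVertices B) := mem_graphsWithBoundary.2 ⟨hB, rfl⟩
  refine Finset.sum_bij' (fun A _ => A ∆ B) (fun A _ => A ∆ B)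
    (fun A hA => symmDiff_mem_graphsWithBoundary hA hB') (fun A hA => ?_)
    (fun A _ => symmDiff_symmDiff_cancel_right _ _)
    (fun A _ => symmDiff_symmDiff_cancel_right _ _) (fun A _ => rfl)
  have := symmDiff_mem_graphsWithBoundary hA hB'
  rwa [symmDiff_symmDiff_cancel_right] at this

/-- For each boundary W the shifted sum is some Z_{W'} ≤ Z_∅, even when W' has four vertices and
lies outside 𝒲. For B = ∅ this bounds the normalisation; for general B it is the congestion
estimate. -/
theorem sum_wormSpace_symmDiff_le {x : ℝ} (hx0 : 0 < x) (hx1 : x < 1) {B : Finset (Sym2 V)}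
    (hB : B ⊆ G.edgeFinset) :
    ∑ A ∈ wormSpace G, boundaryCoeff (oddVertices A) * x ^ (A ∆ B).card ≤
      (Fintype.card V : ℝ) ^ 2 * loopSum G x ∅ := by
  rw [sum_wormSpace_boundary, ← sum_boundaryCoeff, Finset.sum_mul]
  refine Finset.sum_le_sum fun W _ => mul_le_mul_of_nonneg_left ?_ (boundaryCoeff_nonneg W)
  rw [loopSum_symmDiff W hB]
  exact loopSum_le hx0 hx1 _

variable (G) in
/-- The normalisation of the stationary distribution. -/
def wormTotal (x : ℝ) : ℝ := ∑ A ∈ wormSpace G, wormWeight x A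

theorem wormTotal_le {x : ℝ} (hx0 : 0 < x) (hx1 : x < 1) :
    wormTotal G x ≤ (Fintype.card V : ℝ) ^ 2 * loopSum G x ∅ := by
  have := sum_wormSpace_symmDiff_le (G := G) hx0 hx1 (Finset.empty_subset _)
  simpa [wormTotal, wormWeight_eq, symmDiff_bot, ← Finset.bot_eq_empty] using this

theorem graphsWithBoundary_subset {W : Finset V} (hW : W.card = 0 ∨ W.card = 2) :
    graphsWithBoundary G W ⊆ wormSpace G := by
  intro A hA
  rw [mem_graphsWithBoundary] at hA
  rw [mem_wormSpace, hA.2]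
  exact ⟨hA.1, hW⟩

theorem wormProb_graphsWithBoundary (x : ℝ) {W : Finset V} (hW : W.card = 0 ∨ W.card = 2) :
    wormProb G x (graphsWithBoundary G W) = boundaryCoeff W * loopSum G x W / wormTotal G x := by
  rw [wormProb, Finset.inter_eq_left.2 (graphsWithBoundary_subset hW), wormTotal, loopSum,
    Finset.mul_sum]
  congr 1
  exact Finset.sum_congr rfl fun A hA => by
    rw [wormWeight_eq, (mem_graphsWithBoundary.1 hA).2]

theorem wormWeight_pos [Nonempty V] {x : ℝ} (hx : 0 < x) {A : Finset (Sym2 V)}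
    (hA : A ∈ wormSpace G) : 0 < wormWeight x A := by
  rw [wormWeight_eq]
  refine mul_pos ?_ (by positivity)
  have : 0 < (Fintype.card V : ℝ) := by exact_mod_cast Fintype.card_pos
  rcases (mem_wormSpace.1 hA).2 with h | h <;> simp [boundaryCoeff, h, this]

theorem wormTotal_pos [Nonempty V] {x : ℝ} (hx : 0 < x) : 0 < wormTotal G x :=
  Finset.sum_pos (fun _ hA => wormWeight_pos hx hA) ⟨∅, empty_mem_wormSpace G⟩

theorem boundaryCoeff_empty : boundaryCoeff (∅ : Finset V) = Fintype.card V := by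
  simp [boundaryCoeff]

theorem boundaryCoeff_pair {u v : V} (h : u ≠ v) : boundaryCoeff ({u, v} : Finset V) = 2 := by
  simp [boundaryCoeff, Finset.card_pair h]

theorem wormProb_empty_ge [Nonempty V] {x : ℝ} (hx0 : 0 < x) (hx1 : x < 1) :
    (Fintype.card V : ℝ)⁻¹ ≤ wormProb G x (graphsWithBoundary G ∅) := by
  have hn : 0 < (Fintype.card V : ℝ) := by exact_mod_cast Fintype.card_pos
  rw [wormProb_graphsWithBoundary x (Or.inl rfl), boundaryCoeff_empty,
    le_div_iff₀ (wormTotal_pos hx0), inv_mul_le_iff₀ hn]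
  have := wormTotal_le (G := G) hx0 hx1
  linarith [this]

/-- Toggling a shortest path adds at most k edges to an even subgraph, so each weight drops by at
most the factor x^k. -/
theorem loopSum_pair_ge {x : ℝ} (hx0 : 0 < x) (hx1 : x < 1) {u v : V} (huv : u ≠ v) {k : ℕ}
    (hc : G.Connected) (hk : G.dist u v ≤ k) : x ^ k * loopSum G x ∅ ≤ loopSum G x {u, v} := by
  obtain ⟨p, hp, hl⟩ := hc.exists_path_of_dist u v
  have hP := edges_mem_graphsWithBoundary huv hp.isTrail
  have h1 := loopSum_symmDiff (G := G) (x := x) ∅ (mem_graphsWithBoundary.1 hP).1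
  rw [(mem_graphsWithBoundary.1 hP).2, ← Finset.bot_eq_empty, bot_symmDiff] at h1
  rw [← h1, loopSum, Finset.mul_sum]
  refine Finset.sum_le_sum fun A _ => ?_
  rw [← pow_add]
  refine pow_le_pow_of_le_one hx0.le hx1.le ?_
  have h2 : (A ∆ p.edges.toFinset).card ≤ (A ∪ p.edges.toFinset).card :=
    Finset.card_le_card (by simpa using symmDiff_le_sup (a := A) (b := p.edges.toFinset))
  have h3 := Finset.card_union_le A p.edges.toFinset
  have h4 := p.edges.toFinset_card_le
  rw [SimpleGraph.Walk.length_edges] at h4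
  omega

theorem wormProb_pair_ge {x : ℝ} (hx0 : 0 < x) (hx1 : x < 1) {u v : V} (huv : u ≠ v) {k : ℕ}
    (hc : G.Connected) (hk : G.dist u v ≤ k) :
    2 * x ^ k / ((Fintype.card V : ℝ) * ((Fintype.card V : ℝ) + 1)) ≤
      wormProb G x (graphsWithBoundary G {u, v}) := by
  have : Nonempty V := ⟨u⟩
  have hn : 0 < (Fintype.card V : ℝ) := by exact_mod_cast Fintype.card_pos
  have h1 := loopSum_pair_ge hx0 hx1 huv hc hk
  have h2 := wormTotal_le (G := G) hx0 hx1
  have h0 := loopSum_pos (G := G) hx0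
  have hxk : 0 < x ^ k := by positivity
  rw [wormProb_graphsWithBoundary x (Or.inr (Finset.card_pair huv)), boundaryCoeff_pair huv,
    div_le_div_iff₀ (by positivity) (wormTotal_pos hx0)]
  calc 2 * x ^ k * wormTotal G x ≤ 2 * x ^ k * ((Fintype.card V : ℝ) ^ 2 * loopSum G x ∅) := by
        gcongr
    _ = 2 * (x ^ k * loopSum G x ∅) * (Fintype.card V : ℝ) ^ 2 := by ring
    -- The argument so far gives the constant n²; it is relaxed here to n(n + 1).
    _ ≤ 2 * loopSum G x {u, v} * ((Fintype.card V : ℝ) * ((Fintype.card V : ℝ) + 1)) := by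
        have : 0 ≤ loopSum G x {u, v} := loopSum_nonneg hx0 _
        gcongr
        nlinarith

theorem isingCorr_pair_eq [Nonempty V] {β : ℝ} (hβ : 0 < Real.tanh β) {u v : V} (huv : u ≠ v) :
    isingCorr G β {u, v} = (Fintype.card V : ℝ) / 2 *
      (wormProb G (Real.tanh β) (graphsWithBoundary G {u, v}) /
        wormProb G (Real.tanh β) (graphsWithBoundary G ∅)) := by
  have hn : 0 < (Fintype.card V : ℝ) := by exact_mod_cast Fintype.card_pos
  have h0 := loopSum_pos (G := G) hβ
  have hT := wormTotal_pos (G := G) hβ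
  rw [isingCorr_eq_loopSum_div, wormProb_graphsWithBoundary _ (W := ∅) (Or.inl rfl),
    wormProb_graphsWithBoundary _ (Or.inr (Finset.card_pair huv)), boundaryCoeff_pair huv,
    boundaryCoeff_empty]
  field_simp

end Weights

/-! ### Expectations over finite types -/

section Expectation

variable {α β : Type*} [Fintype α] [Fintype β]

/-- The expectation of `g` under `μ`. -/
def pmfExp (μ : PMF α) (g : α → ℝ) : ℝ := ∑ a, (μ a).toReal * g a

theorem sum_toReal_pmf (μ : PMF α) : ∑ a, (μ a).toReal = 1 := by
  rw [← ENNReal.toReal_sum fun a _ => μ.apply_ne_top a, ← tsum_fintype (L := .unconditional α),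
    μ.tsum_coe, ENNReal.toReal_one]

theorem pmfExp_pure (a : α) (g : α → ℝ) : pmfExp (PMF.pure a) g = g a := by
  classical
  rw [pmfExp, Finset.sum_eq_single a]
  · simp [PMF.pure_apply]
  · intro b _ hb; simp [PMF.pure_apply, hb]
  · simp

theorem pmfExp_bind (μ : PMF α) (κ : α → PMF β) (g : β → ℝ) :
    pmfExp (μ.bind κ) g = pmfExp μ fun a => pmfExp (κ a) g := by
  simp only [pmfExp, PMF.bind_apply, Finset.mul_sum]
  rw [Finset.sum_comm]
  refine Finset.sum_congr rfl fun b _ => ?_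
  rw [tsum_fintype, ENNReal.toReal_sum fun a _ =>
    ENNReal.mul_ne_top (μ.apply_ne_top a) ((κ a).apply_ne_top b), Finset.sum_mul]
  exact Finset.sum_congr rfl fun a _ => by rw [ENNReal.toReal_mul, mul_assoc]

theorem pmfExp_map (μ : PMF α) (f : α → β) (g : β → ℝ) :
    pmfExp (μ.map f) g = pmfExp μ fun a => g (f a) := by
  rw [← PMF.bind_pure_comp, pmfExp_bind]
  simp only [Function.comp, pmfExp_pure]

theorem pmfExp_uniformOr {s : Finset α} (hs : s.Nonempty) (d : α) (g : α → ℝ) :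
    pmfExp (uniformOr s d) g = ∑ a ∈ s, (s.card : ℝ)⁻¹ * g a := by
  classical
  rw [uniformOr, dif_pos hs, pmfExp, ← Finset.sum_filter_add_sum_filter_not _ (· ∈ s),
    Finset.filter_mem_eq_inter, Finset.univ_inter, Finset.sum_congr (s₁ := s) rfl
      (g := fun a => (s.card : ℝ)⁻¹ * g a), add_eq_left]
  · refine Finset.sum_eq_zero fun a ha => ?_
    rw [PMF.uniformOfFinset_apply_of_notMem _ (Finset.mem_filter.1 ha).2]; simp
  · intro a ha
    rw [PMF.uniformOfFinset_apply_of_mem _ ha]; simp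

theorem coin_true {p : ℝ} (h1 : p ≤ 1) : coin p true = ENNReal.ofReal p := by
  have : p.toNNReal ≤ 1 := by rwa [Real.toNNReal_le_one]
  simp only [coin, PMF.bernoulli_apply, cond_true, min_eq_left this]
  rfl

theorem coin_false {p : ℝ} (h0 : 0 ≤ p) (h1 : p ≤ 1) :
    coin p false = ENNReal.ofReal (1 - p) := by
  have : p.toNNReal ≤ 1 := by rwa [Real.toNNReal_le_one]
  simp only [coin, PMF.bernoulli_apply, cond_false, min_eq_left this]
  rw [ENNReal.ofReal_sub _ h0, ENNReal.ofReal_one]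
  rfl

theorem pmfExp_coin {p : ℝ} (h0 : 0 ≤ p) (h1 : p ≤ 1) (g : Bool → ℝ) :
    pmfExp (coin p) g = p * g true + (1 - p) * g false := by
  rw [pmfExp, Fintype.sum_bool, coin_true h1, coin_false h0 h1, ENNReal.toReal_ofReal h0,
    ENNReal.toReal_ofReal (by linarith)]

end Expectation

/-! ### The transition kernel -/

section Chain

variable {V : Type*} [Fintype V] [DecidableEq V]

/-- The vertices from which a step of the chain may start. -/
def startVertices (A : Finset (Sym2 V)) : Finset V :=
  if (oddVertices A).card = 0 then Finset.univ else oddVertices A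

theorem startVertices_nonempty [Nonempty V] (A : Finset (Sym2 V)) :
    (startVertices A).Nonempty := by
  unfold startVertices
  split_ifs with h
  · exact Finset.univ_nonempty
  · exact Finset.card_pos.1 (Nat.pos_of_ne_zero h)

variable (G : SimpleGraph V) [DecidableRel G.Adj]

/-- The probability that a step from `A` moves along the ordered edge `(u, v)`. -/
def moveProb (x : ℝ) (A : Finset (Sym2 V)) (u v : V) : ℝ :=
  if u ∈ startVertices A ∧ G.Adj u v then
    ((startVertices A).card : ℝ)⁻¹ * ((G.degree u : ℝ)⁻¹ * acceptance G x A u v) else 0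

variable {G}

theorem acceptance_nonneg {x : ℝ} (hx : 0 < x) (A : Finset (Sym2 V)) (u v : V) :
    0 ≤ acceptance G x A u v := by
  unfold acceptance
  have : 0 ≤ if s(u, v) ∈ A then 1 / x else x := by split_ifs <;> positivity
  dsimp only
  split_ifs <;> positivity

theorem acceptance_le_half (x : ℝ) (A : Finset (Sym2 V)) (u v : V) :
    acceptance G x A u v ≤ 1 / 2 := by
  unfold acceptance
  dsimp only
  refine mul_le_of_le_one_right (by norm_num) ?_
  split_ifs <;> exact min_le_left _ _

theorem acceptance_le_one (x : ℝ) (A : Finset (Sym2 V)) (u v : V) :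
    acceptance G x A u v ≤ 1 := (acceptance_le_half x A u v).trans (by norm_num)

theorem moveProb_nonneg {x : ℝ} (hx : 0 < x) (A : Finset (Sym2 V)) (u v : V) :
    0 ≤ moveProb G x A u v := by
  unfold moveProb
  have := acceptance_nonneg (G := G) hx A u v
  split_ifs <;> positivity

theorem sum_moveProb_eq (x : ℝ) (A : Finset (Sym2 V)) (g : V → V → ℝ) :
    ∑ p : V × V, moveProb G x A p.1 p.2 * g p.1 p.2 =
      ∑ u ∈ startVertices A, ((startVertices A).card : ℝ)⁻¹ *
        ∑ v ∈ G.neighborFinset u, ((G.neighborFinset u).card : ℝ)⁻¹ *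
          (acceptance G x A u v * g u v) := by
  rw [Fintype.sum_prod_type]
  rw [← Finset.sum_filter_add_sum_filter_not Finset.univ (· ∈ startVertices A)]
  rw [Finset.filter_mem_eq_inter, Finset.univ_inter]
  have h0 : ∑ u ∈ Finset.univ.filter (· ∉ startVertices A),
      ∑ v, moveProb G x A u v * g u v = 0 := by
    refine Finset.sum_eq_zero fun u hu => Finset.sum_eq_zero fun v _ => ?_
    rw [moveProb, if_neg (fun h => (Finset.mem_filter.1 hu).2 h.1), zero_mul]
  rw [h0, add_zero]
  refine Finset.sum_congr rfl fun u hu => ?_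
  rw [Finset.mul_sum, ← Finset.sum_filter_add_sum_filter_not Finset.univ (· ∈ G.neighborFinset u)]
  rw [Finset.filter_mem_eq_inter, Finset.univ_inter]
  have h1 : ∑ v ∈ Finset.univ.filter (· ∉ G.neighborFinset u), moveProb G x A u v * g u v = 0 := by
    refine Finset.sum_eq_zero fun v hv => ?_
    rw [moveProb, if_neg (fun h => (Finset.mem_filter.1 hv).2 (by simpa using h.2)), zero_mul]
  rw [h1, add_zero]
  refine Finset.sum_congr rfl fun v hv => ?_
  rw [moveProb, if_pos ⟨hu, by simpa using hv⟩, G.card_neighborFinset_eq_degree]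
  ring

theorem sum_moveProb_le [Nonempty V] (x : ℝ) (hdeg : ∀ u, 0 < G.degree u)
    (A : Finset (Sym2 V)) : ∑ p : V × V, moveProb G x A p.1 p.2 ≤ 1 / 2 := by
  have h := sum_moveProb_eq (G := G) x A fun _ _ => 1
  simp only [mul_one] at h
  rw [h]
  have hs : 0 < ((startVertices A).card : ℝ) := by
    exact_mod_cast (startVertices_nonempty A).card_pos
  calc _ ≤ ∑ u ∈ startVertices A, ((startVertices A).card : ℝ)⁻¹ * (1 / 2) := by
        refine Finset.sum_le_sum fun u _ => mul_le_mul_of_nonneg_left ?_ (by positivity)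
        have hu : 0 < ((G.neighborFinset u).card : ℝ) := by
          rw [G.card_neighborFinset_eq_degree]; exact_mod_cast hdeg u
        calc _ ≤ ∑ v ∈ G.neighborFinset u, ((G.neighborFinset u).card : ℝ)⁻¹ * (1 / 2) :=
              Finset.sum_le_sum fun v _ =>
                mul_le_mul_of_nonneg_left (acceptance_le_half x A u v) (by positivity)
          _ = 1 / 2 := by
              rw [Finset.sum_const, nsmul_eq_mul, ← mul_assoc, mul_inv_cancel₀ hu.ne', one_mul]
    _ = 1 / 2 := by
        rw [Finset.sum_const, nsmul_eq_mul, ← mul_assoc, mul_inv_cancel₀ hs.ne', one_mul]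

/-- The transition operator as identity plus a weighted sum of increments; rejections drop out
because they contribute no increment. -/
theorem pmfExp_psStep [Nonempty V] {x : ℝ} (hx : 0 < x) (hdeg : ∀ u, 0 < G.degree u)
    (A : Finset (Sym2 V)) (g : Finset (Sym2 V) → ℝ) :
    pmfExp (psStep G x A) g =
      g A + ∑ p : V × V, moveProb G x A p.1 p.2 * (g (A ∆ {s(p.1, p.2)}) - g A) := by
  have hs : 0 < ((startVertices A).card : ℝ) := by
    exact_mod_cast (startVertices_nonempty A).card_pos
  rw [sum_moveProb_eq (G := G) x A fun u v => g (A ∆ {s(u, v)}) - g A]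
  have h1 : psStep G x A = (uniformOr (startVertices A) (Classical.arbitrary V)).bind fun u =>
    (uniformOr (G.neighborFinset u) u).bind fun v =>
      (coin (acceptance G x A u v)).map fun b => if b then A ∆ {s(u, v)} else A := rfl
  rw [h1, pmfExp_bind, pmfExp_uniformOr (startVertices_nonempty A)]
  have h2 : ∀ u, pmfExp ((uniformOr (G.neighborFinset u) u).bind fun v =>
      (coin (acceptance G x A u v)).map fun b => if b then A ∆ {s(u, v)} else A) g =
      g A + ∑ v ∈ G.neighborFinset u, ((G.neighborFinset u).card : ℝ)⁻¹ *
          (acceptance G x A u v * (g (A ∆ {s(u, v)}) - g A)) := by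
    intro u
    have hu : 0 < ((G.neighborFinset u).card : ℝ) := by
      rw [G.card_neighborFinset_eq_degree]; exact_mod_cast hdeg u
    rw [pmfExp_bind, pmfExp_uniformOr (Finset.card_pos.1 (by exact_mod_cast hu))]
    have h3 : g A = ∑ v ∈ G.neighborFinset u, ((G.neighborFinset u).card : ℝ)⁻¹ * g A := by
      rw [Finset.sum_const, nsmul_eq_mul, ← mul_assoc, mul_inv_cancel₀ hu.ne', one_mul]
    conv_rhs => rw [h3, ← Finset.sum_add_distrib]
    refine Finset.sum_congr rfl fun v _ => ?_
    rw [pmfExp_map, pmfExp_coin (acceptance_nonneg hx A u v) (acceptance_le_one x A u v)]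
    simp only [if_true, Bool.false_eq_true, if_false]
    ring_nf
    rw [← h3]
  simp only [h2, mul_add, Finset.sum_add_distrib]
  rw [Finset.sum_const, nsmul_eq_mul, ← mul_assoc, mul_inv_cancel₀ hs.ne', one_mul]

/-- The chain stays in 𝒲 because it starts its move at an odd vertex whenever there is one: {u, w} ∆
{u, v} is {w, v} or empty. -/
theorem toggle_mem_wormSpace {A : Finset (Sym2 V)} (hA : A ∈ wormSpace G) {u v : V}
    (hu : u ∈ startVertices A) (huv : G.Adj u v) : A ∆ {s(u, v)} ∈ wormSpace G := by
  rw [mem_wormSpace] at hA ⊢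
  refine ⟨symmDiff_subset_edgeFinset hA.1 (by simpa using huv), ?_⟩
  rw [oddVertices_toggle]
  have hne := huv.ne
  rcases hA.2 with h | h
  · rw [Finset.card_eq_zero] at h
    right
    rw [h, ← Finset.bot_eq_empty, bot_symmDiff, Finset.card_pair hne]
  · rw [startVertices, if_neg (by omega)] at hu
    obtain ⟨a, b, hab, hW⟩ := Finset.card_eq_two.1 h
    obtain ⟨w, huw, hW⟩ : ∃ w, u ≠ w ∧ oddVertices A = {u, w} := by
      rw [hW, Finset.mem_insert, Finset.mem_singleton] at hu
      rcases hu with rfl | rfl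
      · exact ⟨b, hab, hW⟩
      · exact ⟨a, hab.symm, by rw [hW, Finset.pair_comm]⟩
    rw [hW]
    by_cases hwv : w = v
    · left; rw [hwv, symmDiff_self]; rfl
    · right
      have : ({u, w} : Finset V) ∆ {u, v} = {w, v} := by
        ext z; simp only [Finset.mem_symmDiff, Finset.mem_insert, Finset.mem_singleton]
        by_cases h1 : z = u <;> by_cases h2 : z = w <;> by_cases h3 : z = v <;> simp_all
      rw [this, Finset.card_pair hwv]

/-! ### Reversibility and stationarity. -/

/-- The stationary flow along the ordered edge `(u, v)` out of `A`, up to normalisation. -/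
def flow (G : SimpleGraph V) [DecidableRel G.Adj] (x : ℝ) (A : Finset (Sym2 V)) (u v : V) : ℝ :=
  if A ∈ wormSpace G then wormWeight x A * moveProb G x A u v else 0

/-- The coefficients n and 2 of the stationary weight are exactly the numbers of start vertices, so
they cancel against the uniform choice of u. -/
theorem weight_mul_inv_card [Nonempty V] {x : ℝ} {A : Finset (Sym2 V)} (hA : A ∈ wormSpace G) :
    wormWeight x A * ((startVertices A).card : ℝ)⁻¹ = x ^ A.card := by
  have hn : 0 < (Fintype.card V : ℝ) := by exact_mod_cast Fintype.card_pos
  rcases (mem_wormSpace.1 hA).2 with h | h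
  · rw [wormWeight, startVertices, if_pos h, if_pos h, Finset.card_univ]; field_simp
  · rw [wormWeight, startVertices, if_neg (by omega), if_pos h, if_neg (by omega), h]
    push_cast; ring

theorem card_toggle_of_mem {A : Finset (Sym2 V)} {e : Sym2 V} (h : e ∈ A) :
    (A ∆ {e}).card + 1 = A.card := by
  have : A ∆ {e} = A.erase e := by
    ext f; simp only [Finset.mem_symmDiff, Finset.mem_singleton, Finset.mem_erase]
    by_cases hf : f = e <;> simp_all
  rw [this, Finset.card_erase_add_one h]

theorem card_toggle_of_notMem {A : Finset (Sym2 V)} {e : Sym2 V} (h : e ∉ A) :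
    (A ∆ {e}).card = A.card + 1 := by
  have : A ∆ {e} = insert e A := by
    ext f; simp only [Finset.mem_symmDiff, Finset.mem_singleton, Finset.mem_insert]
    by_cases hf : f = e <;> simp_all
  rw [this, Finset.card_insert_of_notMem h]

theorem pow_card_mul_ratio {x : ℝ} (hx : 0 < x) (A : Finset (Sym2 V)) (e : Sym2 V) :
    x ^ A.card * (if e ∈ A then 1 / x else x) = x ^ (A ∆ {e}).card := by
  split_ifs with h
  · rw [← card_toggle_of_mem h, pow_succ]; field_simp
  · rw [card_toggle_of_notMem h, pow_succ]

/-- The flow along an edge joining two configurations of the same kind. -/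
theorem flow_eq_of_two [Nonempty V] {x : ℝ} (hx : 0 < x) {A : Finset (Sym2 V)}
    (hA : A ∈ wormSpace G) {u v : V} (hu : u ∈ oddVertices A) (hv : v ∉ oddVertices A)
    (huv : G.Adj u v) :
    flow G x A u v = 1 / 2 * min (x ^ A.card * (G.degree u : ℝ)⁻¹)
      (x ^ (A ∆ {s(u, v)}).card * (G.degree v : ℝ)⁻¹) := by
  have hdu : 0 < (G.degree u : ℝ) := by
    exact_mod_cast (G.degree_pos_iff_exists_adj u).2 ⟨v, huv⟩
  have h2 : (oddVertices A).card = 2 := by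
    rcases (mem_wormSpace.1 hA).2 with h | h
    · rw [Finset.card_eq_zero] at h; simp [h] at hu
    · exact h
  have hs : startVertices A = oddVertices A := if_neg (by omega)
  have h2' : (oddVertices (A ∆ {s(u, v)})).card = 2 := by
    have h := toggle_mem_wormSpace hA (hs ▸ hu) huv
    rcases (mem_wormSpace.1 h).2 with h | h
    · rw [Finset.card_eq_zero, oddVertices_toggle, ← Finset.bot_eq_empty, symmDiff_eq_bot] at h
      rw [h] at hv; simp at hv
    · exact h
  have h3 := weight_mul_inv_card (x := x) hA
  rw [flow, if_pos hA, moveProb, if_pos ⟨hs ▸ hu, huv⟩, acceptance, if_pos ⟨h2, h2', hu⟩,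
    ← pow_card_mul_ratio hx A s(u, v)]
  set r : ℝ := if s(u, v) ∈ A then 1 / x else x
  -- The degree ratio in the acceptance probability turns 1/d(u) into 1/d(v) inside the minimum,
  -- which makes the flow symmetric under reversing the move.
  have h4 : x ^ A.card * (G.degree u : ℝ)⁻¹ * min 1 ((G.degree u : ℝ) / (G.degree v : ℝ) * r) =
      min (x ^ A.card * (G.degree u : ℝ)⁻¹) (x ^ A.card * r * (G.degree v : ℝ)⁻¹) := by
    rw [mul_min_of_nonneg _ _ (by positivity), mul_one]
    congr 1
    field_simp
  calc _ = 1 / 2 * ((wormWeight x A * ((startVertices A).card : ℝ)⁻¹) * (G.degree u : ℝ)⁻¹ *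
        min 1 ((G.degree u : ℝ) / (G.degree v : ℝ) * r)) := by ring
    _ = _ := by rw [h3, h4]

/-- The flow along an edge joining an even subgraph to a configuration with two odd vertices. -/
theorem flow_eq_of_even [Nonempty V] {x : ℝ} (hx : 0 < x) {A : Finset (Sym2 V)}
    (hA : A ∈ wormSpace G) {u v : V} (hu : u ∈ startVertices A) (huv : G.Adj u v)
    (h : oddVertices A = ∅ ∨ oddVertices (A ∆ {s(u, v)}) = ∅) :
    flow G x A u v = 1 / 2 * (min (x ^ A.card) (x ^ (A ∆ {s(u, v)}).card) *
      (G.degree u : ℝ)⁻¹) := by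
  have h3 := weight_mul_inv_card (x := x) hA
  rw [flow, if_pos hA, moveProb, if_pos ⟨hu, huv⟩, acceptance, if_neg,
    ← pow_card_mul_ratio hx A s(u, v)]
  · set r : ℝ := if s(u, v) ∈ A then 1 / x else x
    have h4 : x ^ A.card * min 1 r = min (x ^ A.card) (x ^ A.card * r) := by
      rw [mul_min_of_nonneg _ _ (by positivity), mul_one]
    calc _ = 1 / 2 * ((wormWeight x A * ((startVertices A).card : ℝ)⁻¹) * min 1 r *
        (G.degree u : ℝ)⁻¹) := by ring
    _ = _ := by rw [h3, h4]
  · rintro ⟨h5, h6, -⟩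
    rcases h with h | h
    · rw [h] at h5; simp at h5
    · rw [h] at h6; simp at h6

theorem flow_eq_zero {x : ℝ} {A : Finset (Sym2 V)} {u v : V}
    (h : ¬ (u ∈ startVertices A ∧ G.Adj u v)) : flow G x A u v = 0 := by
  rw [flow, moveProb, if_neg h, mul_zero, ite_self]

theorem flow_nonneg {x : ℝ} (hx : 0 < x) (A : Finset (Sym2 V)) (u v : V) :
    0 ≤ flow G x A u v := by
  unfold flow
  have := moveProb_nonneg (G := G) hx A u v
  have := wormWeight_nonneg hx A
  split_ifs <;> positivity

theorem startVertices_of_empty {A : Finset (Sym2 V)} (h : oddVertices A = ∅) :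
    startVertices A = Finset.univ := by simp [startVertices, h]

theorem startVertices_of_ne_empty {A : Finset (Sym2 V)} (h : oddVertices A ≠ ∅) :
    startVertices A = oddVertices A := by simp [startVertices, h]

/-- Detailed balance holds for the undirected edge, not for each orientation. Between an even
subgraph and its toggle both orientations carry flow. If u is odd and v is not, only (u, v) carries
flow out of A and only (v, u) carries it back. -/
theorem flow_symm_of_mem [Nonempty V] {x : ℝ} (hx : 0 < x) {A : Finset (Sym2 V)}
    (hA : A ∈ wormSpace G) {u v : V} (huv : G.Adj u v) (hu : u ∈ startVertices A) :
    flow G x A u v + flow G x A v u =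
      flow G x (A ∆ {s(u, v)}) u v + flow G x (A ∆ {s(u, v)}) v u := by
  have hA' := toggle_mem_wormSpace hA hu huv
  have hB := symmDiff_symmDiff_cancel_right ({s(u, v)} : Finset (Sym2 V)) A
  have hsw : s(v, u) = s(u, v) := Sym2.eq_swap
  have hodd := oddVertices_toggle A u v
  by_cases h0 : oddVertices A = ∅
  · have h1 : oddVertices (A ∆ {s(u, v)}) = {u, v} := by
      rw [hodd, h0, ← Finset.bot_eq_empty, bot_symmDiff]
    have hs : startVertices (A ∆ {s(u, v)}) = {u, v} := by
      rw [startVertices_of_ne_empty (by rw [h1]; simp), h1]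
    rw [flow_eq_of_even hx hA hu huv (Or.inl h0),
      flow_eq_of_even hx hA (by rw [startVertices_of_empty h0]; simp) huv.symm (Or.inl h0),
      flow_eq_of_even hx hA' (by rw [hs]; simp) huv (Or.inr (by rw [hB, h0])),
      flow_eq_of_even hx hA' (by rw [hs]; simp) huv.symm (Or.inr (by rw [hsw, hB, h0])),
      hsw, hB, min_comm]
  · rw [startVertices_of_ne_empty h0] at hu
    by_cases hv : v ∈ oddVertices A
    · have h1 : oddVertices (A ∆ {s(u, v)}) = ∅ := by
        have h2 : (oddVertices A).card = 2 := by
          rcases (mem_wormSpace.1 hA).2 with h | h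
          · exact absurd (Finset.card_eq_zero.1 h) h0
          · exact h
        have h3 : {u, v} = oddVertices A := Finset.eq_of_subset_of_card_le
          (by intro z; simp only [Finset.mem_insert, Finset.mem_singleton]
              rintro (rfl | rfl) <;> assumption) (by rw [h2, Finset.card_pair huv.ne])
        rw [hodd, h3, symmDiff_self]; rfl
      have hs := startVertices_of_empty h1
      have hsA := startVertices_of_ne_empty h0
      rw [flow_eq_of_even hx hA (hsA ▸ hu) huv (Or.inr h1),
        flow_eq_of_even hx hA (hsA ▸ hv) huv.symm (Or.inr (by rw [hsw, h1])),
        flow_eq_of_even hx hA' (by rw [hs]; simp) huv (Or.inl h1),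
        flow_eq_of_even hx hA' (by rw [hs]; simp) huv.symm (Or.inl h1),
        hsw, hB, min_comm]
    · have hv' : v ∈ oddVertices (A ∆ {s(u, v)}) := by
        rw [hodd, Finset.mem_symmDiff]; right; simp [hv]
      have hu' : u ∉ oddVertices (A ∆ {s(u, v)}) := by
        rw [hodd, Finset.mem_symmDiff]; simp [hu]
      have hs' : startVertices (A ∆ {s(u, v)}) = oddVertices (A ∆ {s(u, v)}) :=
        startVertices_of_ne_empty (Finset.nonempty_iff_ne_empty.1 ⟨v, hv'⟩)
      rw [flow_eq_of_two hx hA hu hv huv, flow_eq_zero (u := v),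
        flow_eq_zero (u := u) (A := A ∆ {s(u, v)}), flow_eq_of_two hx hA' hv' hu' huv.symm,
        hsw, hB, add_zero, zero_add, min_comm]
      · rw [hs']; exact fun h => hu' h.1
      · rw [startVertices_of_ne_empty h0]; exact fun h => hv h.1

theorem flow_symm_of_notMem {x : ℝ} {A : Finset (Sym2 V)}
    {u v : V} (hu : A ∈ wormSpace G → u ∉ startVertices A)
    (hv : A ∈ wormSpace G → v ∉ startVertices A) : flow G x A u v + flow G x A v u = 0 := by
  by_cases hA : A ∈ wormSpace G
  · rw [flow_eq_zero fun h => hu hA h.1, flow_eq_zero fun h => hv hA h.1, add_zero]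
  · rw [flow, flow, if_neg hA, if_neg hA, add_zero]

theorem flow_symm [Nonempty V] {x : ℝ} (hx : 0 < x) (A : Finset (Sym2 V)) (u v : V) :
    flow G x A u v + flow G x A v u =
      flow G x (A ∆ {s(u, v)}) u v + flow G x (A ∆ {s(u, v)}) v u := by
  by_cases huv : G.Adj u v
  swap
  · simp only [flow_eq_zero fun h => huv h.2, flow_eq_zero fun h => huv (G.adj_symm h.2)]
  have key : ∀ B : Finset (Sym2 V), (B ∈ wormSpace G ∧ (u ∈ startVertices B ∨ v ∈ startVertices B)) →
      flow G x B u v + flow G x B v u =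
      flow G x (B ∆ {s(u, v)}) u v + flow G x (B ∆ {s(u, v)}) v u := by
    rintro B ⟨hB, h | h⟩
    · exact flow_symm_of_mem hx hB huv h
    · rw [add_comm, flow_symm_of_mem hx hB huv.symm h, add_comm, Sym2.eq_swap]
  by_cases h1 : A ∈ wormSpace G ∧ (u ∈ startVertices A ∨ v ∈ startVertices A)
  · exact key A h1
  by_cases h2 : A ∆ {s(u, v)} ∈ wormSpace G ∧
      (u ∈ startVertices (A ∆ {s(u, v)}) ∨ v ∈ startVertices (A ∆ {s(u, v)}))
  · have := key _ h2
    rw [symmDiff_symmDiff_cancel_right] at this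
    exact this.symm
  · rw [flow_symm_of_notMem, flow_symm_of_notMem] <;> tauto

/-- The involution A ↦ A ∆ uv preserves the flow summed over both orientations and changes the sign
of the increment of g. Exchanging u and v in the sum over ordered pairs brings in the second
orientation. -/
theorem sum_flow_eq_zero [Nonempty V] {x : ℝ} (hx : 0 < x) (g : Finset (Sym2 V) → ℝ) :
    ∑ A : Finset (Sym2 V), ∑ p : V × V,
      flow G x A p.1 p.2 * (g (A ∆ {s(p.1, p.2)}) - g A) = 0 := by
  rw [Finset.sum_comm]
  have h1 : ∀ u v : V, ∑ A : Finset (Sym2 V),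
      (flow G x A u v + flow G x A v u) * (g (A ∆ {s(u, v)}) - g A) = 0 := by
    intro u v
    simp only [mul_sub, Finset.sum_sub_distrib]
    rw [sub_eq_zero]
    refine Finset.sum_bij' (fun A _ => A ∆ {s(u, v)}) (fun A _ => A ∆ {s(u, v)})
      (fun _ _ => Finset.mem_univ _) (fun _ _ => Finset.mem_univ _)
      (fun A _ => symmDiff_symmDiff_cancel_right _ _)
      (fun A _ => symmDiff_symmDiff_cancel_right _ _) (fun A _ => ?_)
    rw [flow_symm hx A u v]
  have h2 : ∑ p : V × V, ∑ A : Finset (Sym2 V),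
      flow G x A p.1 p.2 * (g (A ∆ {s(p.1, p.2)}) - g A) =
      ∑ p : V × V, ∑ A : Finset (Sym2 V),
      flow G x A p.2 p.1 * (g (A ∆ {s(p.1, p.2)}) - g A) := by
    rw [← (Equiv.prodComm V V).sum_comp]
    refine Finset.sum_congr rfl fun p _ => Finset.sum_congr rfl fun A _ => ?_
    simp only [Equiv.prodComm_apply, Prod.fst_swap, Prod.snd_swap]
    rw [Sym2.eq_swap (a := p.2)]
  have h3 : ∑ p : V × V, ∑ A : Finset (Sym2 V),
      (flow G x A p.1 p.2 + flow G x A p.2 p.1) * (g (A ∆ {s(p.1, p.2)}) - g A) = 0 :=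
    Finset.sum_eq_zero fun p _ => h1 p.1 p.2
  simp only [add_mul, Finset.sum_add_distrib] at h3
  linarith

theorem sum_wormWeight_mul_sum_moveProb (x : ℝ) (h : Finset (Sym2 V) → V → V → ℝ) :
    ∑ A ∈ wormSpace G, wormWeight x A * ∑ p : V × V, moveProb G x A p.1 p.2 * h A p.1 p.2 =
      ∑ A : Finset (Sym2 V), ∑ p : V × V, flow G x A p.1 p.2 * h A p.1 p.2 := by
  rw [← Finset.sum_filter_add_sum_filter_not Finset.univ (· ∈ wormSpace G),
    Finset.filter_mem_eq_inter, Finset.univ_inter, eq_comm, add_eq_left.2]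
  · refine Finset.sum_congr rfl fun A hA => ?_
    rw [Finset.mul_sum]
    refine Finset.sum_congr rfl fun p _ => ?_
    rw [flow, if_pos hA, mul_assoc]
  · refine Finset.sum_eq_zero fun A hA => Finset.sum_eq_zero fun p _ => ?_
    rw [flow, if_neg (Finset.mem_filter.1 hA).2, zero_mul]

/-- The weights `wormWeight` are stationary for the chain. -/
theorem psStep_stationary [Nonempty V] {x : ℝ} (hx : 0 < x) (hdeg : ∀ u, 0 < G.degree u)
    (g : Finset (Sym2 V) → ℝ) :
    ∑ A ∈ wormSpace G, wormWeight x A * pmfExp (psStep G x A) g =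
      ∑ A ∈ wormSpace G, wormWeight x A * g A := by
  simp only [pmfExp_psStep hx hdeg, mul_add, Finset.sum_add_distrib]
  rw [sum_wormWeight_mul_sum_moveProb x fun A u v => g (A ∆ {s(u, v)}) - g A,
    sum_flow_eq_zero hx, add_zero]

end Chain

/-! ### Canonical paths -/

section Paths

variable {V : Type*} [Fintype V] [DecidableEq V] {G : SimpleGraph V} [DecidableRel G.Adj]

theorem symmDiff_singleton_of_mem {A : Finset (Sym2 V)} {e : Sym2 V} (h : e ∈ A) :
    A ∆ {e} = A.erase e := by
  ext f; simp only [Finset.mem_symmDiff, Finset.mem_singleton, Finset.mem_erase]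
  by_cases hf : f = e <;> simp_all

/-- Every toggle that stays in 𝒲 is a move of the chain: if neither end were a start vertex, the new
boundary would have four vertices. -/
theorem exists_mem_startVertices {A : Finset (Sym2 V)} (hA : A ∈ wormSpace G) {e : Sym2 V}
    (he : e ∈ G.edgeFinset) (hAe : A ∆ {e} ∈ wormSpace G) :
    ∃ u v, e = s(u, v) ∧ u ∈ startVertices A ∧ G.Adj u v := by
  induction e using Sym2.ind with
  | _ u v =>
    have huv : G.Adj u v := by simpa using he
    by_cases hu : u ∈ startVertices A
    · exact ⟨u, v, rfl, hu, huv⟩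
    by_cases hv : v ∈ startVertices A
    · exact ⟨v, u, Sym2.eq_swap, hv, huv.symm⟩
    exfalso
    have h0 : oddVertices A ≠ ∅ := fun h => hu (by rw [startVertices_of_empty h]; simp)
    rw [startVertices_of_ne_empty h0] at hu hv
    have h2 : (oddVertices A).card = 2 := by
      rcases (mem_wormSpace.1 hA).2 with h | h
      · exact absurd (Finset.card_eq_zero.1 h) h0
      · exact h
    have hd : Disjoint (oddVertices A) {u, v} := by
      rw [Finset.disjoint_right]; intro z; simp only [Finset.mem_insert, Finset.mem_singleton]
      rintro (rfl | rfl) <;> assumption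
    have h3 : (oddVertices (A ∆ {s(u, v)})).card = 4 := by
      rw [oddVertices_toggle, hd.symmDiff_eq_sup, Finset.sup_eq_union,
        Finset.card_union_of_disjoint hd, h2, Finset.card_pair huv.ne]
    rcases (mem_wormSpace.1 hAe).2 with h | h <;> omega

/-- In an even D any edge may be removed. Otherwise an odd vertex has positive degree, and any edge
at it may be removed. -/
theorem exists_removable {D : Finset (Sym2 V)} (hD : D ∈ wormSpace G) (hne : D.Nonempty) :
    ∃ e ∈ D, D.erase e ∈ wormSpace G := by
  have key : ∀ u v, s(u, v) ∈ D → u ∈ startVertices D →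
      ∃ e ∈ D, D.erase e ∈ wormSpace G := by
    intro u v he hu
    have huv : G.Adj u v := by simpa using (mem_wormSpace.1 hD).1 he
    refine ⟨s(u, v), he, ?_⟩
    rw [← symmDiff_singleton_of_mem he]
    exact toggle_mem_wormSpace hD hu huv
  by_cases h0 : oddVertices D = ∅
  · obtain ⟨e, he⟩ := hne
    induction e using Sym2.ind with
    | _ u v => exact key u v he (by rw [startVertices_of_empty h0]; simp)
  · obtain ⟨u, hu⟩ := Finset.nonempty_iff_ne_empty.2 h0
    have h1 := (mem_oddVertices.1 hu).pos
    obtain ⟨e, he⟩ := Finset.card_pos.1 h1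
    obtain ⟨he, hue⟩ := Finset.mem_filter.1 he
    obtain ⟨v, rfl⟩ := Sym2.mem_iff_exists.1 hue
    exact key u v he (by rwa [startVertices_of_ne_empty h0])

open Classical in
variable (G) in
/-- The edge that is removed next when `D` is unwound. -/
def nextEdge (D : Finset (Sym2 V)) : Option (Sym2 V) :=
  if h : ∃ e ∈ D, D.erase e ∈ wormSpace G then some h.choose else none

variable (G) in
/-- The edges of `D` that remain after one edge is removed. -/
def unwindStep (D : Finset (Sym2 V)) : Finset (Sym2 V) :=
  (nextEdge G D).elim D fun e => D.erase e

theorem exists_nextEdge {D : Finset (Sym2 V)} (hD : D ∈ wormSpace G) (hne : D.Nonempty) :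
    ∃ e ∈ D, nextEdge G D = some e ∧ unwindStep G D = D.erase e ∧ D.erase e ∈ wormSpace G := by
  have h := exists_removable hD hne
  have h1 : nextEdge G D = some h.choose := dif_pos h
  exact ⟨h.choose, h.choose_spec.1, h1, by rw [unwindStep, h1]; rfl, h.choose_spec.2⟩

/-- The unwinding is a sequence determined by D alone; it stays in 𝒲 and reaches ∅ after |D| steps.
That it does not depend on the end points of the path is what makes the encoding injective. -/
theorem iterate_unwindStep {D : Finset (Sym2 V)} (hD : D ∈ wormSpace G) {i : ℕ}
    (hi : i ≤ D.card) : (unwindStep G)^[i] D ∈ wormSpace G ∧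
      ((unwindStep G)^[i] D).card + i = D.card := by
  induction i with
  | zero => exact ⟨hD, rfl⟩
  | succ i ih =>
    obtain ⟨h1, h2⟩ := ih (by omega)
    obtain ⟨e, he, -, h3, h4⟩ := exists_nextEdge h1 (Finset.card_pos.1 (by omega))
    rw [Function.iterate_succ_apply', h3]
    refine ⟨h4, ?_⟩
    have := Finset.card_erase_add_one he
    omega

theorem unwindStep_subset (D : Finset (Sym2 V)) : unwindStep G D ⊆ D := by
  unfold unwindStep
  cases nextEdge G D with
  | none => exact subset_rfl
  | some e => exact Finset.erase_subset _ _

theorem iterate_unwindStep_anti (D : Finset (Sym2 V)) {i j : ℕ} (h : i ≤ j) :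
    (unwindStep G)^[j] D ⊆ (unwindStep G)^[i] D := by
  induction j, h using Nat.le_induction with
  | base => exact subset_rfl
  | succ j _ ih =>
    rw [Function.iterate_succ_apply']
    exact (unwindStep_subset _).trans ih

theorem exists_nextEdge_iterate {D : Finset (Sym2 V)} (hD : D ∈ wormSpace G) {i : ℕ}
    (hi : i < D.card) : ∃ e ∈ (unwindStep G)^[i] D,
      nextEdge G ((unwindStep G)^[i] D) = some e ∧
      (unwindStep G)^[i + 1] D = ((unwindStep G)^[i] D).erase e ∧
      (unwindStep G)^[i + 1] D ∈ wormSpace G := by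
  obtain ⟨h1, h2⟩ := iterate_unwindStep hD hi.le
  obtain ⟨e, he, h3, h4, h5⟩ := exists_nextEdge h1 (Finset.card_pos.1 (by omega))
  rw [Function.iterate_succ_apply']
  exact ⟨e, he, h3, h4, h4 ▸ h5⟩

/-- An edge removed at step i is absent from all later sets, so no edge is removed twice and a sum
over steps is at most a sum over edges. -/
theorem nextEdge_iterate_ne {D : Finset (Sym2 V)} (hD : D ∈ wormSpace G) {i j : ℕ}
    (hij : i < j) (hj : j < D.card) :
    nextEdge G ((unwindStep G)^[i] D) ≠ nextEdge G ((unwindStep G)^[j] D) := by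
  obtain ⟨e, -, h1, h2, -⟩ := exists_nextEdge_iterate hD (hij.trans hj)
  obtain ⟨f, hf, h3, -, -⟩ := exists_nextEdge_iterate hD hj
  rw [h1, h3]
  intro h
  obtain rfl := Option.some.inj h
  have := iterate_unwindStep_anti (G := G) D (Nat.succ_le_of_lt hij) hf
  rw [Nat.succ_eq_add_one, h2] at this
  simp at this

/-- The right side involves X only through X \ D, so sets that agree off D have the same total
weight exponent. -/
theorem card_add_card_symmDiff {α : Type*} [DecidableEq α] (X D : Finset α) :
    X.card + (X ∆ D).card = 2 * (X \ D).card + D.card := by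
  have h1 : (X ∆ D).card = (X \ D).card + (D \ X).card := by
    rw [symmDiff_def, Finset.sup_eq_union, Finset.card_union_of_disjoint disjoint_sdiff_sdiff]
  have h2 := Finset.card_sdiff_add_card_inter X D
  have h3 := Finset.card_sdiff_add_card_inter D X
  rw [Finset.inter_comm] at h3
  omega

/-- The weights of the two ends of a canonical path are the weights of the transition and its
encoding. -/
theorem card_add_card_of_path {F B D : Finset (Sym2 V)} {e : Sym2 V} (hBD : B ⊆ D) (he : e ∈ D) :
    F.card + (F ∆ D).card = (insert e (F ∆ B)).card + (D ∆ insert e (F ∆ B)).card := by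
  rw [symmDiff_comm D, card_add_card_symmDiff, card_add_card_symmDiff]
  congr 3
  ext f
  simp only [Finset.mem_sdiff, Finset.mem_insert, Finset.mem_symmDiff]
  constructor
  · rintro ⟨h1, h2⟩
    exact ⟨Or.inr (Or.inl ⟨h1, fun h => h2 (hBD h)⟩), h2⟩
  · rintro ⟨rfl | h | h, h2⟩
    · exact absurd he h2
    · exact ⟨h.1, h2⟩
    · exact absurd (hBD h.1) h2

/-! ### Congestion of the canonical paths. -/

/-- The squared increment of `f` when `e` is toggled in `A`, weighted by the larger edge set; zero
unless the toggle is a move within the configuration space. -/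
def edgeEnergy (G : SimpleGraph V) [DecidableRel G.Adj] (x : ℝ) (f : Finset (Sym2 V) → ℝ)
    (A : Finset (Sym2 V)) (e : Sym2 V) : ℝ :=
  if A ∆ {e} ∈ wormSpace G then x ^ (insert e A).card * (f (A ∆ {e}) - f A) ^ 2 else 0

theorem edgeEnergy_nonneg {x : ℝ} (hx : 0 < x) (f : Finset (Sym2 V) → ℝ)
    (A : Finset (Sym2 V)) (e : Sym2 V) : 0 ≤ edgeEnergy G x f A e := by
  unfold edgeEnergy; split_ifs <;> positivity

/-- The sets F ∆ D_i, with D_i the i-th unwinding of D, form a path from F ∆ D to F. Telescope along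
it and apply Cauchy–Schwarz with length |D| ≤ m. -/
theorem sq_sub_le_sum_path (f : Finset (Sym2 V) → ℝ) (F : Finset (Sym2 V))
    {D : Finset (Sym2 V)} (hD : D ∈ wormSpace G) :
    (f (F ∆ D) - f F) ^ 2 ≤ G.edgeFinset.card * ∑ i ∈ Finset.range D.card,
      (f (F ∆ (unwindStep G)^[i + 1] D) - f (F ∆ (unwindStep G)^[i] D)) ^ 2 := by
  have h1 : f F - f (F ∆ D) = ∑ i ∈ Finset.range D.card,
      (f (F ∆ (unwindStep G)^[i + 1] D) - f (F ∆ (unwindStep G)^[i] D)) := by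
    rw [Finset.sum_range_sub (fun i => f (F ∆ (unwindStep G)^[i] D))]
    obtain ⟨-, h⟩ := iterate_unwindStep hD le_rfl
    have h0 : (unwindStep G)^[D.card] D = ⊥ := Finset.card_eq_zero.1 (by omega)
    rw [h0, symmDiff_bot, Function.iterate_zero_apply]
  have h2 : (f (F ∆ D) - f F) ^ 2 = (f F - f (F ∆ D)) ^ 2 := by ring
  rw [h2, h1]
  refine (sq_sum_le_card_mul_sum_sq).trans ?_
  rw [Finset.card_range]
  refine mul_le_mul_of_nonneg_right ?_ (Finset.sum_nonneg fun _ _ => sq_nonneg _)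
  exact_mod_cast Finset.card_le_card (mem_wormSpace.1 hD).1

/-- This is why one end of each path is taken even: two configurations with two odd vertices each
could differ by a set with four. -/
theorem symmDiff_mem_wormSpace {F D : Finset (Sym2 V)} (hF : F ∈ graphsWithBoundary G ∅)
    (hD : D ∈ wormSpace G) : F ∆ D ∈ wormSpace G ∧ oddVertices (F ∆ D) = oddVertices D := by
  rw [mem_graphsWithBoundary] at hF
  rw [mem_wormSpace] at hD ⊢
  have h : oddVertices (F ∆ D) = oddVertices D := by
    rw [oddVertices_symmDiff, hF.2, ← Finset.bot_eq_empty, bot_symmDiff]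
  exact ⟨⟨symmDiff_subset_edgeFinset hF.1 hD.1, h ▸ hD.2⟩, h⟩

/-- With D and the step fixed, the remaining set B is fixed too, so F ↦ F ∆ B is injective and the
sum over starting points becomes a sum over states A. The exponent splits by
`card_add_card_of_path`. -/
theorem sum_path_term_le {x : ℝ} (hx : 0 < x) (f : Finset (Sym2 V) → ℝ)
    {D : Finset (Sym2 V)} (hD : D ∈ wormSpace G) {i : ℕ} (hi : i < D.card) {e : Sym2 V}
    (he : nextEdge G ((unwindStep G)^[i] D) = some e) :
    ∑ F ∈ graphsWithBoundary G ∅, x ^ (F.card + (F ∆ D).card) *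
      (f (F ∆ (unwindStep G)^[i + 1] D) - f (F ∆ (unwindStep G)^[i] D)) ^ 2 ≤
    ∑ A ∈ wormSpace G, edgeEnergy G x f A e * x ^ (D ∆ insert e A).card := by
  obtain ⟨e', he', h1, h2, h3⟩ := exists_nextEdge_iterate hD hi
  obtain rfl : e' = e := Option.some.inj (h1.symm.trans he)
  have hBD : (unwindStep G)^[i] D ⊆ D := iterate_unwindStep_anti (G := G) D (Nat.zero_le i)
  have hB := (iterate_unwindStep hD hi.le).1
  rw [h2] at h3 ⊢
  -- From here on only B ∈ 𝒲, B ⊆ D, e' ∈ B and the membership of B without e' in 𝒲 matter.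
  generalize (unwindStep G)^[i] D = B at *
  have hstep : ∀ F : Finset (Sym2 V), F ∆ (B.erase e') = (F ∆ B) ∆ {e'} := by
    intro F; rw [symmDiff_assoc, symmDiff_singleton_of_mem he']
  have h4 : ∀ F ∈ graphsWithBoundary G ∅, x ^ (F.card + (F ∆ D).card) *
      (f (F ∆ B.erase e') - f (F ∆ B)) ^ 2 =
      edgeEnergy G x f (F ∆ B) e' * x ^ (D ∆ insert e' (F ∆ B)).card := by
    intro F hF
    rw [edgeEnergy, if_pos (hstep F ▸ (symmDiff_mem_wormSpace hF h3).1), hstep F,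
      card_add_card_of_path hBD (hBD he'), pow_add]
    ring
  rw [Finset.sum_congr rfl h4]
  have hinj : Set.InjOn (fun F : Finset (Sym2 V) => F ∆ B) (graphsWithBoundary G ∅) :=
    fun _ _ _ _ h => symmDiff_left_injective _ h
  rw [← Finset.sum_image (f := fun A => edgeEnergy G x f A e' * x ^ (D ∆ insert e' A).card) hinj]
  refine Finset.sum_le_sum_of_subset_of_nonneg ?_ fun A _ _ =>
    mul_nonneg (edgeEnergy_nonneg hx f A e') (by positivity)
  intro A hA
  obtain ⟨F, hF, rfl⟩ := Finset.mem_image.1 hA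
  exact (symmDiff_mem_wormSpace hF hB).1

theorem sum_path_le {x : ℝ} (hx : 0 < x) (f : Finset (Sym2 V) → ℝ)
    {D : Finset (Sym2 V)} (hD : D ∈ wormSpace G) :
    ∑ F ∈ graphsWithBoundary G ∅, x ^ (F.card + (F ∆ D).card) * (f (F ∆ D) - f F) ^ 2 ≤
      G.edgeFinset.card * ∑ e ∈ G.edgeFinset, ∑ A ∈ wormSpace G,
        edgeEnergy G x f A e * x ^ (D ∆ insert e A).card := by
  calc _ ≤ ∑ F ∈ graphsWithBoundary G ∅, x ^ (F.card + (F ∆ D).card) *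
        (G.edgeFinset.card * ∑ i ∈ Finset.range D.card,
      (f (F ∆ (unwindStep G)^[i + 1] D) - f (F ∆ (unwindStep G)^[i] D)) ^ 2) :=
        Finset.sum_le_sum fun F _ =>
          mul_le_mul_of_nonneg_left (sq_sub_le_sum_path f F hD) (by positivity)
    _ = G.edgeFinset.card * ∑ i ∈ Finset.range D.card, ∑ F ∈ graphsWithBoundary G ∅,
        x ^ (F.card + (F ∆ D).card) *
      (f (F ∆ (unwindStep G)^[i + 1] D) - f (F ∆ (unwindStep G)^[i] D)) ^ 2 := by
        rw [Finset.sum_comm, Finset.mul_sum]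
        refine Finset.sum_congr rfl fun F _ => ?_
        rw [← Finset.mul_sum]; ring
    _ ≤ _ := by
        refine mul_le_mul_of_nonneg_left ?_ (by positivity)
        set H : Sym2 V → ℝ := fun e => ∑ A ∈ wormSpace G,
          edgeEnergy G x f A e * x ^ (D ∆ insert e A).card with hH
        have hH0 : ∀ e, 0 ≤ H e := fun e => Finset.sum_nonneg fun A _ =>
          mul_nonneg (edgeEnergy_nonneg hx f A e) (by positivity)
        -- Each step is charged to the edge it removes. The value 0 assigned to `none` never occurs,
        -- since every step below |D| removes an edge.
        calc _ ≤ ∑ i ∈ Finset.range D.card,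
              (nextEdge G ((unwindStep G)^[i] D)).elim 0 H := by
              refine Finset.sum_le_sum fun i hi => ?_
              rw [Finset.mem_range] at hi
              obtain ⟨e, -, he, -, -⟩ := exists_nextEdge_iterate hD hi
              rw [he]
              exact sum_path_term_le hx f hD hi he
          _ = ∑ o ∈ (Finset.range D.card).image fun i => nextEdge G ((unwindStep G)^[i] D),
              o.elim 0 H := by
              rw [Finset.sum_image]
              intro i hi j hj hij
              simp only [Finset.coe_range, Set.mem_Iio] at hi hj
              rcases lt_trichotomy i j with h | h | h
              · exact absurd hij (nextEdge_iterate_ne hD h hj)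
              · exact h
              · exact absurd hij.symm (nextEdge_iterate_ne hD h hi)
          _ ≤ ∑ o ∈ G.edgeFinset.image some, o.elim 0 H := by
              refine Finset.sum_le_sum_of_subset_of_nonneg ?_ fun o _ _ => ?_
              · intro o ho
                obtain ⟨i, hi, rfl⟩ := Finset.mem_image.1 ho
                rw [Finset.mem_range] at hi
                obtain ⟨e, he, h1, -, -⟩ := exists_nextEdge_iterate hD hi
                rw [h1]
                refine Finset.mem_image_of_mem _ ((mem_wormSpace.1 hD).1 ?_)
                exact iterate_unwindStep_anti (G := G) D (Nat.zero_le i) he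
              · cases o with
                | none => exact le_rfl
                | some e => exact hH0 e
          _ = ∑ e ∈ G.edgeFinset, H e := by
              rw [Finset.sum_image fun _ _ _ _ h => Option.some.inj h]; rfl

/-- For each F the second end I is parametrised by D = F ∆ I, which has the same boundary and hence
the same coefficient. After the path estimate D occurs only in the encoding weight, whose sum
`sum_wormSpace_symmDiff_le` bounds. -/
theorem sum_pairs_le {x : ℝ} (hx0 : 0 < x) (hx1 : x < 1) (f : Finset (Sym2 V) → ℝ) :
    ∑ F ∈ graphsWithBoundary G ∅, x ^ F.card *
      ∑ I ∈ wormSpace G, wormWeight x I * (f I - f F) ^ 2 ≤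
    G.edgeFinset.card * ((Fintype.card V : ℝ) ^ 2 * loopSum G x ∅) *
      ∑ A ∈ wormSpace G, ∑ e ∈ G.edgeFinset, edgeEnergy G x f A e := by
  have h1 : ∀ F ∈ graphsWithBoundary G ∅, x ^ F.card *
      ∑ I ∈ wormSpace G, wormWeight x I * (f I - f F) ^ 2 =
      ∑ D ∈ wormSpace G, boundaryCoeff (oddVertices D) *
        (x ^ (F.card + (F ∆ D).card) * (f (F ∆ D) - f F) ^ 2) := by
    intro F hF
    rw [Finset.mul_sum]
    refine (Finset.sum_bij' (fun D _ => F ∆ D) (fun D _ => F ∆ D)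
      (fun D hD => (symmDiff_mem_wormSpace hF hD).1)
      (fun D hD => (symmDiff_mem_wormSpace hF hD).1)
      (fun D _ => symmDiff_symmDiff_cancel_left _ _)
      (fun D _ => symmDiff_symmDiff_cancel_left _ _) (fun D hD => ?_)).symm
    rw [wormWeight_eq, (symmDiff_mem_wormSpace hF hD).2, pow_add]
    ring
  rw [Finset.sum_congr rfl h1, Finset.sum_comm]
  calc _ = ∑ D ∈ wormSpace G, boundaryCoeff (oddVertices D) *
        ∑ F ∈ graphsWithBoundary G ∅,
          x ^ (F.card + (F ∆ D).card) * (f (F ∆ D) - f F) ^ 2 := by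
        simp only [Finset.mul_sum]
    _ ≤ ∑ D ∈ wormSpace G, boundaryCoeff (oddVertices D) *
        (G.edgeFinset.card * ∑ e ∈ G.edgeFinset, ∑ A ∈ wormSpace G,
          edgeEnergy G x f A e * x ^ (D ∆ insert e A).card) :=
        Finset.sum_le_sum fun D hD =>
          mul_le_mul_of_nonneg_left (sum_path_le hx0 f hD) (boundaryCoeff_nonneg _)
    _ = G.edgeFinset.card * ∑ A ∈ wormSpace G, ∑ e ∈ G.edgeFinset, edgeEnergy G x f A e *
        ∑ D ∈ wormSpace G, boundaryCoeff (oddVertices D) * x ^ (D ∆ insert e A).card := by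
        rw [Finset.sum_comm (s := wormSpace G) (t := G.edgeFinset)]
        simp only [Finset.mul_sum]
        rw [Finset.sum_comm (s := wormSpace G) (t := G.edgeFinset)]
        refine Finset.sum_congr rfl fun e _ => ?_
        rw [Finset.sum_comm]
        refine Finset.sum_congr rfl fun A _ => Finset.sum_congr rfl fun D _ => by ring
    _ ≤ G.edgeFinset.card * ∑ A ∈ wormSpace G, ∑ e ∈ G.edgeFinset, edgeEnergy G x f A e *
        ((Fintype.card V : ℝ) ^ 2 * loopSum G x ∅) := by
        refine mul_le_mul_of_nonneg_left (Finset.sum_le_sum fun A hA =>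
          Finset.sum_le_sum fun e he => mul_le_mul_of_nonneg_left ?_
            (edgeEnergy_nonneg hx0 f A e)) (by positivity)
        exact sum_wormSpace_symmDiff_le hx0 hx1
          (Finset.insert_subset he (mem_wormSpace.1 hA).1)
    _ = _ := by
        simp only [← Finset.sum_mul]; ring

end Paths

/-! ### The Poincaré inequality and the mixing time -/

section Mixing

variable {V : Type*} [Fintype V] [DecidableEq V] {G : SimpleGraph V} [DecidableRel G.Adj]

theorem pow_insert_le {x : ℝ} (hx0 : 0 < x) (hx1 : x < 1) (A : Finset (Sym2 V)) (e : Sym2 V) :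
    x ^ (insert e A).card ≤ x ^ A.card ∧ x ^ (insert e A).card ≤ x ^ (A ∆ {e}).card := by
  constructor <;> refine pow_le_pow_of_le_one hx0.le hx1.le (Finset.card_le_card ?_)
  · exact Finset.subset_insert _ _
  · intro f hf
    rcases Finset.mem_symmDiff.1 hf with h | h
    · exact Finset.mem_insert_of_mem h.1
    · rw [Finset.mem_singleton.1 h.1]; exact Finset.mem_insert_self _ _

/-- The flow is half of a minimum of the two weights divided by degrees. The factor 2Δ undoes the
laziness and the choice of a neighbour. -/
theorem flow_ge [Nonempty V] {x : ℝ} (hx0 : 0 < x) (hx1 : x < 1) {A : Finset (Sym2 V)}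
    (hA : A ∈ wormSpace G) {u v : V} (hu : u ∈ startVertices A) (huv : G.Adj u v) :
    x ^ (insert s(u, v) A).card ≤ 2 * G.maxDegree * flow G x A u v := by
  obtain ⟨h1, h2⟩ := pow_insert_le hx0 hx1 A s(u, v)
  have hdu : 0 < (G.degree u : ℝ) := by
    exact_mod_cast (G.degree_pos_iff_exists_adj u).2 ⟨v, huv⟩
  have hdv : 0 < (G.degree v : ℝ) := by
    exact_mod_cast (G.degree_pos_iff_exists_adj v).2 ⟨u, huv.symm⟩
  have hu' : (G.degree u : ℝ) ≤ G.maxDegree := by exact_mod_cast G.degree_le_maxDegree u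
  have hv' : (G.degree v : ℝ) ≤ G.maxDegree := by exact_mod_cast G.degree_le_maxDegree v
  have key : ∀ d : ℝ, 0 < d → d ≤ G.maxDegree → ∀ y, x ^ (insert s(u, v) A).card ≤ y →
      x ^ (insert s(u, v) A).card ≤ G.maxDegree * (y * d⁻¹) := by
    intro d hd hd' y hy
    have hy0 : 0 ≤ y := (pow_pos hx0 _).le.trans hy
    calc _ ≤ y * (d * d⁻¹) := by rw [mul_inv_cancel₀ hd.ne', mul_one]; exact hy
      _ = d * (y * d⁻¹) := by ring
      _ ≤ _ := by gcongr
  by_cases h0 : oddVertices A = ∅ ∨ oddVertices (A ∆ {s(u, v)}) = ∅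
  · rw [flow_eq_of_even hx0 hA hu huv h0]
    have := key _ hdu hu' _ (le_min h1 h2)
    linarith
  · rw [not_or] at h0
    have hs := startVertices_of_ne_empty h0.1
    have hv : v ∉ oddVertices A := by
      intro hv
      have h3 : (oddVertices A).card = 2 := by
        rcases (mem_wormSpace.1 hA).2 with h | h
        · exact absurd (Finset.card_eq_zero.1 h) h0.1
        · exact h
      have h4 : {u, v} = oddVertices A := Finset.eq_of_subset_of_card_le
          (by intro z; simp only [Finset.mem_insert, Finset.mem_singleton]
              rintro (rfl | rfl)
              · exact hs ▸ hu
              · exact hv) (by rw [h3, Finset.card_pair huv.ne])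
      apply h0.2
      rw [oddVertices_toggle, h4, symmDiff_self]; rfl
    rw [flow_eq_of_two hx0 hA (hs ▸ hu) hv huv]
    have := le_min (key _ hdu hu' _ h1) (key _ hdv hv' _ h2)
    rw [← mul_min_of_nonneg _ _ (by positivity)] at this
    linarith

/-- The Dirichlet form of the chain (unnormalised, summed over ordered moves). -/
def dirichlet (G : SimpleGraph V) [DecidableRel G.Adj] (x : ℝ) (f : Finset (Sym2 V) → ℝ) : ℝ :=
  ∑ A ∈ wormSpace G, wormWeight x A *
    ∑ p : V × V, moveProb G x A p.1 p.2 * (f (A ∆ {s(p.1, p.2)}) - f A) ^ 2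

/-- The left side counts undirected edges and the Dirichlet form counts ordered moves, so one
admissible orientation per edge is enough. -/
theorem sum_edgeEnergy_le [Nonempty V] {x : ℝ} (hx0 : 0 < x) (hx1 : x < 1)
    (f : Finset (Sym2 V) → ℝ) :
    ∑ A ∈ wormSpace G, ∑ e ∈ G.edgeFinset, edgeEnergy G x f A e ≤
      2 * G.maxDegree * dirichlet G x f := by
  rw [dirichlet, Finset.mul_sum]
  refine Finset.sum_le_sum fun A hA => ?_
  set h : V × V → ℝ := fun p => 2 * G.maxDegree *
    (flow G x A p.1 p.2 * (f (A ∆ {s(p.1, p.2)}) - f A) ^ 2) with hh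
  have h0 : ∀ p, 0 ≤ h p := fun p => by
    have := flow_nonneg (G := G) hx0 A p.1 p.2
    positivity
  have h1 : 2 * (G.maxDegree : ℝ) * (wormWeight x A *
      ∑ p : V × V, moveProb G x A p.1 p.2 * (f (A ∆ {s(p.1, p.2)}) - f A) ^ 2) =
      ∑ p : V × V, h p := by
    rw [hh, ← Finset.mul_sum, Finset.mul_sum (a := wormWeight x A)]
    congr 1
    refine Finset.sum_congr rfl fun p _ => ?_
    rw [flow, if_pos hA, mul_assoc]
  rw [h1]
  -- Edges whose toggle stays in 𝒲 are oriented away from a start vertex. The orientation of the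
  -- others is arbitrary, because they carry no energy.
  have hex : ∀ e : Sym2 V, ∃ p : V × V, e = s(p.1, p.2) ∧
      (e ∈ G.edgeFinset → A ∆ {e} ∈ wormSpace G → p.1 ∈ startVertices A ∧ G.Adj p.1 p.2) := by
    intro e
    by_cases he : e ∈ G.edgeFinset ∧ A ∆ {e} ∈ wormSpace G
    · obtain ⟨u, v, h2, h3, h4⟩ := exists_mem_startVertices hA he.1 he.2
      exact ⟨(u, v), h2, fun _ _ => ⟨h3, h4⟩⟩
    · induction e using Sym2.ind with
      | _ u v => exact ⟨(u, v), rfl, fun h h' => absurd ⟨h, h'⟩ he⟩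
  choose φ hφ1 hφ2 using hex
  have hinj : Function.Injective φ := fun a b hab => by rw [hφ1 a, hφ1 b, hab]
  calc _ ≤ ∑ e ∈ G.edgeFinset, h (φ e) := by
        refine Finset.sum_le_sum fun e he => ?_
        rw [edgeEnergy]
        split_ifs with hAe
        · obtain ⟨h3, h4⟩ := hφ2 e he hAe
          have h5 := flow_ge hx0 hx1 hA h3 h4
          rw [← hφ1 e] at h5
          rw [hh]
          dsimp only
          rw [← hφ1 e, ← mul_assoc]
          exact mul_le_mul_of_nonneg_right h5 (sq_nonneg _)
        · exact h0 _
    _ = ∑ p ∈ G.edgeFinset.image φ, h p := (Finset.sum_image hinj.injOn).symm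
    _ ≤ _ := Finset.sum_le_univ_sum_of_nonneg h0

/-! ### The Poincaré inequality and decay of the variance. -/

variable (G) in
/-- The mean of `f` in the stationary distribution. -/
def wormMean (x : ℝ) (f : Finset (Sym2 V) → ℝ) : ℝ :=
  (∑ A ∈ wormSpace G, wormWeight x A * f A) / wormTotal G x

variable (G) in
/-- The unnormalised variance of `f` in the stationary distribution. -/
def wormVar (x : ℝ) (f : Finset (Sym2 V) → ℝ) : ℝ :=
  ∑ A ∈ wormSpace G, wormWeight x A * (f A - wormMean G x f) ^ 2

theorem sum_sq_sub_eq [Nonempty V] {x : ℝ} (hx : 0 < x) (f : Finset (Sym2 V) → ℝ) (c : ℝ) :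
    ∑ A ∈ wormSpace G, wormWeight x A * (f A - c) ^ 2 =
      ∑ A ∈ wormSpace G, wormWeight x A * f A ^ 2 +
        wormTotal G x * ((c - wormMean G x f) ^ 2 - wormMean G x f ^ 2) := by
  have hT := wormTotal_pos (G := G) hx
  have h1 : ∑ A ∈ wormSpace G, wormWeight x A * f A = wormTotal G x * wormMean G x f := by
    rw [wormMean]; field_simp
  have h2 : ∀ A, wormWeight x A * (f A - c) ^ 2 = wormWeight x A * f A ^ 2 -
      2 * c * (wormWeight x A * f A) + c ^ 2 * wormWeight x A := fun A => by ring
  simp only [h2, Finset.sum_add_distrib, Finset.sum_sub_distrib, ← Finset.mul_sum, h1]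
  rw [← wormTotal]
  ring

theorem wormVar_le [Nonempty V] {x : ℝ} (hx : 0 < x) (f : Finset (Sym2 V) → ℝ) (c : ℝ) :
    wormVar G x f ≤ ∑ A ∈ wormSpace G, wormWeight x A * (f A - c) ^ 2 := by
  rw [wormVar, sum_sq_sub_eq hx f, sum_sq_sub_eq hx f]
  have hT := wormTotal_pos (G := G) hx
  have : 0 ≤ wormTotal G x * (c - wormMean G x f) ^ 2 := by positivity
  nlinarith

/-- The variance is at most the mean square distance to any constant, so f(F) may be used for each
even F. Averaging over F with weights x^|F| produces the pair sum of `sum_pairs_le`, and the factor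
Z_∅ cancels. -/
theorem poincare [Nonempty V] {x : ℝ} (hx0 : 0 < x) (hx1 : x < 1) (f : Finset (Sym2 V) → ℝ) :
    wormVar G x f ≤ 2 * (G.maxDegree : ℝ) * G.edgeFinset.card * (Fintype.card V : ℝ) ^ 2 *
      dirichlet G x f := by
  have h0 := loopSum_pos (G := G) hx0
  have h1 : loopSum G x ∅ * wormVar G x f ≤ ∑ F ∈ graphsWithBoundary G ∅, x ^ F.card *
      ∑ I ∈ wormSpace G, wormWeight x I * (f I - f F) ^ 2 := by
    rw [loopSum, Finset.sum_mul]
    exact Finset.sum_le_sum fun F _ =>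
      mul_le_mul_of_nonneg_left (wormVar_le hx0 f (f F)) (by positivity)
  have h2 := sum_pairs_le (G := G) hx0 hx1 f
  have h3 := sum_edgeEnergy_le (G := G) hx0 hx1 f
  have h4 := h1.trans (h2.trans (mul_le_mul_of_nonneg_left h3 (by positivity)))
  refine le_of_mul_le_mul_left (h4.trans_eq ?_) h0
  ring

theorem wormMean_psStep [Nonempty V] {x : ℝ} (hx : 0 < x) (hdeg : ∀ u, 0 < G.degree u)
    (f : Finset (Sym2 V) → ℝ) :
    wormMean G x (fun A => pmfExp (psStep G x A) f) = wormMean G x f := by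
  rw [wormMean, psStep_stationary hx hdeg, wormMean]

/-- Write Pf = f + s with s = ∑ p·δ and let q = ∑ p·δ² over the moves, δ being the increment of f.
Then P(f²) − (Pf)² = q − s², and s² ≤ (∑ p) q ≤ q/2 because the chain is lazy. -/
theorem wormVar_psStep_le [Nonempty V] {x : ℝ} (hx : 0 < x) (hdeg : ∀ u, 0 < G.degree u)
    (f : Finset (Sym2 V) → ℝ) :
    wormVar G x (fun A => pmfExp (psStep G x A) f) ≤ wormVar G x f - 1 / 2 * dirichlet G x f := by
  -- Both functions have the same mean, so only second moments differ. Replacing the mean of f² by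
  -- that of P(f²) leaves a claim about a single state.
  rw [wormVar, wormVar, sum_sq_sub_eq hx, sum_sq_sub_eq hx f, wormMean_psStep hx hdeg,
    ← psStep_stationary hx hdeg fun A => f A ^ 2]
  have key : ∀ A, pmfExp (psStep G x A) f ^ 2 + 1 / 2 * ∑ p : V × V, moveProb G x A p.1 p.2 *
      (f (A ∆ {s(p.1, p.2)}) - f A) ^ 2 ≤ pmfExp (psStep G x A) fun A => f A ^ 2 := by
    intro A
    rw [pmfExp_psStep hx hdeg, pmfExp_psStep hx hdeg]
    have h1 : ∑ p : V × V, moveProb G x A p.1 p.2 * (f (A ∆ {s(p.1, p.2)}) ^ 2 - f A ^ 2) =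
        ∑ p : V × V, moveProb G x A p.1 p.2 * (f (A ∆ {s(p.1, p.2)}) - f A) ^ 2 + 2 * f A *
        ∑ p : V × V, moveProb G x A p.1 p.2 * (f (A ∆ {s(p.1, p.2)}) - f A) := by
      rw [Finset.mul_sum, ← Finset.sum_add_distrib]
      exact Finset.sum_congr rfl fun p _ => by ring
    have h2 : (∑ p : V × V, moveProb G x A p.1 p.2 * (f (A ∆ {s(p.1, p.2)}) - f A)) ^ 2 ≤
        (∑ p : V × V, moveProb G x A p.1 p.2) *
        ∑ p : V × V, moveProb G x A p.1 p.2 * (f (A ∆ {s(p.1, p.2)}) - f A) ^ 2 := by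
      refine Finset.sum_sq_le_sum_mul_sum_of_sq_eq_mul _
        (fun p _ => moveProb_nonneg hx A p.1 p.2)
        (fun p _ => mul_nonneg (moveProb_nonneg hx A p.1 p.2) (sq_nonneg _))
        (fun p _ => by ring)
    have h3 := sum_moveProb_le (G := G) x hdeg A
    have h4 : 0 ≤ ∑ p : V × V, moveProb G x A p.1 p.2 * (f (A ∆ {s(p.1, p.2)}) - f A) ^ 2 :=
      Finset.sum_nonneg fun p _ => mul_nonneg (moveProb_nonneg hx A p.1 p.2) (sq_nonneg _)
    rw [h1]
    nlinarith [mul_le_mul_of_nonneg_right h3 h4]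
  have h5 := Finset.sum_le_sum fun A (_ : A ∈ wormSpace G) =>
    mul_le_mul_of_nonneg_left (key A) (wormWeight_nonneg hx A)
  simp only [mul_add, Finset.sum_add_distrib] at h5
  have h6 : ∑ A ∈ wormSpace G, wormWeight x A * (1 / 2 * ∑ p : V × V, moveProb G x A p.1 p.2 *
      (f (A ∆ {s(p.1, p.2)}) - f A) ^ 2) = 1 / 2 * dirichlet G x f := by
    rw [dirichlet, Finset.mul_sum]
    exact Finset.sum_congr rfl fun A _ => by ring
  rw [h6] at h5
  linarith

theorem pmfExp_psRun_succ [Nonempty V] (x : ℝ) (t : ℕ) (f : Finset (Sym2 V) → ℝ) :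
    (fun A => pmfExp (psRun G x (t + 1) A) f) =
      fun A => pmfExp (psStep G x A) fun B => pmfExp (psRun G x t B) f := by
  funext A
  rw [psRun, pmfExp_bind]

/-- The bound on the relaxation time given by the canonical paths. -/
def relaxBound (G : SimpleGraph V) [DecidableRel G.Adj] : ℝ :=
  4 * (G.maxDegree : ℝ) * G.edgeFinset.card * (Fintype.card V : ℝ) ^ 2

theorem wormVar_psRun_le [Nonempty V] {x : ℝ} (hx0 : 0 < x) (hx1 : x < 1)
    (hdeg : ∀ u, 0 < G.degree u) (hR : 1 ≤ relaxBound G) (f : Finset (Sym2 V) → ℝ) (t : ℕ) :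
    wormMean G x (fun A => pmfExp (psRun G x t A) f) = wormMean G x f ∧
    wormVar G x (fun A => pmfExp (psRun G x t A) f) ≤
      (1 - (relaxBound G)⁻¹) ^ t * wormVar G x f := by
  induction t with
  | zero => simp [psRun, pmfExp_pure]
  | succ t ih =>
    rw [pmfExp_psRun_succ]
    refine ⟨by rw [wormMean_psStep hx0 hdeg, ih.1], ?_⟩
    set g := fun A => pmfExp (psRun G x t A) f
    have h1 := wormVar_psStep_le hx0 hdeg g
    have h2 := poincare (G := G) hx0 hx1 g
    have h3 : wormVar G x g ≤ relaxBound G * (1 / 2 * dirichlet G x g) :=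
      h2.trans_eq (by rw [relaxBound]; ring)
    have h4 : (relaxBound G)⁻¹ * wormVar G x g ≤ 1 / 2 * dirichlet G x g := by
      rwa [inv_mul_le_iff₀ (by linarith)]
    -- Nonnegativity of the contraction factor is where the relaxation bound must be at least 1.
    have h5 : 0 ≤ 1 - (relaxBound G)⁻¹ := by
      have := inv_le_one_of_one_le₀ hR
      linarith
    calc _ ≤ (1 - (relaxBound G)⁻¹) * wormVar G x g := by linarith
      _ ≤ (1 - (relaxBound G)⁻¹) * ((1 - (relaxBound G)⁻¹) ^ t * wormVar G x f) :=
          mul_le_mul_of_nonneg_left ih.2 h5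
      _ = _ := by ring

theorem degree_pos_of_connected (hc : G.Connected) (hn : 2 ≤ Fintype.card V) (u : V) :
    0 < G.degree u := by
  have : Nontrivial V := Fintype.one_lt_card_iff_nontrivial.1 hn
  exact hc.preconnected.degree_pos_of_nontrivial u

theorem wormMean_indicator (x : ℝ) (𝒜 : Finset (Finset (Sym2 V))) :
    wormMean G x (fun A => if A ∈ 𝒜 then 1 else 0) = wormProb G x 𝒜 := by
  rw [wormMean, wormProb, wormTotal]
  congr 1
  simp only [mul_ite, mul_one, mul_zero]
  rw [← Finset.sum_filter, Finset.filter_mem_eq_inter, Finset.inter_comm]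

/-- The stationary variance of Pᵗf is at least its term at A₀, whose weight is at least x^m. The
variance of an indicator is at most the normalisation, which is at most n² 2^m. Their quotient is
the factor n² (2/x)^m. -/
theorem sq_psRun_sub_le [Nonempty V] {x : ℝ} (hx0 : 0 < x) (hx1 : x < 1)
    (hdeg : ∀ u, 0 < G.degree u) (hR : 1 ≤ relaxBound G) (hn : 2 ≤ Fintype.card V)
    (𝒜 : Finset (Finset (Sym2 V)))
    {A₀ : Finset (Sym2 V)} (hA₀ : A₀ ∈ wormSpace G) (t : ℕ) :
    (pmfExp (psRun G x t A₀) (fun A => if A ∈ 𝒜 then 1 else 0) - wormProb G x 𝒜) ^ 2 ≤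
      (1 - (relaxBound G)⁻¹) ^ t * ((Fintype.card V : ℝ) ^ 2 * (2 / x) ^ G.edgeFinset.card) := by
  set f : Finset (Sym2 V) → ℝ := fun A => if A ∈ 𝒜 then 1 else 0 with hf
  obtain ⟨h1, h2⟩ := wormVar_psRun_le hx0 hx1 hdeg hR f t
  have hw : x ^ G.edgeFinset.card ≤ wormWeight x A₀ := by
    rw [wormWeight_eq]
    have h3 : 1 ≤ boundaryCoeff (oddVertices A₀) := by
      have : (2 : ℝ) ≤ Fintype.card V := by exact_mod_cast hn
      rcases (mem_wormSpace.1 hA₀).2 with h | h <;> simp only [boundaryCoeff, h] <;> norm_num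
      linarith
    calc x ^ G.edgeFinset.card ≤ x ^ A₀.card :=
          pow_le_pow_of_le_one hx0.le hx1.le (Finset.card_le_card (mem_wormSpace.1 hA₀).1)
      _ ≤ _ := le_mul_of_one_le_left (by positivity) h3
  have hZ : wormTotal G x ≤ (Fintype.card V : ℝ) ^ 2 * 2 ^ G.edgeFinset.card := by
    refine (wormTotal_le hx0 hx1).trans (mul_le_mul_of_nonneg_left ?_ (by positivity))
    calc loopSum G x ∅ ≤ ∑ A ∈ graphsWithBoundary G ∅, 1 :=
          Finset.sum_le_sum fun A _ => pow_le_one₀ hx0.le hx1.le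
      _ ≤ ∑ A ∈ G.edgeFinset.powerset, 1 :=
          Finset.sum_le_sum_of_subset_of_nonneg (Finset.filter_subset _ _) fun _ _ _ => zero_le_one
      _ = 2 ^ G.edgeFinset.card := by
          rw [Finset.sum_const, Finset.card_powerset]; simp
  have hV : wormVar G x f ≤ wormTotal G x := by
    refine (wormVar_le hx0 f 0).trans (Finset.sum_le_sum fun A _ => ?_)
    refine mul_le_of_le_one_right (wormWeight_nonneg hx0 A) ?_
    rw [hf]; dsimp only; split_ifs <;> norm_num
  have h3 : wormWeight x A₀ * (pmfExp (psRun G x t A₀) f - wormProb G x 𝒜) ^ 2 ≤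
      wormVar G x (fun A => pmfExp (psRun G x t A) f) := by
    rw [wormVar, h1, hf, wormMean_indicator, ← hf]
    exact Finset.single_le_sum (f := fun A => wormWeight x A *
      (pmfExp (psRun G x t A) f - wormProb G x 𝒜) ^ 2)
      (fun A _ => mul_nonneg (wormWeight_nonneg hx0 A) (sq_nonneg _)) hA₀
  have h5 : 0 ≤ 1 - (relaxBound G)⁻¹ := by
    have := inv_le_one_of_one_le₀ hR
    linarith
  have hxm : 0 < x ^ G.edgeFinset.card := by positivity
  have h6 : x ^ G.edgeFinset.card * (pmfExp (psRun G x t A₀) f - wormProb G x 𝒜) ^ 2 ≤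
      (1 - (relaxBound G)⁻¹) ^ t * ((Fintype.card V : ℝ) ^ 2 * 2 ^ G.edgeFinset.card) :=
    calc _ ≤ _ := mul_le_mul_of_nonneg_right hw (sq_nonneg _)
      _ ≤ _ := h3.trans h2
      _ ≤ _ := mul_le_mul_of_nonneg_left (hV.trans hZ) (pow_nonneg h5 t)
  refine le_of_mul_le_mul_left (h6.trans_eq ?_) hxm
  rw [div_pow]; field_simp

/-- Connectedness gives n ≤ m + 1 ≤ 2^m. Together with (2/x)^m this explains the constant 8 in
log(8/x). -/
theorem card_sq_le_four_pow (hc : G.Connected) :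
    (Fintype.card V : ℝ) ^ 2 ≤ 4 ^ G.edgeFinset.card := by
  have h1 := hc.card_vert_le_card_edgeSet_add_one
  rw [Nat.card_eq_fintype_card, Nat.card_eq_fintype_card, ← SimpleGraph.edgeFinset_card] at h1
  have h2 : Fintype.card V ≤ 2 ^ G.edgeFinset.card := h1.trans Nat.lt_two_pow_self
  have h3 : (Fintype.card V : ℝ) ≤ 2 ^ G.edgeFinset.card := by exact_mod_cast h2
  calc (Fintype.card V : ℝ) ^ 2 ≤ (2 ^ G.edgeFinset.card) ^ 2 := by gcongr
    _ = 4 ^ G.edgeFinset.card := by rw [← pow_mul, mul_comm, pow_mul]; norm_num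

/-- After the number of steps given by `mixingBound` the chain is within `δ` of stationarity. -/
theorem abs_psRun_sub_le [Nonempty V] {x : ℝ} (hx0 : 0 < x) (hx1 : x < 1) (hc : G.Connected)
    (hn : 2 ≤ Fintype.card V) (𝒜 : Finset (Finset (Sym2 V))) {A₀ : Finset (Sym2 V)}
    (hA₀ : A₀ ∈ wormSpace G) {δ : ℝ} (hδ0 : 0 < δ) (hδ1 : δ ≤ 1) {t : ℕ}
    (ht : mixingBound G x δ ≤ t) :
    |pmfExp (psRun G x t A₀) (fun A => if A ∈ 𝒜 then 1 else 0) - wormProb G x 𝒜| ≤ δ := by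
  have hdeg := degree_pos_of_connected hc hn
  obtain ⟨u⟩ := ‹Nonempty V›
  obtain ⟨v, huv⟩ := (G.degree_pos_iff_exists_adj u).1 (hdeg u)
  have hm : (1 : ℝ) ≤ G.edgeFinset.card := by
    exact_mod_cast Finset.card_pos.2 ⟨s(u, v), by simpa using huv⟩
  have hΔ : (1 : ℝ) ≤ G.maxDegree := by
    exact_mod_cast (hdeg u).trans_le (G.degree_le_maxDegree u)
  have hn' : (2 : ℝ) ≤ Fintype.card V := by exact_mod_cast hn
  have hR : 1 ≤ relaxBound G := by
    have h1 : (1 : ℝ) ≤ (Fintype.card V : ℝ) ^ 2 := by nlinarith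
    have h2 : (1 : ℝ) ≤ (G.maxDegree : ℝ) * G.edgeFinset.card := by nlinarith
    rw [relaxBound]; nlinarith
  have h1 := sq_psRun_sub_le hx0 hx1 hdeg hR hn 𝒜 hA₀ t
  refine abs_le_of_sq_le_sq (h1.trans ?_) hδ0.le
  set m := G.edgeFinset.card with hm'
  set n : ℝ := (Fintype.card V : ℝ)
  set L : ℝ := m * Real.log (8 / x) - Real.log δ with hL
  have hlog : 0 ≤ Real.log (8 / x) := Real.log_nonneg (by rw [le_div_iff₀ hx0]; linarith)
  have hlogδ : Real.log δ ≤ 0 := Real.log_nonpos hδ0.le hδ1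
  have hL0 : 0 ≤ L := by
    have : 0 ≤ (m : ℝ) * Real.log (8 / x) := by positivity
    linarith
  -- The squared error is at most exp(−t / relaxation bound) (8/x)^m. An exponent of 2L turns this
  -- into δ² (8/x)^(-m).
  have h2 : 2 * L ≤ (relaxBound G)⁻¹ * t := by
    rw [inv_mul_eq_div, le_div_iff₀ (by linarith)]
    refine le_trans ?_ ht
    have e1 : mixingBound G x δ = (1 / (2 * x)) * (3 + 1 / (m * x)) * L *
        ((G.maxDegree : ℝ) * n ^ 6 * m) := by
      rw [mixingBound, hL]
      rw [← hm']
      have : (m : ℝ) ≠ 0 := by positivity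
      change 1 / (2 * x) * (Real.log (8 / x) - Real.log δ / m) * (3 + 1 / (m * x)) *
        (G.maxDegree : ℝ) * n ^ 6 * (m : ℝ) ^ 2 = _
      field_simp
    have e2 : 2 * L * relaxBound G = (8 * n ^ 2) * L * ((G.maxDegree : ℝ) * m) := by
      rw [relaxBound]; ring
    rw [e1, e2]
    have h3 : (1 : ℝ) / 2 ≤ 1 / (2 * x) := by
      rw [div_le_div_iff₀ (by norm_num) (by positivity)]; linarith
    have h4 : (3 : ℝ) ≤ 3 + 1 / (m * x) := by
      have : 0 ≤ 1 / ((m : ℝ) * x) := by positivity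
      linarith
    -- The prescribed number of steps is generous: only n ≥ 2, hence n⁴ ≥ 16, is needed for the
    -- comparison.
    have h5 : 8 * n ^ 2 ≤ 1 / 2 * 3 * n ^ 6 := by
      have : 16 ≤ n ^ 4 := by
        calc (16 : ℝ) = 2 ^ 4 := by norm_num
          _ ≤ n ^ 4 := by gcongr
      nlinarith [sq_nonneg n]
    calc 8 * n ^ 2 * L * ((G.maxDegree : ℝ) * m) ≤
        1 / 2 * 3 * n ^ 6 * L * ((G.maxDegree : ℝ) * m) := by gcongr
      _ ≤ (1 / (2 * x)) * (3 + 1 / (m * x)) * n ^ 6 * L * ((G.maxDegree : ℝ) * m) := by gcongr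
      _ = _ := by ring
  have h6 : (1 - (relaxBound G)⁻¹) ^ t ≤ Real.exp (-(2 * L)) := by
    have h7 : 0 ≤ 1 - (relaxBound G)⁻¹ := by
      have := inv_le_one_of_one_le₀ hR
      linarith
    calc _ ≤ Real.exp (-(relaxBound G)⁻¹) ^ t :=
          pow_le_pow_left₀ h7 (Real.one_sub_le_exp_neg _) t
      _ = Real.exp (-((relaxBound G)⁻¹ * t)) := by rw [← Real.exp_nat_mul]; ring_nf
      _ ≤ _ := Real.exp_le_exp.2 (by linarith)
  have h7 : n ^ 2 * (2 / x) ^ m ≤ (8 / x) ^ m := by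
    calc n ^ 2 * (2 / x) ^ m ≤ 4 ^ m * (2 / x) ^ m := by
          gcongr; exact card_sq_le_four_pow hc
      _ = _ := by rw [← mul_pow]; congr 1; ring
  have h8 : (8 / x) ^ m = Real.exp (m * Real.log (8 / x)) := by
    rw [Real.exp_nat_mul, Real.exp_log (by positivity)]
  calc _ ≤ Real.exp (-(2 * L)) * Real.exp (m * Real.log (8 / x)) := by
        rw [← h8]; gcongr
    _ = Real.exp (2 * Real.log δ - m * Real.log (8 / x)) := by
        rw [← Real.exp_add]; congr 1; rw [hL]; ring
    _ ≤ Real.exp (2 * Real.log δ) := Real.exp_le_exp.2 (by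
        have : 0 ≤ (m : ℝ) * Real.log (8 / x) := by positivity
        linarith)
    _ = δ ^ 2 := by
        rw [← Nat.cast_two (R := ℝ), Real.exp_nat_mul, Real.exp_log hδ0]

end Mixing

/-! ### Accuracy of the sampling scheme -/

section Sampling

/-- The expectation of a nonnegative function. -/
def pmfLE {α : Type*} (μ : PMF α) (g : α → ENNReal) : ENNReal := ∑' a, μ a * g a

section

variable {α β : Type*}

theorem pmfLE_pure (a : α) (g : α → ENNReal) : pmfLE (PMF.pure a) g = g a := by
  rw [pmfLE, tsum_eq_single a]
  · simp
  · intro b hb; simp [PMF.pure_apply, hb]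

theorem pmfLE_bind (μ : PMF α) (κ : α → PMF β) (g : β → ENNReal) :
    pmfLE (μ.bind κ) g = pmfLE μ fun a => pmfLE (κ a) g := by
  simp only [pmfLE, PMF.bind_apply, ← ENNReal.tsum_mul_left, ← ENNReal.tsum_mul_right]
  rw [ENNReal.tsum_comm]
  simp only [mul_assoc]

theorem pmfLE_map (μ : PMF α) (f : α → β) (g : β → ENNReal) :
    pmfLE (μ.map f) g = pmfLE μ fun a => g (f a) := by
  rw [← PMF.bind_pure_comp, pmfLE_bind]
  simp only [Function.comp, pmfLE_pure]

theorem pmfLE_const (μ : PMF α) (c : ENNReal) : pmfLE μ (fun _ => c) = c := by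
  rw [pmfLE, ENNReal.tsum_mul_right, μ.tsum_coe, one_mul]

theorem pmfLE_add (μ : PMF α) (g h : α → ENNReal) :
    pmfLE μ (fun a => g a + h a) = pmfLE μ g + pmfLE μ h := by
  simp only [pmfLE, mul_add, ENNReal.tsum_add]

theorem pmfLE_const_mul (μ : PMF α) (c : ENNReal) (g : α → ENNReal) :
    pmfLE μ (fun a => c * g a) = c * pmfLE μ g := by
  simp only [pmfLE, mul_left_comm, ENNReal.tsum_mul_left]

theorem pmfLE_mono {μ : PMF α} {g h : α → ENNReal} (hgh : ∀ a ∈ μ.support, g a ≤ h a) :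
    pmfLE μ g ≤ pmfLE μ h := by
  refine ENNReal.tsum_le_tsum fun a => ?_
  by_cases ha : μ a = 0
  · simp [ha]
  · gcongr; exact hgh a ((PMF.mem_support_iff _ _).2 ha)

theorem pmfLE_eq_ofReal [Fintype α] (μ : PMF α) {g : α → ℝ} (hg : ∀ a, 0 ≤ g a) :
    pmfLE μ (fun a => ENNReal.ofReal (g a)) = ENNReal.ofReal (pmfExp μ g) := by
  rw [pmfLE, tsum_fintype, pmfExp, ENNReal.ofReal_sum_of_nonneg fun a _ =>
    mul_nonneg ENNReal.toReal_nonneg (hg a)]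
  refine Finset.sum_congr rfl fun a _ => ?_
  rw [ENNReal.ofReal_mul ENNReal.toReal_nonneg, ENNReal.ofReal_toReal (μ.apply_ne_top a)]

theorem toMeasure_eq_pmfLE [MeasurableSpace α] (μ : PMF α) {s : Set α} (hs : MeasurableSet s) :
    μ.toMeasure s = pmfLE μ (s.indicator 1) := by
  rw [PMF.toMeasure_apply _ hs, pmfLE]
  refine tsum_congr fun a => ?_
  by_cases ha : a ∈ s <;> simp [ha]

/-- Failure probabilities are expectations of indicators, which can be bounded pointwise and added.
-/
theorem approximates_iff {μ : PMF ℝ} {q ε η : ℝ} (hη0 : 0 ≤ η) :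
    Approximates μ q ε η ↔
      pmfLE μ ((Set.Icc ((1 - ε) * q) ((1 + ε) * q))ᶜ.indicator 1) ≤ ENNReal.ofReal η := by
  rw [Approximates, ← toMeasure_eq_pmfLE _ measurableSet_Icc.compl,
    MeasureTheory.prob_compl_eq_one_sub measurableSet_Icc, ENNReal.ofReal_sub _ hη0,
    ENNReal.ofReal_one]
  constructor
  · intro h
    rw [tsub_le_iff_left] at h ⊢
    rwa [add_comm]
  · intro h
    rw [tsub_le_iff_left] at h ⊢
    rwa [add_comm]

theorem length_of_mem_support_iidDraws (μ : PMF α) (N : ℕ) :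
    ∀ l ∈ (iidDraws μ N).support, l.length = N := by
  induction N with
  | zero => intro l hl; simp [iidDraws] at hl; simp [hl]
  | succ N ih =>
    intro l hl
    simp only [iidDraws, PMF.mem_support_bind_iff, PMF.support_map, Set.mem_image] at hl
    obtain ⟨a, -, l', hl', rfl⟩ := hl
    simp [ih l' hl']

/-- The second moment of a sum of independent indicators. -/
theorem pmfLE_iidDraws_sq {μ : PMF ℝ} {p : ℝ} (hp0 : 0 ≤ p) (hp1 : p ≤ 1)
    (hμ : ∀ g, pmfLE μ g = ENNReal.ofReal p * g 1 + ENNReal.ofReal (1 - p) * g 0) (N : ℕ) (c : ℝ) :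
    pmfLE (iidDraws μ N) (fun l => ENNReal.ofReal ((l.sum - c) ^ 2)) =
      ENNReal.ofReal (N * (p * (1 - p)) + (N * p - c) ^ 2) := by
  -- The centre c varies because a first draw a leaves the remaining sum to be compared with c − a.
  induction N generalizing c with
  | zero => rw [iidDraws, pmfLE_pure]; simp
  | succ N ih =>
    have hp' : 0 ≤ 1 - p := by linarith
    have hpp : 0 ≤ p * (1 - p) := mul_nonneg hp0 hp'
    rw [iidDraws, pmfLE_bind, hμ]
    have h1 : ∀ a : ℝ, pmfLE ((iidDraws μ N).map fun l => a :: l)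
        (fun l => ENNReal.ofReal ((l.sum - c) ^ 2)) =
        ENNReal.ofReal (N * (p * (1 - p)) + (N * p - (c - a)) ^ 2) := by
      intro a
      rw [pmfLE_map, ← ih]
      congr 1; funext l
      rw [List.sum_cons]; congr 2; ring
    rw [h1, h1, ← ENNReal.ofReal_mul hp0, ← ENNReal.ofReal_mul hp',
      ← ENNReal.ofReal_add (by positivity) (by positivity)]
    congr 1
    push_cast
    ring

/-- The generating function of a number of successes is multiplicative over independent draws. -/
theorem pmfLE_iidDraws_countP (μ : PMF α) (bad : α → Bool) (c : ENNReal) (N : ℕ) :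
    pmfLE (iidDraws μ N) (fun l => c ^ l.countP bad) =
      (pmfLE μ fun a => if bad a then c else 1) ^ N := by
  induction N with
  | zero => rw [iidDraws, pmfLE_pure]; simp
  | succ N ih =>
    rw [iidDraws, pmfLE_bind]
    have h1 : ∀ a, pmfLE ((iidDraws μ N).map fun l => a :: l) (fun l => c ^ l.countP bad) =
        (if bad a then c else 1) * (pmfLE μ fun a => if bad a then c else 1) ^ N := by
      intro a
      rw [pmfLE_map, ← ih, ← pmfLE_const_mul]
      congr 1; funext l
      rw [List.countP_cons]
      split_ifs <;> ring
    simp only [h1]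
    rw [pow_succ, ← pmfLE_const_mul]
    congr 1; funext a; exact mul_comm _ _

end

/-! ### Order statistics -/

/-- For a downward closed property the entries of a sorted list that satisfy it form an initial
segment, whose length is their number. -/
theorem List.getElem_iff_lt_countP {s : List ℝ} (hs : s.SortedLE) {q : ℝ → Bool}
    (hq : ∀ y z, z ≤ y → q y → q z) {i : ℕ} (hi : i < s.length) :
    q s[i] ↔ i < s.countP q := by
  have hm := fun {a b : ℕ} (h : a ≤ b) (hb : b < s.length) =>
    hs.getElem_le_getElem_of_le (hi := h.trans_lt hb) (hj := hb) h
  constructor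
  · intro h
    have h1 : (s.take (i + 1)).countP q = (s.take (i + 1)).length := by
      rw [List.countP_eq_length]
      intro a ha
      obtain ⟨j, hj, rfl⟩ := List.getElem_of_mem ha
      rw [List.getElem_take]
      rw [List.length_take] at hj
      exact hq _ _ (hm (by omega) hi) h
    have h2 := (List.take_sublist (i + 1) s).countP_le (p := q)
    rw [h1, List.length_take] at h2
    omega
  · intro h
    by_contra hn
    have h1 : (s.drop i).countP q = 0 := by
      rw [List.countP_eq_zero]
      intro a ha
      obtain ⟨j, hj, rfl⟩ := List.getElem_of_mem ha
      rw [List.getElem_drop]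
      rw [List.length_drop] at hj
      exact fun h => hn (hq _ _ (hm (Nat.le_add_right i j) (by omega)) h)
    have h2 : s.countP q = (s.take i).countP q + (s.drop i).countP q := by
      rw [← List.countP_append, List.take_append_drop]
    have h3 := List.countP_le_length (p := q) (l := s.take i)
    rw [List.length_take] at h3
    omega

/-- The `i`-th smallest entry of a list. -/
def orderStat (l : List ℝ) (i : ℕ) : ℝ := (l.insertionSort (· ≤ ·)).getD i 0

theorem listMedian_eq (l : List ℝ) :
    listMedian l = (orderStat l ((l.length - 1) / 2) + orderStat l (l.length / 2)) / 2 := rfl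

theorem orderStat_iff {l : List ℝ} {q : ℝ → Bool} (hq : ∀ y z, z ≤ y → q y → q z) {i : ℕ}
    (hi : i < l.length) : q (orderStat l i) ↔ i < l.countP q := by
  have hi' : i < (l.insertionSort (· ≤ ·)).length := by rwa [List.length_insertionSort]
  rw [orderStat, List.getD_eq_getElem _ _ hi',
    List.getElem_iff_lt_countP List.sortedLE_insertionSort hq hi',
    (List.perm_insertionSort (· ≤ ·) l).countP_eq]

theorem orderStat_mem {l : List ℝ} {i : ℕ} (hi : i < l.length) : orderStat l i ∈ l := by
  have hi' : i < (l.insertionSort (· ≤ ·)).length := by rwa [List.length_insertionSort]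
  rw [orderStat, List.getD_eq_getElem _ _ hi', ← List.mem_insertionSort (r := (· ≤ ·))]
  exact List.getElem_mem _

theorem lt_orderStat_iff {l : List ℝ} {i : ℕ} (hi : i < l.length) (a : ℝ) :
    orderStat l i < a ↔ i < l.countP fun y => decide (y < a) := by
  rw [← orderStat_iff (q := fun y => decide (y < a)) _ hi]
  · simp
  · intro y z h; simpa using h.trans_lt

theorem le_orderStat_iff {l : List ℝ} {i : ℕ} (hi : i < l.length) (a : ℝ) :
    orderStat l i ≤ a ↔ i < l.countP fun y => decide (y ≤ a) := by
  rw [← orderStat_iff (q := fun y => decide (y ≤ a)) _ hi]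
  · simp
  · intro y z h; simpa using h.trans

/-- An order statistic is recognised from two counts in the unsorted list; this lets a program find
medians without sorting. -/
theorem eq_orderStat_iff {l : List ℝ} {i : ℕ} (hi : i < l.length) (y : ℝ) :
    orderStat l i = y ↔
      (l.countP fun z => decide (z < y)) ≤ i ∧ i < l.countP fun z => decide (z ≤ y) := by
  rw [← le_orderStat_iff hi, ← not_lt, ← lt_orderStat_iff hi, not_lt]
  exact ⟨fun h => ⟨h.ge, h.le⟩, fun h => le_antisymm h.2 h.1⟩

/-- At most `l.countP bad` entries lie below a, and at most that many lie above b, so an index at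
least this far from both ends falls inside. -/
theorem orderStat_mem_Icc {l : List ℝ} {i : ℕ} {a b : ℝ} {bad : ℝ → Bool}
    (hbad : ∀ y, bad y = false → y ∈ Set.Icc a b) (h1 : l.countP bad ≤ i)
    (h2 : l.countP bad + i < l.length) : orderStat l i ∈ Set.Icc a b := by
  have hi : i < l.length := by omega
  constructor
  · rw [← not_lt, lt_orderStat_iff hi, not_lt]
    refine le_trans (List.countP_mono_left fun y _ hy => ?_) h1
    by_contra h
    have := (hbad y (by simpa using h)).1
    simp only [decide_eq_true_eq] at hy
    linarith
  · rw [le_orderStat_iff hi]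
    have h3 := List.length_eq_countP_add_countP (fun y => decide (y ≤ b)) (l := l)
    have h4 : (l.countP fun y => decide ¬ (decide (y ≤ b)) = true) ≤ l.countP bad := by
      refine List.countP_mono_left fun y _ hy => ?_
      by_contra h
      have := (hbad y (by simpa using h)).2
      simp only [decide_eq_true_eq] at hy
      exact hy this
    omega

theorem listMedian_mem_Icc {l : List ℝ} {a b : ℝ} {bad : ℝ → Bool}
    (hbad : ∀ y, bad y = false → y ∈ Set.Icc a b) (h : 2 * l.countP bad < l.length) :
    listMedian l ∈ Set.Icc a b := by
  have h1 := orderStat_mem_Icc hbad (l := l) (i := (l.length - 1) / 2) (by omega) (by omega)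
  have h2 := orderStat_mem_Icc hbad (l := l) (i := l.length / 2) (by omega) (by omega)
  rw [listMedian_eq]
  constructor
  · linarith [h1.1, h2.1]
  · linarith [h1.2, h2.2]

/-! ### Sample means and their median -/

/-- Chebyshev around the true mean p. The bias is at most ε/(16S) ≤ εq/16, so an error above εq in
the estimate of q is a deviation of at least (15/16)εq from p. -/
theorem pmfLE_listMean_le {μ : PMF ℝ} {p q S ε : ℝ} (hp0 : 0 ≤ p) (hp1 : p ≤ 1)
    (hμ : ∀ g, pmfLE μ g = ENNReal.ofReal p * g 1 + ENNReal.ofReal (1 - p) * g 0)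
    (hS : 0 < S) (hq : 1 / S ≤ q) (hε0 : 0 < ε) (hε : ε < 1 / 4) (hpq : |p - q| ≤ ε / (16 * S))
    {N : ℕ} (hN : 20 * (S * (ε ^ 2)⁻¹) ≤ N) :
    pmfLE ((iidDraws μ N).map listMean)
      ((Set.Icc ((1 - ε) * q) ((1 + ε) * q))ᶜ.indicator 1) ≤ ENNReal.ofReal (1 / 16) := by
  have hq0 : 0 < q := lt_of_lt_of_le (by positivity) hq
  have hN0 : 0 < (N : ℝ) := lt_of_lt_of_le (by positivity) hN
  have hSq : 1 ≤ S * q := by rwa [div_le_iff₀' hS] at hq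
  have hpq' : |p - q| ≤ ε * q / 16 := by
    refine hpq.trans ?_
    calc ε / (16 * S) = ε * (1 / S) / 16 := by field_simp
      _ ≤ _ := by gcongr
  rw [pmfLE_map]
  set c : ℝ := (N * (15 / 16 * ε * q)) ^ 2 with hc
  have hc0 : 0 < c := by positivity
  calc _ ≤ pmfLE (iidDraws μ N) fun l =>
        ENNReal.ofReal c⁻¹ * ENNReal.ofReal ((l.sum - N * p) ^ 2) := by
        refine pmfLE_mono fun l hl => ?_
        have hlen := length_of_mem_support_iidDraws μ N l hl
        by_cases h : listMean l ∈ (Set.Icc ((1 - ε) * q) ((1 + ε) * q))ᶜ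
        swap
        · rw [Set.indicator_of_notMem h]; exact zero_le
        rw [Set.indicator_of_mem h, Pi.one_apply, ← ENNReal.ofReal_mul (by positivity),
          ENNReal.one_le_ofReal, ← div_eq_inv_mul, one_le_div hc0, hc]
        have h1 : l.sum = N * listMean l := by rw [listMean, hlen]; field_simp
        rw [h1, ← mul_sub, mul_pow (N : ℝ), mul_pow (N : ℝ)]
        refine mul_le_mul_of_nonneg_left ?_ (sq_nonneg _)
        rw [← sq_abs (listMean l - p)]
        have hεq : 0 ≤ 15 / 16 * ε * q := by positivity
        refine pow_le_pow_left₀ hεq ?_ 2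
        rw [Set.mem_compl_iff, Set.mem_Icc, not_and_or, not_le, not_le] at h
        have h2 := abs_le.1 hpq'
        rcases h with h | h
        · refine le_trans ?_ (neg_le_abs _)
          nlinarith [h2.1]
        · refine le_trans ?_ (le_abs_self _)
          nlinarith [h2.2]
    _ = ENNReal.ofReal (c⁻¹ * (N * (p * (1 - p)))) := by
        rw [pmfLE_const_mul, pmfLE_iidDraws_sq hp0 hp1 hμ, ← ENNReal.ofReal_mul (by positivity)]
        congr 1; ring
    _ ≤ _ := by
        refine ENNReal.ofReal_le_ofReal ?_
        rw [inv_mul_le_iff₀ hc0, hc]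
        -- 65/64 = 1 + (1/4)/16 comes from the bias εq/16 and ε < 1/4.
        have h1 : p ≤ 65 / 64 * q := by
          have := (abs_le.1 hpq').2
          nlinarith
        have h2 : p * (1 - p) ≤ 65 / 64 * q := by nlinarith
        have h3 : 20 ≤ N * ε ^ 2 * q := by
          have h4 : 20 * S ≤ N * ε ^ 2 := by
            have := mul_le_mul_of_nonneg_right hN (sq_nonneg ε)
            rwa [mul_assoc, inv_mul_cancel_right₀ (by positivity)] at this
          nlinarith
        calc (N : ℝ) * (p * (1 - p)) ≤ N * (65 / 64 * q) := by gcongr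
          -- The factor 20 in the sample size suffices because (15/16)²·20/16 exceeds 65/64.
          _ ≤ N * q * ((15 / 16) ^ 2 * 20 * (1 / 16)) := by
              have : 0 < (N : ℝ) * q := by positivity
              nlinarith
          _ ≤ N * q * ((15 / 16) ^ 2 * (N * ε ^ 2 * q) * (1 / 16)) := by gcongr
          _ = _ := by ring

/-- Exponential Markov inequality with base 16: a bad median needs at least K/2 bad entries, so
16^#bad ≥ 4^K, while each draw contributes a factor of at most 1 + 15/16 ≤ 2 to the expectation. -/
theorem pmfLE_listMedian_le {μ : PMF ℝ} {a b : ℝ}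
    (hμ : pmfLE μ ((Set.Icc a b)ᶜ.indicator 1) ≤ ENNReal.ofReal (1 / 16)) (K : ℕ) :
    pmfLE ((iidDraws μ K).map listMedian) ((Set.Icc a b)ᶜ.indicator 1) ≤
      ENNReal.ofReal ((1 / 2) ^ K) := by
  classical
  set bad : ℝ → Bool := fun y => decide (y ∉ Set.Icc a b) with hbad
  have h1 : (pmfLE μ fun y => if bad y then 16 else 1) ≤ 2 := by
    calc _ = pmfLE μ fun y => 1 + 15 * (Set.Icc a b)ᶜ.indicator (1 : ℝ → ENNReal) y := by
          congr 1; funext y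
          by_cases hy : y ∈ Set.Icc a b
          · rw [Set.indicator_of_notMem (not_not.2 hy), if_neg (by simpa [hbad] using hy)]; simp
          · rw [Set.indicator_of_mem (show y ∈ (Set.Icc a b)ᶜ from hy),
              if_pos (by rw [hbad]; exact decide_eq_true hy)]
            norm_num
      _ ≤ 1 + 15 * ENNReal.ofReal (1 / 16) := by
          rw [pmfLE_add, pmfLE_const, pmfLE_const_mul]; gcongr
      _ ≤ 2 := by
          rw [← ENNReal.ofReal_ofNat, ← ENNReal.ofReal_mul (by norm_num), ← ENNReal.ofReal_one,
            ← ENNReal.ofReal_add (by norm_num) (by norm_num), ← ENNReal.ofReal_ofNat]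
          exact ENNReal.ofReal_le_ofReal (by norm_num)
  rw [pmfLE_map]
  calc _ ≤ pmfLE (iidDraws μ K) fun l => ENNReal.ofReal ((1 / 4) ^ K) * 16 ^ l.countP bad := by
        refine pmfLE_mono fun l hl => ?_
        by_cases h : listMedian l ∈ (Set.Icc a b)ᶜ
        swap
        · rw [Set.indicator_of_notMem h]; exact zero_le
        rw [Set.indicator_of_mem h, Pi.one_apply]
        have hlen := length_of_mem_support_iidDraws μ K l hl
        have h2 : K ≤ 2 * l.countP bad := by
          by_contra hc
          exact h (listMedian_mem_Icc (bad := bad) (fun y hy => by simpa [hbad] using hy)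
            (by omega))
        have h3 : (16 : ENNReal) ^ l.countP bad = ENNReal.ofReal (4 ^ (2 * l.countP bad)) := by
          rw [pow_mul, ENNReal.ofReal_pow (by norm_num)]; norm_num
        rw [h3, ← ENNReal.ofReal_mul (by positivity), ENNReal.one_le_ofReal]
        calc (1 : ℝ) = (1 / 4) ^ K * 4 ^ K := by rw [← mul_pow]; norm_num
          _ ≤ _ := by gcongr; norm_num
    _ ≤ ENNReal.ofReal ((1 / 4) ^ K) * 2 ^ K := by
        rw [pmfLE_const_mul, pmfLE_iidDraws_countP]; gcongr
    _ = _ := by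
        rw [← ENNReal.ofReal_ofNat, ← ENNReal.ofReal_pow (by norm_num),
          ← ENNReal.ofReal_mul (by positivity), ← mul_pow]
        norm_num

theorem half_pow_le {η : ℝ} (hη0 : 0 < η) (hη : η < 1 / 4) :
    (1 / 2 : ℝ) ^ (7 * ⌈Real.log η⁻¹⌉₊ + 1) ≤ η := by
  have h1 := Nat.le_ceil (Real.log η⁻¹)
  set L := ⌈Real.log η⁻¹⌉₊
  -- Two of the seven multiples are enough, since 1/4 ≤ 1/e.
  calc (1 / 2 : ℝ) ^ (7 * L + 1) ≤ (1 / 2 : ℝ) ^ (2 * L) :=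
        pow_le_pow_of_le_one (by norm_num) (by norm_num) (by omega)
    _ ≤ Real.exp (-1) ^ L := by
        rw [pow_mul]
        refine pow_le_pow_left₀ (by norm_num) ?_ L
        rw [Real.exp_neg, ← one_div, le_div_iff₀ (Real.exp_pos 1)]
        have := Real.exp_one_lt_d9
        linarith
    _ = Real.exp (-L) := by rw [← Real.exp_nat_mul]; ring_nf
    _ ≤ Real.exp (-Real.log η⁻¹) := Real.exp_le_exp.2 (by linarith)
    _ = η := by rw [Real.log_inv, neg_neg, Real.exp_log hη0]

theorem samplingScheme_approximates {V : Type*} [Fintype V] [DecidableEq V] [Nonempty V]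
    {G : SimpleGraph V} [DecidableRel G.Adj] {x : ℝ} (hx0 : 0 < x) (hx1 : x < 1)
    (hc : G.Connected) (hn : 2 ≤ Fintype.card V) (𝒜 : Finset (Finset (Sym2 V))) {S ε η : ℝ}
    (hS : 1 ≤ S) (h𝒜 : 1 / S ≤ wormProb G x 𝒜) (hε : ε ∈ Set.Ioo (0 : ℝ) (1 / 4))
    (hη : η ∈ Set.Ioo (0 : ℝ) (1 / 4)) {A₀ : Finset (Sym2 V)} (hA₀ : A₀ ∈ wormSpace G) :
    Approximates (samplingScheme G x 𝒜 S ε η A₀) (wormProb G x 𝒜) ε η := by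
  obtain ⟨hε0, hε1⟩ := hε
  obtain ⟨hη0, hη1⟩ := hη
  rw [approximates_iff hη0.le]
  have hS0 : 0 < S := by linarith
  have hδ0 : 0 < ε / (16 * S) := by positivity
  have hδ1 : ε / (16 * S) ≤ 1 := by rw [div_le_one (by positivity)]; linarith
  have hmix := abs_psRun_sub_le hx0 hx1 hc hn 𝒜 hA₀ hδ0 hδ1 (Nat.le_ceil _)
  set t := ⌈mixingBound G x (ε / (16 * S))⌉₊ with ht
  set f : Finset (Sym2 V) → ℝ := fun A => if A ∈ 𝒜 then 1 else 0 with hf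
  set p := pmfExp (psRun G x t A₀) f with hp
  have hp0 : 0 ≤ p := Finset.sum_nonneg fun A _ => mul_nonneg ENNReal.toReal_nonneg (by
    rw [hf]; dsimp only; split_ifs <;> norm_num)
  have hpc : 1 - p = pmfExp (psRun G x t A₀) fun A => 1 - f A := by
    rw [hp, pmfExp, pmfExp]
    simp only [mul_sub, mul_one, Finset.sum_sub_distrib, sum_toReal_pmf]
  have hp1 : p ≤ 1 := by
    rw [← sub_nonneg, hpc]
    exact Finset.sum_nonneg fun A _ => mul_nonneg ENNReal.toReal_nonneg (by
      rw [hf]; dsimp only; split_ifs <;> norm_num)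
  -- The indicator takes only the values 0 and 1, so its law is Bernoulli with parameter p.
  have hμ : ∀ g, pmfLE ((psRun G x t A₀).map f) g =
      ENNReal.ofReal p * g 1 + ENNReal.ofReal (1 - p) * g 0 := by
    intro g
    rw [hpc, hp, ← pmfLE_eq_ofReal, ← pmfLE_eq_ofReal, mul_comm, mul_comm _ (g 0),
      ← pmfLE_const_mul, ← pmfLE_const_mul, ← pmfLE_add, pmfLE_map]
    · congr 1; funext A; rw [hf]; dsimp only; split_ifs <;> simp
    · intro A; rw [hf]; dsimp only; split_ifs <;> norm_num
    · intro A; rw [hf]; dsimp only; split_ifs <;> norm_num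
  have h1 := pmfLE_listMean_le hp0 hp1 hμ hS0 h𝒜 hε0 hε1 hmix
    (N := 20 * ⌈S * (ε ^ 2)⁻¹ + 1⌉₊) (by
      push_cast
      have := Nat.le_ceil (S * (ε ^ 2)⁻¹ + 1)
      linarith)
  exact (pmfLE_listMedian_le h1 _).trans (ENNReal.ofReal_le_ofReal (half_pow_le hη0 hη1))

/-- The quotient of two independent approximations. -/
theorem Approximates.div {μ ν : PMF ℝ} {q r ε η c : ℝ} (hq : 0 < q) (hr : 0 < r) (hc : 0 ≤ c)
    (hε : ε ∈ Set.Ioo (0 : ℝ) (1 / 4)) (hη : η ∈ Set.Ioo (0 : ℝ) (1 / 4))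
    (hμ : Approximates μ q (ε / 4) (η / 2)) (hν : Approximates ν r (ε / 4) (η / 2)) :
    Approximates (μ.bind fun y => ν.map fun z => c * (y / z)) (c * (q / r)) ε η := by
  obtain ⟨hε0, hε1⟩ := hε
  obtain ⟨hη0, hη1⟩ := hη
  rw [approximates_iff (by linarith)] at hμ hν ⊢
  have hη2 : ENNReal.ofReal η = ENNReal.ofReal (η / 2) + ENNReal.ofReal (η / 2) := by
    rw [← ENNReal.ofReal_add (by linarith) (by linarith)]; congr 1; ring
  set I := Set.Icc ((1 - ε / 4) * q) ((1 + ε / 4) * q)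
  set J := Set.Icc ((1 - ε / 4) * r) ((1 + ε / 4) * r)
  rw [pmfLE_bind, hη2]
  calc _ ≤ pmfLE μ fun y => Iᶜ.indicator 1 y + pmfLE ν (Jᶜ.indicator 1) := by
        refine pmfLE_mono fun y _ => ?_
        by_cases hy : y ∈ I
        swap
        · rw [Set.indicator_of_mem hy, Pi.one_apply]
          refine le_add_right ?_
          rw [← pmfLE_const (ν.map fun z => c * (y / z)) 1]
          refine pmfLE_mono fun z _ => Set.indicator_le_self' (fun _ _ => zero_le) z
        · rw [pmfLE_map]
          refine le_add_left (pmfLE_mono fun z _ => ?_)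
          by_cases hz : z ∈ J
          swap
          · rw [Set.indicator_of_mem (show z ∈ Jᶜ from hz)]
            exact Set.indicator_le_self' (fun _ _ => zero_le) _
          rw [Set.indicator_of_notMem]
          · exact zero_le
          rw [Set.mem_compl_iff, not_not]
          have hz0 : 0 < z := lt_of_lt_of_le (mul_pos (by linarith) hr) hz.1
          have hq0 := hq.le
          have hy0 : 0 ≤ y := le_trans (mul_nonneg (by linarith) hq.le) hy.1
          constructor
          · rw [mul_left_comm]
            refine mul_le_mul_of_nonneg_left ?_ hc
            rw [mul_div_assoc', div_le_div_iff₀ hr hz0]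
            -- The accuracy ε/4 leaves room for the quotient: (1 − ε)(1 + ε/4) ≤ 1 − ε/4, and below
            -- 1 + ε/4 ≤ (1 + ε)(1 − ε/4).
            calc (1 - ε) * q * z ≤ (1 - ε) * q * ((1 + ε / 4) * r) :=
                  mul_le_mul_of_nonneg_left hz.2 (mul_nonneg (by linarith) hq.le)
              _ = ((1 - ε) * (1 + ε / 4)) * (q * r) := by ring
              _ ≤ (1 - ε / 4) * (q * r) :=
                  mul_le_mul_of_nonneg_right (by nlinarith) (by positivity)
              _ = (1 - ε / 4) * q * r := by ring
              _ ≤ y * r := mul_le_mul_of_nonneg_right hy.1 hr.le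
          · rw [mul_left_comm]
            refine mul_le_mul_of_nonneg_left ?_ hc
            rw [mul_div_assoc', div_le_div_iff₀ hz0 hr]
            calc y * r ≤ (1 + ε / 4) * q * r := mul_le_mul_of_nonneg_right hy.2 hr.le
              _ = (1 + ε / 4) * (q * r) := by ring
              _ ≤ ((1 + ε) * (1 - ε / 4)) * (q * r) :=
                  mul_le_mul_of_nonneg_right (by nlinarith) (by positivity)
              _ = (1 + ε) * q * ((1 - ε / 4) * r) := by ring
              _ ≤ (1 + ε) * q * z :=
                  mul_le_mul_of_nonneg_left hz.1 (mul_nonneg (by linarith) hq.le)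
    _ ≤ _ := by
        rw [pmfLE_add, pmfLE_const]; gcongr

end Sampling

/-! ### A program logic -/

section Logic

/-- The law `ρ` of a final memory and a number of steps implements `μ`: in some coupling, the steps
are at most `T` and the memory is related to the value drawn from `μ` by `post`. -/
def Coupled {β : Type*} (ρ : PMF (Mem × ℕ)) (μ : PMF β) (T : ℕ) (post : Mem → β → Prop) : Prop :=
  ∃ ν : PMF ((Mem × ℕ) × β), ν.map Prod.fst = ρ ∧ ν.map Prod.snd = μ ∧
    ∀ z ∈ ν.support, z.1.2 ≤ T ∧ post z.1.1 z.2

namespace Coupled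

variable {α β γ : Type*}

theorem of_map {μ : PMF α} {h : α → Mem × ℕ} {g : α → β} {T : ℕ} {post : Mem → β → Prop}
    (H : ∀ a ∈ μ.support, (h a).2 ≤ T ∧ post (h a).1 (g a)) :
    Coupled (μ.map h) (μ.map g) T post := by
  refine ⟨μ.map fun a => (h a, g a), ?_, ?_, ?_⟩
  · rw [PMF.map_comp]; rfl
  · rw [PMF.map_comp]; rfl
  · intro z hz
    rw [PMF.support_map] at hz
    obtain ⟨a, ha, rfl⟩ := hz
    exact H a ha

theorem pure {M : Mem} {c : ℕ} {b : β} {T : ℕ} {post : Mem → β → Prop} (hc : c ≤ T)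
    (h : post M b) : Coupled (PMF.pure (M, c)) (PMF.pure b) T post := by
  refine ⟨PMF.pure ((M, c), b), ?_, ?_, ?_⟩
  · rw [PMF.pure_map]
  · rw [PMF.pure_map]
  · intro z hz
    rw [PMF.support_pure, Set.mem_singleton_iff] at hz
    subst hz
    exact ⟨hc, h⟩

theorem mono {ρ : PMF (Mem × ℕ)} {μ : PMF β} {T T' : ℕ} {post post' : Mem → β → Prop}
    (h : Coupled ρ μ T post) (hT : T ≤ T') (hp : ∀ M b, post M b → post' M b) :
    Coupled ρ μ T' post' := by
  obtain ⟨ν, h1, h2, h3⟩ := h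
  exact ⟨ν, h1, h2, fun z hz => ⟨(h3 z hz).1.trans hT, hp _ _ (h3 z hz).2⟩⟩

theorem with_support {ρ : PMF (Mem × ℕ)} {μ : PMF β} {T : ℕ} {post : Mem → β → Prop}
    (h : Coupled ρ μ T post) : Coupled ρ μ T fun M b => post M b ∧ b ∈ μ.support := by
  obtain ⟨ν, h1, h2, h3⟩ := h
  refine ⟨ν, h1, h2, fun z hz => ⟨(h3 z hz).1, (h3 z hz).2, ?_⟩⟩
  rw [← h2, PMF.support_map]
  exact ⟨z, hz, rfl⟩

theorem map {ρ : PMF (Mem × ℕ)} {μ : PMF β} {T : ℕ} {post : Mem → γ → Prop} (g : β → γ)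
    (h : Coupled ρ μ T fun M b => post M (g b)) : Coupled ρ (μ.map g) T post := by
  obtain ⟨ν, h1, h2, h3⟩ := h
  refine ⟨ν.map fun z => (z.1, g z.2), ?_, ?_, ?_⟩
  · rw [PMF.map_comp]; exact h1
  · rw [PMF.map_comp, ← h2, PMF.map_comp]; rfl
  · intro z hz
    rw [PMF.support_map] at hz
    obtain ⟨a, ha, rfl⟩ := hz
    exact h3 a ha

theorem addCost {ρ : PMF (Mem × ℕ)} {μ : PMF β} {T : ℕ} {post : Mem → β → Prop} (c : ℕ)
    (h : Coupled ρ μ T post) : Coupled (ρ.map fun s => (s.1, c + s.2)) μ (c + T) post := by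
  obtain ⟨ν, h1, h2, h3⟩ := h
  refine ⟨ν.map fun z => ((z.1.1, c + z.1.2), z.2), ?_, ?_, ?_⟩
  · rw [PMF.map_comp, ← h1, PMF.map_comp]; rfl
  · rw [PMF.map_comp]; exact h2
  · intro z hz
    rw [PMF.support_map] at hz
    obtain ⟨a, ha, rfl⟩ := hz
    exact ⟨Nat.add_le_add_left (h3 a ha).1 c, (h3 a ha).2⟩

/-- Couplings are glued: draw from the first, then from a coupling of the two continuations. The
number k allows for the extra step that a loop charges per round. -/
theorem bind {ρ : PMF (Mem × ℕ)} {μ : PMF α} {T₁ T₂ : ℕ} {mid : Mem → α → Prop}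
    {f : Mem → PMF (Mem × ℕ)} {κ : α → PMF β} {post : Mem → β → Prop} (k : ℕ)
    (h : Coupled ρ μ T₁ mid) (hf : ∀ M a, mid M a → Coupled (f M) (κ a) T₂ post) :
    Coupled (ρ.bind fun s => (f s.1).map fun s' => (s'.1, s.2 + k + s'.2)) (μ.bind κ)
      (T₁ + k + T₂) post := by
  obtain ⟨ν, h1, h2, h3⟩ := h
  have hex : ∀ z : (Mem × ℕ) × α, ∃ ν' : PMF ((Mem × ℕ) × β),
      ν'.map Prod.fst = f z.1.1 ∧ ν'.map Prod.snd = κ z.2 ∧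
      (mid z.1.1 z.2 → ∀ z' ∈ ν'.support, z'.1.2 ≤ T₂ ∧ post z'.1.1 z'.2) := by
    intro z
    by_cases hz : mid z.1.1 z.2
    · obtain ⟨ν', h1, h2, h3⟩ := hf _ _ hz
      exact ⟨ν', h1, h2, fun _ => h3⟩
    -- A coupling must be chosen for every pair, also for those without mass where `mid` fails; the
    -- independent one serves there.
    · refine ⟨(f z.1.1).bind fun s => (κ z.2).map fun b => (s, b), ?_, ?_, fun h => absurd h hz⟩
      · rw [PMF.map_bind]
        simp only [PMF.map_comp, Function.comp_def]
        exact (congrArg _ (funext fun s => PMF.map_const _ s)).trans (PMF.bind_pure _)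
      · rw [PMF.map_bind]
        simp only [PMF.map_comp, Function.comp_def]
        rw [PMF.bind_const]
        exact PMF.map_id _
  choose ν' g1 g2 g3 using hex
  refine ⟨ν.bind fun z => (ν' z).map fun z' => ((z'.1.1, z.1.2 + k + z'.1.2), z'.2), ?_, ?_, ?_⟩
  · rw [PMF.map_bind, ← h1, PMF.bind_map]
    congr 1; funext z
    rw [PMF.map_comp, Function.comp_apply, ← g1 z, PMF.map_comp]
    rfl
  · rw [PMF.map_bind, ← h2, PMF.bind_map]
    congr 1; funext z
    rw [PMF.map_comp, Function.comp_apply, ← g2 z]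
    rfl
  · intro z hz
    rw [PMF.mem_support_bind_iff] at hz
    obtain ⟨w, hw, hz⟩ := hz
    rw [PMF.support_map] at hz
    obtain ⟨z', hz', rfl⟩ := hz
    obtain ⟨h4, h5⟩ := h3 w hw
    obtain ⟨h6, h7⟩ := g3 w h5 z' hz'
    exact ⟨by dsimp only; omega, h7⟩

end Coupled

/-- `r` steps of the kernel `κ`. -/
def iterKernel {β : Type*} (κ : β → PMF β) : ℕ → β → PMF β
  | 0, b => PMF.pure b
  | r + 1, b => (κ b).bind (iterKernel κ r)

theorem psRun_eq_iterKernel {V : Type*} [Fintype V] [DecidableEq V] [Nonempty V]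
    (G : SimpleGraph V) [DecidableRel G.Adj] (x : ℝ) (t : ℕ) :
    psRun G x t = iterKernel (psStep G x) t := by
  induction t with
  | zero => rfl
  | succ t ih => funext A; rw [psRun, iterKernel, ih]

/-- A loop appends each draw at the end while `iidDraws` prepends the first draw to the rest; both
list the draws in the order in which they are made. -/
theorem iidDraws_map_append {α : Type*} (μ : PMF α) (N : ℕ) (l₀ : List α) :
    iterKernel (fun l => μ.map fun a => l ++ [a]) N l₀ = (iidDraws μ N).map (l₀ ++ ·) := by
  induction N generalizing l₀ with
  | zero => rw [iterKernel, iidDraws, PMF.pure_map, List.append_nil]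
  | succ N ih =>
    rw [iterKernel, iidDraws, PMF.bind_map, PMF.map_bind]
    congr 1; funext a
    rw [Function.comp_apply, ih, PMF.map_comp]
    congr 1; funext l
    simp

theorem iidDraws_eq_iterKernel {α : Type*} (μ : PMF α) (N : ℕ) :
    iidDraws μ N = iterKernel (fun l => μ.map fun a => l ++ [a]) N [] := by
  rw [iidDraws_map_append]
  exact (PMF.map_id _).symm

namespace Coupled

variable {α β : Type*}

theorem iterate {f : Mem → PMF (Mem × ℕ)} {κ : β → PMF β} {T : ℕ} {inv : Mem → β → Prop}
    (hf : ∀ M b, inv M b → Coupled (f M) (κ b) T inv) (r : ℕ) {M : Mem} {b : β} (h : inv M b) :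
    Coupled (Prog.iterate f r M) (iterKernel κ r b) (r * (T + 1)) inv := by
  induction r generalizing M b with
  | zero => exact pure (Nat.zero_le _) h
  | succ r ih => exact (bind 1 (hf M b h) fun M' b' h' => ih h').mono (by linarith) fun _ _ h => h

theorem loop {e : NExp} {p : Prog} {κ : β → PMF β} {T r : ℕ} {inv : Mem → β → Prop} {M : Mem}
    {b : β} (hr : e.val M = r) (h : inv M b)
    (hf : ∀ M b, inv M b → Coupled (p.exec M) (κ b) T inv) :
    Coupled ((Prog.loop e p).exec M) (iterKernel κ r b) (e.cost + 1 + r * (T + 1)) inv := by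
  rw [Prog.exec, hr]
  exact addCost (e.cost + 1) (iterate hf r h)

theorem seq {p q : Prog} {M : Mem} {μ : PMF α} {κ : α → PMF β} {T₁ T₂ : ℕ}
    {mid : Mem → α → Prop} {post : Mem → β → Prop} (h : Coupled (p.exec M) μ T₁ mid)
    (hq : ∀ M a, mid M a → Coupled (q.exec M) (κ a) T₂ post) :
    Coupled ((Prog.seq p q).exec M) (μ.bind κ) (T₁ + T₂) post := by
  rw [Prog.exec]
  exact bind 0 h hq

theorem ite {c : Test} {p q : Prog} {M : Mem} {μ : PMF β} {T : ℕ} {post : Mem → β → Prop}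
    (hp : c.holds M → Coupled (p.exec M) μ T post)
    (hq : ¬ c.holds M → Coupled (q.exec M) μ T post) :
    Coupled ((Prog.ite c p q).exec M) μ (c.cost + T) post := by
  rw [Prog.exec]
  refine addCost c.cost ?_
  split_ifs with h
  exacts [hp h, hq h]

/-- A coupling with a constant says that `post` holds surely. -/
theorem seq_det {p q : Prog} {M : Mem} {μ : PMF β} {T₁ T₂ : ℕ}
    {mid : Mem → Prop} {post : Mem → β → Prop}
    (h : Coupled (p.exec M) (PMF.pure ()) T₁ fun M _ => mid M)
    (hq : ∀ M, mid M → Coupled (q.exec M) μ T₂ post) :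
    Coupled ((Prog.seq p q).exec M) μ (T₁ + T₂) post := by
  have := seq (κ := fun _ : Unit => μ) h fun M _ hM => hq M hM
  rwa [PMF.pure_bind] at this

/-- A coupling is followed by steps without randomness. -/
theorem seq_after {p q : Prog} {M : Mem} {μ : PMF β} {T₁ T₂ : ℕ}
    {mid : Mem → β → Prop} {post : Mem → β → Prop} (h : Coupled (p.exec M) μ T₁ mid)
    (hq : ∀ M b, mid M b → Coupled (q.exec M) (PMF.pure ()) T₂ fun M' _ => post M' b) :
    Coupled ((Prog.seq p q).exec M) μ (T₁ + T₂) post := by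
  have := seq (κ := fun b : β => PMF.pure b) (post := post) h fun M b hM => by
    have h2 := map (fun _ => b) (post := post) (hq M b hM)
    rwa [PMF.pure_map] at h2
  rwa [PMF.bind_pure] at this

theorem skip {M : Mem} {b : β} {T : ℕ} {post : Mem → β → Prop} (hT : 1 ≤ T) (h : post M b) :
    Coupled (Prog.skip.exec M) (PMF.pure b) T post := by
  rw [Prog.exec]; exact pure hT h

theorem setNat {a : ℕ} {i j e : NExp} {M : Mem} {b : β} {T : ℕ} {post : Mem → β → Prop}
    (hT : i.cost + j.cost + e.cost + 1 ≤ T)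
    (h : post (M.writeNat a (i.val M) (j.val M) (e.val M)) b) :
    Coupled ((Prog.setNat a i j e).exec M) (PMF.pure b) T post := by
  rw [Prog.exec]; exact pure hT h

theorem setReal {a : ℕ} {i : NExp} {e : RExp} {M : Mem} {b : β} {T : ℕ} {post : Mem → β → Prop}
    (hT : i.cost + e.cost + 1 ≤ T) (h : post (M.writeReal a (i.val M) (e.val M)) b) :
    Coupled ((Prog.setReal a i e).exec M) (PMF.pure b) T post := by
  rw [Prog.exec]; exact pure hT h

theorem setCeil {a : ℕ} {i j : NExp} {e : RExp} {M : Mem} {b : β} {T : ℕ}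
    {post : Mem → β → Prop} (hT : i.cost + j.cost + e.cost + ⌈e.val M⌉₊ + 1 ≤ T)
    (h : post (M.writeNat a (i.val M) (j.val M) ⌈e.val M⌉₊) b) :
    Coupled ((Prog.setCeil a i j e).exec M) (PMF.pure b) T post := by
  rw [Prog.exec]; exact pure hT h

theorem setCoin {a : ℕ} {i j : NExp} {e : RExp} {M : Mem} {g : Bool → β} {T : ℕ}
    {post : Mem → β → Prop} (hT : i.cost + j.cost + e.cost + 1 ≤ T)
    (h : ∀ c : Bool, post (M.writeNat a (i.val M) (j.val M) (if c then 1 else 0)) (g c)) :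
    Coupled ((Prog.setCoin a i j e).exec M) ((coin (e.val M)).map g) T post := by
  rw [Prog.exec]; exact of_map fun c _ => ⟨hT, h c⟩

/-- Programs can only draw uniform integers; a bijective ranking transfers the uniform law to any
finite set. -/
theorem uniformOr_map_rank {s : Finset α} (hs : s.Nonempty) (d : α) {rank : α → ℕ}
    (hr : Set.InjOn rank s) (hi : s.image rank = Finset.range s.card) :
    (uniformOr s d).map rank = uniformOr (Finset.range s.card) 0 := by
  classical
  have hne : (Finset.range s.card).Nonempty := by
    rw [Finset.nonempty_range_iff]; exact hs.card_pos.ne'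
  rw [uniformOr, uniformOr, dif_pos hs, dif_pos hne]
  ext c
  rw [PMF.map_apply, PMF.uniformOfFinset_apply, Finset.card_range]
  split_ifs with hc
  · rw [← hi, Finset.mem_image] at hc
    obtain ⟨a, ha, rfl⟩ := hc
    rw [tsum_eq_single a, if_pos rfl, PMF.uniformOfFinset_apply_of_mem _ ha]
    intro b hb
    split_ifs with h
    · exact PMF.uniformOfFinset_apply_of_notMem _ fun hb' => hb (hr hb' ha h.symm)
    · rfl
  · refine ENNReal.tsum_eq_zero.2 fun a => ?_
    split_ifs with h
    · refine PMF.uniformOfFinset_apply_of_notMem _ fun ha => hc ?_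
      rw [← hi, h]; exact Finset.mem_image_of_mem _ ha
    · rfl

theorem setUniform {a : ℕ} {i j e : NExp} {M : Mem} {s : Finset α} (hs : s.Nonempty) (d : α)
    {rank : α → ℕ} (hr : Set.InjOn rank s) (hi : s.image rank = Finset.range s.card)
    (he : e.val M = s.card) {T : ℕ}
    {post : Mem → α → Prop} (hT : i.cost + j.cost + e.cost + 1 ≤ T)
    (h : ∀ c ∈ s, post (M.writeNat a (i.val M) (j.val M) (rank c)) c) :
    Coupled ((Prog.setUniform a i j e).exec M) (uniformOr s d) T post := by
  rw [Prog.exec, he, ← uniformOr_map_rank hs d hr hi, PMF.map_comp]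
  have := of_map (μ := uniformOr s d) (g := id) (T := T) (post := post)
    (h := (fun c => (M.writeNat a (i.val M) (j.val M) c, i.cost + j.cost + e.cost + 1)) ∘ rank)
    fun c hc => ⟨hT, h c (by
      rw [uniformOr, dif_pos hs] at hc
      exact (PMF.mem_support_uniformOfFinset_iff hs c).1 hc)⟩
  rwa [PMF.map_id] at this

theorem loop_range {e : NExp} {p : Prog} {T r : ℕ} {inv : ℕ → Mem → Prop} {M : Mem}
    (hr : e.val M = r) (h : inv 0 M)
    (hf : ∀ i < r, ∀ M, inv i M → Coupled (p.exec M) (PMF.pure ()) T fun M' _ => inv (i + 1) M') :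
    Coupled ((Prog.loop e p).exec M) (PMF.pure ()) (e.cost + 1 + r * (T + 1))
      fun M' _ => inv r M' := by
  rw [Prog.exec, hr]
  refine addCost (e.cost + 1) ?_
  have key : ∀ r' i M, i + r' = r → inv i M →
      Coupled (Prog.iterate p.exec r' M) (PMF.pure ()) (r' * (T + 1)) fun M' _ => inv r M' := by
    intro r'
    induction r' with
    | zero => intro i M hi hM; exact pure (Nat.zero_le _) (by rwa [← hi])
    | succ r' ih =>
      intro i M hi hM
      have := bind 1 (κ := fun _ : Unit => PMF.pure ()) (hf i (by omega) M hM)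
        fun M' _ h' => ih (i + 1) M' (by omega) h'
      rw [PMF.pure_bind] at this
      exact this.mono (by linarith) fun _ _ h => h
  exact key r 0 M (by omega) h

/-- Under a coupling in which the output cell surely equals the drawn value, the two marginals have
the same image. -/
theorem output_eq {p : Prog} {M : Mem} {μ : PMF ℝ} {T : ℕ}
    (h : Coupled (p.exec M) μ T fun M' y => M'.real 1 0 = y) : p.output M = μ := by
  obtain ⟨ν, h1, h2, h3⟩ := h
  rw [Prog.output, ← h1, ← h2, PMF.map_comp, ← PMF.bind_pure_comp, ← PMF.bind_pure_comp]
  ext y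
  rw [PMF.bind_apply, PMF.bind_apply]
  refine tsum_congr fun z => ?_
  by_cases hz : ν z = 0
  · simp [hz]
  · have := (h3 z ((PMF.mem_support_iff _ _).2 hz)).2
    simp [this]

theorem runsWithin {p : Prog} {M : Mem} {μ : PMF β} {T : ℕ} {post : Mem → β → Prop}
    (h : Coupled (p.exec M) μ T post) {T' : ℝ} (hT : (T : ℝ) ≤ T') : p.RunsWithin M T' := by
  obtain ⟨ν, h1, h2, h3⟩ := h
  intro s hs
  rw [← h1, PMF.support_map] at hs
  obtain ⟨z, hz, rfl⟩ := hs
  exact le_trans (by exact_mod_cast (h3 z hz).1) hT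

end Coupled

end Logic

/-! ### Subroutines -/

/-- `M'` differs from `M` only in the natural arrays `s` and the real arrays `t`. -/
structure Frame (s t : List ℕ) (M M' : Mem) : Prop where
  nat : ∀ a, a ∉ s → M'.nat a = M.nat a
  real : ∀ a, a ∉ t → M'.real a = M.real a

namespace Mem

theorem writeNat_nat (M : Mem) (a i j c a' i' j' : ℕ) : (M.writeNat a i j c).nat a' i' j' =
    if a' = a ∧ i' = i ∧ j' = j then c else M.nat a' i' j' := rfl

theorem writeNat_real (M : Mem) (a i j c : ℕ) : (M.writeNat a i j c).real = M.real := rfl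

theorem writeReal_nat (M : Mem) (a i : ℕ) (y : ℝ) : (M.writeReal a i y).nat = M.nat := rfl

theorem writeReal_real (M : Mem) (a i : ℕ) (y : ℝ) (a' i' : ℕ) : (M.writeReal a i y).real a' i' =
    if a' = a ∧ i' = i then y else M.real a' i' := rfl

end Mem

namespace Frame

variable {s t s' t' : List ℕ} {M M' M'' : Mem}

theorem refl (s t : List ℕ) (M : Mem) : Frame s t M M := ⟨fun _ _ => rfl, fun _ _ => rfl⟩

theorem trans (h : Frame s t M M') (h' : Frame s t M' M'') : Frame s t M M'' :=
  ⟨fun a ha => (h'.nat a ha).trans (h.nat a ha), fun a ha => (h'.real a ha).trans (h.real a ha)⟩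

theorem mono (h : Frame s t M M') (hs : s ⊆ s') (ht : t ⊆ t') : Frame s' t' M M' :=
  ⟨fun a ha => h.nat a fun h' => ha (hs h'), fun a ha => h.real a fun h' => ha (ht h')⟩

theorem writeNat (h : Frame s t M M') {a : ℕ} (ha : a ∈ s) (i j c : ℕ) :
    Frame s t M (M'.writeNat a i j c) := by
  refine ⟨fun b hb => ?_, h.real⟩
  rw [← h.nat b hb]
  funext i' j'
  refine if_neg ?_
  rintro ⟨rfl, -⟩
  exact hb ha

theorem writeReal (h : Frame s t M M') {a : ℕ} (ha : a ∈ t) (i : ℕ) (y : ℝ) :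
    Frame s t M (M'.writeReal a i y) := by
  refine ⟨h.nat, fun b hb => ?_⟩
  rw [← h.real b hb]
  funext i'
  refine if_neg ?_
  rintro ⟨rfl, -⟩
  exact hb ha

end Frame

/-- The scalar stored in a natural array. -/
def NExp.scalar (a : ℕ) : NExp := .cell a (.const 0) (.const 0)

theorem NExp.scalar_val (M : Mem) (a : ℕ) : (NExp.scalar a).val M = M.nat a 0 0 := rfl

theorem NExp.scalar_cost (a : ℕ) : (NExp.scalar a).cost = 3 := rfl

/-- Assignment to the scalar stored in a natural array. -/
def Prog.setScalar (a : ℕ) (e : NExp) : Prog := .setNat a (.const 0) (.const 0) e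

theorem Coupled.setScalar {β : Type*} {a : ℕ} {e : NExp} {M : Mem} {b : β} {T : ℕ}
    {post : Mem → β → Prop} (hT : e.cost + 3 ≤ T) (h : post (M.writeNat a 0 0 (e.val M)) b) :
    Coupled ((Prog.setScalar a e).exec M) (PMF.pure b) T post :=
  Coupled.setNat (by simp only [NExp.cost]; omega) h

theorem Coupled.seq_setScalar {β : Type*} {a : ℕ} {e : NExp} {q : Prog} {M : Mem} {μ : PMF β}
    {T : ℕ} {post : Mem → β → Prop}
    (h : Coupled (q.exec (M.writeNat a 0 0 (e.val M))) μ T post) :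
    Coupled ((Prog.seq (Prog.setScalar a e) q).exec M) μ (e.cost + 3 + T) post :=
  Coupled.seq_det (mid := fun M' => M' = M.writeNat a 0 0 (e.val M)) (Coupled.setScalar le_rfl rfl)
    fun _ hM => hM ▸ h

theorem Coupled.seq_setReal {β : Type*} {a : ℕ} {i : NExp} {e : RExp} {q : Prog} {M : Mem}
    {μ : PMF β} {T : ℕ} {post : Mem → β → Prop}
    (h : Coupled (q.exec (M.writeReal a (i.val M) (e.val M))) μ T post) :
    Coupled ((Prog.seq (Prog.setReal a i e) q).exec M) μ (i.cost + e.cost + 1 + T) post :=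
  Coupled.seq_det (mid := fun M' => M' = M.writeReal a (i.val M) (e.val M))
    (Coupled.setReal le_rfl rfl) fun _ hM => hM ▸ h

theorem Coupled.seq_setNat {β : Type*} {a : ℕ} {i j e : NExp} {q : Prog} {M : Mem} {μ : PMF β}
    {T : ℕ} {post : Mem → β → Prop}
    (h : Coupled (q.exec (M.writeNat a (i.val M) (j.val M) (e.val M))) μ T post) :
    Coupled ((Prog.seq (Prog.setNat a i j e) q).exec M) μ
      (i.cost + j.cost + e.cost + 1 + T) post :=
  Coupled.seq_det (mid := fun M' => M' = M.writeNat a (i.val M) (j.val M) (e.val M))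
    (Coupled.setNat le_rfl rfl) fun _ hM => hM ▸ h

/-- `acc := ∑ j < bd, e`, where `e` may refer to the counter `ctr`. -/
def sumLoop (acc ctr : ℕ) (bd e : NExp) : Prog :=
  .seq (.setScalar acc (.const 0)) <| .seq (.setScalar ctr (.const 0)) <|
    .loop bd <| .seq (.setScalar acc (.add (.scalar acc) e)) <|
      .setScalar ctr (.add (.scalar ctr) (.const 1))

/-- The summand is evaluated in the middle of the loop, so its value must be known in every memory
that differs from the initial one only in the accumulator and the counter. -/
theorem sumLoop_spec {acc ctr : ℕ} (hac : acc ≠ ctr) {bd e : NExp} {M : Mem} {B : ℕ}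
    (hB : ∀ M', Frame [acc, ctr] [] M M' → bd.val M' = B) (g : Fin B → ℕ)
    (hg : ∀ M', Frame [acc, ctr] [] M M' → ∀ j : Fin B, M'.nat ctr 0 0 = j → e.val M' = g j) :
    Coupled ((sumLoop acc ctr bd e).exec M) (PMF.pure ()) (9 + bd.cost + B * (e.cost + 16))
      fun M' _ => Frame [acc, ctr] [] M M' ∧ M'.nat acc 0 0 = ∑ j, g j := by
  set g' : ℕ → ℕ := fun j => if h : j < B then g ⟨j, h⟩ else 0 with hg'
  have hsum : ∑ j, g j = ∑ j ∈ Finset.range B, g' j := by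
    rw [Finset.sum_range]
    exact Finset.sum_congr rfl fun j _ => by simp [hg']
  have hF : Frame [acc, ctr] [] M ((M.writeNat acc 0 0 0).writeNat ctr 0 0 0) :=
    ((Frame.refl _ _ M).writeNat (by simp) 0 0 0).writeNat (by simp) 0 0 0
  refine Coupled.mono (Coupled.seq_setScalar (Coupled.seq_setScalar (Coupled.loop_range
    (T := e.cost + 15)
    (inv := fun i M' => Frame [acc, ctr] [] M M' ∧ M'.nat ctr 0 0 = i ∧
      M'.nat acc 0 0 = ∑ j ∈ Finset.range i, g' j) (hB _ hF) ?_ ?_)))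
    (by simp only [NExp.cost]; linarith) (fun M' _ h => ⟨h.1, hsum ▸ h.2.2⟩)
  · exact ⟨hF, by simp [Mem.writeNat_nat, NExp.val], by simp [Mem.writeNat_nat, hac, NExp.val]⟩
  · rintro i hi M' ⟨h1, h2, h3⟩
    refine (Coupled.seq_setScalar (Coupled.setScalar le_rfl ?_)).mono
      (by simp only [NExp.cost, NExp.scalar_cost]; omega) fun _ _ h => h
    refine ⟨(h1.writeNat (by simp) _ _ _).writeNat (by simp) _ _ _, ?_, ?_⟩
    · simp [Mem.writeNat_nat, NExp.val, NExp.scalar_val, h2, hac.symm]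
    · have := hg M' h1 ⟨i, hi⟩ h2
      simp [Mem.writeNat_nat, NExp.val, NExp.scalar_val, hac, h3, this, Finset.sum_range_succ,
        hg', hi]

/-- The number of elements of `s` below `j`. -/
def rankIn {n : ℕ} (s : Finset (Fin n)) (j : Fin n) : ℕ := (s.filter (· < j)).card

theorem rankIn_injOn {n : ℕ} (s : Finset (Fin n)) : Set.InjOn (rankIn s) s := by
  have key : ∀ i ∈ s, ∀ j, i < j → rankIn s i < rankIn s j := by
    intro i hi j hij
    refine Finset.card_lt_card ((Finset.ssubset_iff_of_subset ?_).2 ⟨i, ?_, ?_⟩)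
    · exact Finset.monotone_filter_right _ fun a _ h => lt_trans h hij
    · simp [hi, hij]
    · simp
  intro i hi j hj hij
  rcases lt_trichotomy i j with h | h | h
  · exact absurd hij (key i hi j h).ne
  · exact h
  · exact absurd hij (key j hj i h).ne'

theorem rankIn_image {n : ℕ} (s : Finset (Fin n)) :
    s.image (rankIn s) = Finset.range s.card := by
  refine Finset.eq_of_subset_of_card_le (fun c hc => ?_) ?_
  · obtain ⟨j, hj, rfl⟩ := Finset.mem_image.1 hc
    rw [Finset.mem_range]
    exact Finset.card_lt_card ((Finset.ssubset_iff_of_subset (Finset.filter_subset _ _)).2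
      ⟨j, hj, by simp⟩)
  · rw [Finset.card_range, Finset.card_image_of_injOn (rankIn_injOn s)]

/-- A uniformly random index `j < n` with `fl = 1`, where `fl` may refer to the counter `18`;
the result is stored in `17`. -/
def pickProg (fl : NExp) : Prog :=
  .seq (sumLoop 14 18 (.scalar 0) fl) <|
  .seq (.setUniform 15 (.const 0) (.const 0) (.scalar 14)) <|
  .seq (.setScalar 16 (.const 0)) <| .seq (.setScalar 18 (.const 0)) <|
  .loop (.scalar 0) <|
    .seq (.ite (.natLe (.add (.add (.sub (.scalar 16) (.scalar 15))
        (.sub (.scalar 15) (.scalar 16))) (.sub (.const 1) fl)) (.const 0))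
      (.setScalar 17 (.scalar 18)) .skip) <|
    .seq (.setScalar 16 (.add (.scalar 16) fl)) <|
    .setScalar 18 (.add (.scalar 18) (.const 1))

/-- A uniform rank below |s| is drawn, and a scan finds the element of s with that rank. Cell 16
counts the elements of s already passed, so it equals the rank of the current index. -/
theorem pickProg_spec {n : ℕ} {fl : NExp} {M : Mem} (hn : M.nat 0 0 0 = n) {s : Finset (Fin n)}
    (hs : s.Nonempty) (d : Fin n)
    (hfl : ∀ M', Frame [14, 15, 16, 17, 18] [] M M' → ∀ j : Fin n, M'.nat 18 0 0 = j →
      fl.val M' = if j ∈ s then 1 else 0) :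
    Coupled ((pickProg fl).exec M) (uniformOr s d) (100 + n * (3 * fl.cost + 100))
      fun M' j => Frame [14, 15, 16, 17, 18] [] M M' ∧ M'.nat 17 0 0 = j ∧ j ∈ s := by
  have hn' : ∀ M', Frame [14, 15, 16, 17, 18] [] M M' → M'.nat 0 0 0 = n := fun M' h => by
    rw [h.nat 0 (by decide), hn]
  have hsub : ∀ {M'}, Frame [14, 18] [] M M' → Frame [14, 15, 16, 17, 18] [] M M' :=
    fun h => h.mono (by decide) (by decide)
  have hsum := sumLoop_spec (acc := 14) (ctr := 18) (by decide) (bd := .scalar 0) (e := fl)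
    (M := M) (B := n) (fun M' h => hn' M' (hsub h)) (fun j => if j ∈ s then 1 else 0)
    fun M' h j hj => hfl M' (hsub h) j hj
  have hcard : ∑ j : Fin n, (if j ∈ s then 1 else 0) = s.card := by simp
  rw [hcard] at hsum
  refine (Coupled.seq_det hsum (T₂ := 40 + n * (2 * fl.cost + 70)) ?_).mono
    (by simp only [NExp.scalar_cost]; nlinarith) fun _ _ h => h
  rintro M₁ ⟨hF₁, hc₁⟩
  have hu := Coupled.setUniform (a := 15) (i := .const 0) (j := .const 0) (e := .scalar 14)
    (M := M₁) hs d (rankIn_injOn s) (rankIn_image s) hc₁ (T := 6) (by simp [NExp.cost,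
      NExp.scalar_cost])
    (post := fun M' j => Frame [14, 15, 16, 17, 18] [] M M' ∧ M'.nat 15 0 0 = rankIn s j ∧ j ∈ s)
    fun j hj => ⟨(hsub hF₁).writeNat (by decide) _ _ _, by simp [Mem.writeNat_nat, NExp.val], hj⟩
  refine (Coupled.seq_after hu (T₂ := 34 + n * (2 * fl.cost + 70)) ?_).mono (by omega)
    fun _ _ h => h
  rintro M₂ k ⟨hF₂, hk, hks⟩
  have hinj := rankIn_injOn s
  refine Coupled.mono (Coupled.seq_setScalar (Coupled.seq_setScalar (Coupled.loop_range
    (T := 2 * fl.cost + 60) (r := n)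
    (inv := fun i M' => Frame [14, 15, 16, 17, 18] [] M M' ∧ M'.nat 18 0 0 = i ∧
      M'.nat 15 0 0 = rankIn s k ∧ M'.nat 16 0 0 = (s.filter fun j : Fin n => (j : ℕ) < i).card ∧
      (k < i → M'.nat 17 0 0 = k)) ?_ ?_ ?_)))
    (by simp only [NExp.cost, NExp.scalar_cost]; nlinarith)
    (fun M' _ h => ⟨h.1, h.2.2.2.2 k.2, hks⟩)
  · exact hn' _ ((hF₂.writeNat (by decide) _ _ _).writeNat (by decide) _ _ _)
  · refine ⟨(hF₂.writeNat (by decide) _ _ _).writeNat (by decide) _ _ _, ?_, ?_, ?_, ?_⟩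
    · simp [Mem.writeNat_nat, NExp.val]
    · simp [Mem.writeNat_nat, hk]
    · simp [Mem.writeNat_nat, NExp.val]
    · intro h; omega
  · rintro i hi M₃ ⟨h1, h2, h3, h4, h5⟩
    have hflag := hfl M₃ h1 ⟨i, hi⟩ h2
    have h4' : M₃.nat 16 0 0 = rankIn s ⟨i, hi⟩ := by rw [h4, rankIn]; rfl
    refine (Coupled.seq_det (mid := fun M' => Frame [14, 15, 16, 17, 18] [] M M' ∧
      M'.nat 18 0 0 = i ∧ M'.nat 15 0 0 = rankIn s k ∧
      M'.nat 16 0 0 = (s.filter fun j : Fin n => (j : ℕ) < i).card ∧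
      (k < i + 1 → M'.nat 17 0 0 = k)) (T₁ := fl.cost + 30) (T₂ := fl.cost + 20)
      ?_ ?_).mono (by omega) fun _ _ h => h
    · refine (Coupled.ite (T := 6) ?_ ?_).mono
        (by simp only [Test.cost, NExp.cost, NExp.scalar_cost]; omega) fun _ _ h => h
      · intro h
        -- With truncated differences, (a − b) + (b − a) + (1 − flag) ≤ 0 says that the ranks agree
        -- and the index is flagged.
        simp only [Test.holds, NExp.val, NExp.scalar_val, hflag, h3, h4'] at h
        have h6 : (⟨i, hi⟩ : Fin n) ∈ s := by
          by_contra hc; rw [if_neg hc] at h; omega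
        have h7 : (⟨i, hi⟩ : Fin n) = k := hinj h6 hks (by omega)
        refine Coupled.setScalar (by simp [NExp.scalar_cost])
          ⟨h1.writeNat (by decide) _ _ _, ?_, ?_, ?_, fun _ => ?_⟩
        · simp [Mem.writeNat_nat, h2]
        · simp [Mem.writeNat_nat, h3]
        · simp [Mem.writeNat_nat, h4]
        · simp [Mem.writeNat_nat, NExp.scalar_val, h2, ← h7]
      · intro h
        refine Coupled.skip (by omega) ⟨h1, h2, h3, h4, fun hk' => h5 ?_⟩
        by_contra hc
        have h7 : (⟨i, hi⟩ : Fin n) = k := Fin.ext (by simp only; omega)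
        apply h
        simp only [Test.holds, NExp.val, NExp.scalar_val, hflag, h3, h4', h7, hks, if_true]
        omega
    · rintro M₄ ⟨g1, g2, g3, g4, g5⟩
      have hflag' := hfl M₄ g1 ⟨i, hi⟩ g2
      refine (Coupled.seq_setScalar (Coupled.setScalar le_rfl ?_)).mono
        (by simp only [NExp.cost, NExp.scalar_cost]; omega) fun _ _ h => h
      refine ⟨(g1.writeNat (by decide) _ _ _).writeNat (by decide) _ _ _, ?_, ?_, ?_, fun h => ?_⟩
      · simp [Mem.writeNat_nat, NExp.val, NExp.scalar_val, g2]
      · simp [Mem.writeNat_nat, g3]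
      · have h8 : (s.filter fun j : Fin n => (j : ℕ) < i + 1).card =
            (s.filter fun j : Fin n => (j : ℕ) < i).card +
              if (⟨i, hi⟩ : Fin n) ∈ s then 1 else 0 := by
          have h9 : (s.filter fun j : Fin n => (j : ℕ) < i + 1) =
              (s.filter fun j : Fin n => (j : ℕ) < i) ∪ s.filter fun j => j = ⟨i, hi⟩ := by
            ext j
            simp only [Finset.mem_filter, Finset.mem_union, Fin.ext_iff]
            constructor
            · rintro ⟨h1, h2⟩
              rcases Nat.lt_succ_iff_lt_or_eq.1 h2 with h | h
              exacts [Or.inl ⟨h1, h⟩, Or.inr ⟨h1, h⟩]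
            · rintro (⟨h1, h2⟩ | ⟨h1, h2⟩)
              exacts [⟨h1, by omega⟩, ⟨h1, by omega⟩]
          rw [h9, Finset.card_union_of_disjoint, Finset.filter_eq']
          · split_ifs <;> simp
          · rw [Finset.disjoint_left]
            simp only [Finset.mem_filter, Fin.ext_iff]
            rintro j ⟨-, h1⟩ ⟨-, h2⟩
            omega
        rw [h8]
        simp [Mem.writeNat_nat, NExp.val, NExp.scalar_val, g4, hflag']
      · simp [Mem.writeNat_nat, g5 h]

/-! ### One step of the chain as a program -/

/-- The arrays that describe the graph hold their proper values. -/
structure HoldsGraph {n : ℕ} (G : SimpleGraph (Fin n)) [DecidableRel G.Adj] (x : ℝ) (M : Mem) :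
    Prop where
  card : M.nat 0 0 0 = n
  adj : ∀ i j : Fin n, M.nat 1 i j = if G.Adj i j then 1 else 0
  deg : ∀ i : Fin n, M.nat 4 i 0 = G.degree i
  real : M.real 0 0 = x

theorem HoldsGraph.frame {n : ℕ} {G : SimpleGraph (Fin n)} [DecidableRel G.Adj] {x : ℝ}
    {M M' : Mem} (h : HoldsGraph G x M) {s t : List ℕ} (hF : Frame s t M M')
    (hs : 0 ∉ s ∧ 1 ∉ s ∧ 4 ∉ s) (ht : 0 ∉ t) : HoldsGraph G x M' where
  card := by rw [hF.nat 0 hs.1, h.card]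
  adj := by rw [hF.nat 1 hs.2.1]; exact h.adj
  deg := by rw [hF.nat 4 hs.2.2]; exact h.deg
  real := by rw [hF.real 0 ht, h.real]

/-- The arrays that describe the current state of the chain hold `A` and its odd vertices. -/
structure HoldsState {n : ℕ} (A : Finset (Sym2 (Fin n))) (M : Mem) : Prop where
  edge : ∀ i j : Fin n, M.nat 10 i j = if s(i, j) ∈ A then 1 else 0
  odd : ∀ i : Fin n, M.nat 11 0 i = if i ∈ oddVertices A then 1 else 0

theorem HoldsState.frame {n : ℕ} {A : Finset (Sym2 (Fin n))}
    {M M' : Mem} (h : HoldsState A M) {s t : List ℕ} (hF : Frame s t M M')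
    (hs : 10 ∉ s ∧ 11 ∉ s) : HoldsState A M' where
  edge := by rw [hF.nat 10 hs.1]; exact h.edge
  odd := by rw [hF.nat 11 hs.2]; exact h.odd

/-- Toggle the edge between the vertices in `19` and `20`. -/
def toggleProg : Prog :=
  .seq (.setNat 10 (.scalar 19) (.scalar 20)
    (.sub (.const 1) (.cell 10 (.scalar 19) (.scalar 20)))) <|
  .seq (.setNat 10 (.scalar 20) (.scalar 19) (.cell 10 (.scalar 19) (.scalar 20))) <|
  .seq (.setNat 11 (.const 0) (.scalar 19) (.sub (.const 1) (.cell 11 (.const 0) (.scalar 19)))) <|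
  .setNat 11 (.const 0) (.scalar 20) (.sub (.const 1) (.cell 11 (.const 0) (.scalar 20)))

theorem toggleProg_spec {n : ℕ} {A : Finset (Sym2 (Fin n))} {M : Mem} (h : HoldsState A M)
    {u v : Fin n} (huv : u ≠ v) (hu : M.nat 19 0 0 = u) (hv : M.nat 20 0 0 = v) :
    Coupled (toggleProg.exec M) (PMF.pure ()) 100 fun M' _ =>
      Frame [10, 11] [] M M' ∧ HoldsState (A ∆ {s(u, v)}) M' := by
  refine (Coupled.seq_setNat (Coupled.seq_setNat (Coupled.seq_setNat
    (Coupled.setNat le_rfl ?_)))).mono (by simp [NExp.cost, NExp.scalar_cost]) fun _ _ h => h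
  refine ⟨((((Frame.refl _ _ M).writeNat (by decide) _ _ _).writeNat (by decide) _ _ _).writeNat
    (by decide) _ _ _).writeNat (by decide) _ _ _, ?_, ?_⟩
  · intro i j
    have huv' : (u : ℕ) ≠ v := fun h => huv (Fin.ext h)
    have he : s(i, j) ∈ A ∆ {s(u, v)} ↔ (s(i, j) ∈ A ↔ ¬ s(i, j) = s(u, v)) := by
      rw [Finset.mem_symmDiff, Finset.mem_singleton]; tauto
    simp only [Mem.writeNat_nat, NExp.val, NExp.scalar_val, hu, hv, he, h.edge]
    by_cases h1 : i = u ∧ j = v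
    · obtain ⟨rfl, rfl⟩ := h1
      by_cases h2 : s(i, j) ∈ A <;> simp [h2, huv']
    · by_cases h3 : i = v ∧ j = u
      · obtain ⟨rfl, rfl⟩ := h3
        have h4 : s(i, j) = s(j, i) := Sym2.eq_swap
        rw [h4]
        by_cases h2 : s(j, i) ∈ A <;> simp [h2, huv']
      · have h5 : ¬ s(i, j) = s(u, v) := by
          rw [Sym2.eq_iff]; tauto
        have h6 : ¬ ((i : ℕ) = u ∧ (j : ℕ) = v) := by simpa [← Fin.ext_iff] using h1
        have h7 : ¬ ((i : ℕ) = v ∧ (j : ℕ) = u) := by simpa [← Fin.ext_iff] using h3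
        simp [h5, h6, h7]
  · intro i
    have huv' : (u : ℕ) ≠ v := fun h => huv (Fin.ext h)
    have he : i ∈ oddVertices (A ∆ {s(u, v)}) ↔ (i ∈ oddVertices A ↔ ¬ (i = u ∨ i = v)) := by
      rw [oddVertices_toggle, Finset.mem_symmDiff, Finset.mem_insert, Finset.mem_singleton]; tauto
    simp only [Mem.writeNat_nat, NExp.val, NExp.scalar_val, hu, hv, he]
    by_cases h1 : i = u
    · subst h1
      by_cases h2 : i ∈ oddVertices A <;> simp [h2, huv', h.odd]
    · by_cases h3 : i = v
      · subst h3
        by_cases h2 : i ∈ oddVertices A <;> simp [h2, huv'.symm, h.odd]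
      · have h6 : (i : ℕ) ≠ u := fun h => h1 (Fin.ext h)
        have h7 : (i : ℕ) ≠ v := fun h => h3 (Fin.ext h)
        simp [h1, h3, h6, h7, h.odd]

/-- Twice the acceptance probability, stored in the real array `4`. -/
def acceptProg : Prog :=
  .seq (.ite (.natLe (.const 1) (.cell 10 (.scalar 19) (.scalar 20)))
    (.setReal 4 (.const 0) (.div (.ofNat (.const 1)) (.cell 0 (.const 0))))
    (.setReal 4 (.const 0) (.cell 0 (.const 0)))) <|
  .seq (.ite (.natLe (.add (.sub (.const 1) (.scalar 21)) (.cell 11 (.const 0) (.scalar 20)))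
      (.const 0))
    (.setReal 4 (.const 0) (.mul (.div (.ofNat (.cell 4 (.scalar 19) (.const 0)))
      (.ofNat (.cell 4 (.scalar 20) (.const 0)))) (.cell 4 (.const 0)))) .skip) <|
  .ite (.realLe (.ofNat (.const 1)) (.cell 4 (.const 0)))
    (.setReal 4 (.const 0) (.ofNat (.const 1))) .skip

/-- For moves that the chain can propose, the case distinction in the acceptance probability can be
read off ∂A and v, so the program need not compute the toggled boundary. -/
theorem card_oddVertices_toggle_eq_two_iff {V : Type*} [Fintype V] [DecidableEq V]
    {G : SimpleGraph V} [DecidableRel G.Adj] {A : Finset (Sym2 V)} (hA : A ∈ wormSpace G) {u v : V}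
    (hu : u ∈ startVertices A) (huv : G.Adj u v) :
    ((oddVertices A).card = 2 ∧ (oddVertices (A ∆ {s(u, v)})).card = 2 ∧ u ∈ oddVertices A) ↔
      oddVertices A ≠ ∅ ∧ v ∉ oddVertices A := by
  constructor
  · rintro ⟨h1, h2, h3⟩
    refine ⟨fun h => by simp [h] at h3, fun hv => ?_⟩
    have h4 : {u, v} = oddVertices A := Finset.eq_of_subset_of_card_le
      (by intro z; simp only [Finset.mem_insert, Finset.mem_singleton]
          rintro (rfl | rfl) <;> assumption) (by rw [h1, Finset.card_pair huv.ne])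
    rw [oddVertices_toggle, h4, symmDiff_self] at h2
    simp at h2
  · rintro ⟨h1, h2⟩
    rw [startVertices_of_ne_empty h1] at hu
    refine ⟨?_, ?_, hu⟩
    · rcases (mem_wormSpace.1 hA).2 with h | h
      · exact absurd (Finset.card_eq_zero.1 h) h1
      · exact h
    · have h := toggle_mem_wormSpace hA ((startVertices_of_ne_empty h1).symm ▸ hu) huv
      rcases (mem_wormSpace.1 h).2 with h | h
      · rw [Finset.card_eq_zero, oddVertices_toggle, ← Finset.bot_eq_empty, symmDiff_eq_bot] at h
        rw [h] at h2; simp at h2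
      · exact h

theorem acceptProg_spec {n : ℕ} {G : SimpleGraph (Fin n)} [DecidableRel G.Adj] {x : ℝ}
    {A : Finset (Sym2 (Fin n))} (hA : A ∈ wormSpace G) {M : Mem} (hG : HoldsGraph G x M)
    (hS : HoldsState A M) {u v : Fin n} (hu : M.nat 19 0 0 = u) (hv : M.nat 20 0 0 = v)
    (hodd : M.nat 21 0 0 = (oddVertices A).card) (hus : u ∈ startVertices A) (huv : G.Adj u v) :
    Coupled (acceptProg.exec M) (PMF.pure ()) 100 fun M' _ =>
      Frame [] [4] M M' ∧ 1 / 2 * M'.real 4 0 = acceptance G x A u v := by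
  set r : ℝ := if s(u, v) ∈ A then 1 / x else x with hr
  set c : Prop := (oddVertices A).card = 2 ∧ (oddVertices (A ∆ {s(u, v)})).card = 2 ∧
    u ∈ oddVertices A with hc
  set r' : ℝ := if c then (G.degree u : ℝ) / (G.degree v : ℝ) * r else r with hr'
  have hacc : acceptance G x A u v = 1 / 2 * min 1 r' := by
    by_cases h : c
    · rw [hr', if_pos h, acceptance, if_pos h]
    · rw [hr', if_neg h, acceptance, if_neg h]
  refine (Coupled.seq_det (T₁ := 40) (mid := fun M' => Frame [] [4] M M' ∧ M'.real 4 0 = r)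
    ?_ (T₂ := 60) ?_).mono (by omega) fun _ _ h => h
  · refine (Coupled.ite (T := 20) ?_ ?_).mono
      (by simp [Test.cost, NExp.cost, NExp.scalar_cost]) fun _ _ h => h
    · intro h
      simp only [Test.holds, NExp.val, NExp.scalar_val, hu, hv, hS.edge] at h
      have h1 : s(u, v) ∈ A := by by_contra h2; simp [h2] at h
      refine Coupled.setReal (by simp [NExp.cost, RExp.cost])
        ⟨(Frame.refl _ _ M).writeReal (by decide) _ _, ?_⟩
      simp [Mem.writeReal_real, NExp.val, RExp.val, hr, h1, hG.real]
    · intro h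
      simp only [Test.holds, NExp.val, NExp.scalar_val, hu, hv, hS.edge] at h
      have h1 : s(u, v) ∉ A := by intro h2; simp [h2] at h
      refine Coupled.setReal (by simp [NExp.cost, RExp.cost])
        ⟨(Frame.refl _ _ M).writeReal (by decide) _ _, ?_⟩
      simp [Mem.writeReal_real, NExp.val, RExp.val, hr, h1, hG.real]
  rintro M₁ ⟨hF₁, h₁⟩
  have hiff : c ↔ oddVertices A ≠ ∅ ∧ v ∉ oddVertices A :=
    card_oddVertices_toggle_eq_two_iff hA hus huv
  refine (Coupled.seq_det (T₁ := 45) (mid := fun M' => Frame [] [4] M M' ∧ M'.real 4 0 = r')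
    ?_ (T₂ := 15) ?_).mono (by omega) fun _ _ h => h
  -- The truncated 1 − |∂A| vanishes exactly when ∂A is nonempty, so the test says that ∂A ≠ ∅ and v
  -- ∉ ∂A.
  · have htest : (Test.natLe (.add (.sub (.const 1) (.scalar 21))
        (.cell 11 (.const 0) (.scalar 20))) (.const 0)).holds M₁ ↔ c := by
      rw [hiff]
      simp only [Test.holds, NExp.val, NExp.scalar_val]
      rw [hF₁.nat 20 (by decide), hF₁.nat 21 (by decide), hF₁.nat 11 (by decide), hv, hodd,
        hS.odd]
      by_cases h0 : oddVertices A = ∅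
      · simp [h0]
      · have h3 : 0 < (oddVertices A).card :=
          Finset.card_pos.2 (Finset.nonempty_iff_ne_empty.2 h0)
        by_cases h2 : v ∈ oddVertices A <;> simp [h0, h2]
        omega
    refine (Coupled.ite (T := 30) ?_ ?_).mono
      (by simp [Test.cost, NExp.cost, NExp.scalar_cost]) fun _ _ h => h
    · intro h
      rw [htest] at h
      refine Coupled.setReal (by simp [NExp.cost, RExp.cost, NExp.scalar_cost])
        ⟨hF₁.writeReal (by decide) _ _, ?_⟩
      have hG₁ := hG.frame hF₁ (by decide) (by decide)
      have hu₁ : M₁.nat 19 0 0 = u := by rw [hF₁.nat 19 (by decide), hu]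
      have hv₁ : M₁.nat 20 0 0 = v := by rw [hF₁.nat 20 (by decide), hv]
      simp [Mem.writeReal_real, NExp.val, RExp.val, NExp.scalar_val, hu₁, hv₁, hG₁.deg, hr', h, h₁]
    · intro h
      rw [htest] at h
      exact Coupled.skip (by omega) ⟨hF₁, by rw [h₁, hr', if_neg h]⟩
  rintro M₂ ⟨hF₂, h₂⟩
  refine (Coupled.ite (T := 8) ?_ ?_).mono
      (by simp [Test.cost, NExp.cost, RExp.cost]) fun _ _ h => h
  · intro h
    simp only [Test.holds, RExp.val, NExp.val, h₂, Nat.cast_one] at h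
    refine Coupled.setReal (by simp [NExp.cost, RExp.cost])
      ⟨hF₂.writeReal (by decide) _ _, ?_⟩
    rw [hacc, min_eq_left h]
    simp [Mem.writeReal_real, NExp.val, RExp.val]
  · intro h
    simp only [Test.holds, RExp.val, NExp.val, h₂, Nat.cast_one] at h
    exact Coupled.skip (by omega) ⟨hF₂, by rw [hacc, h₂, min_eq_right (le_of_not_ge h)]⟩

/-- One step of the chain. -/
def stepProg : Prog :=
  .seq (sumLoop 21 18 (.scalar 0) (.cell 11 (.const 0) (.scalar 18))) <|
  .seq (pickProg (.add (.cell 11 (.const 0) (.scalar 18)) (.sub (.const 1) (.scalar 21)))) <|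
  .seq (.setScalar 19 (.scalar 17)) <|
  .seq (pickProg (.cell 1 (.scalar 19) (.scalar 18))) <|
  .seq (.setScalar 20 (.scalar 17)) <|
  .seq acceptProg <|
  .seq (.setCoin 22 (.const 0) (.const 0)
    (.mul (.div (.ofNat (.const 1)) (.ofNat (.const 2))) (.cell 4 (.const 0)))) <|
  .ite (.natLe (.const 1) (.scalar 22)) toggleProg .skip

theorem stepProg_spec {n : ℕ} [Nonempty (Fin n)] {G : SimpleGraph (Fin n)} [DecidableRel G.Adj]
    {x : ℝ} (hdeg : ∀ u, 0 < G.degree u)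
    {A : Finset (Sym2 (Fin n))} (hA : A ∈ wormSpace G) {M : Mem} (hG : HoldsGraph G x M)
    (hS : HoldsState A M) :
    Coupled (stepProg.exec M) (psStep G x A) (1000 + 1000 * n) fun M' A' =>
      Frame [10, 11, 14, 15, 16, 17, 18, 19, 20, 21, 22] [4] M M' ∧ HoldsState A' M' ∧
        A' ∈ wormSpace G := by
  have hpick : ∀ {M M' : Mem}, Frame [14, 15, 16, 17, 18] [] M M' →
      Frame [14, 15, 16, 17, 18, 19, 20, 21, 22] [4] M M' :=
    fun h => h.mono (by decide) (by decide)
  have hsum := sumLoop_spec (acc := 21) (ctr := 18) (by decide) (bd := .scalar 0)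
    (e := .cell 11 (.const 0) (.scalar 18))
    (M := M) (B := n) (fun M' h => by rw [NExp.scalar_val, h.nat 0 (by decide), hG.card])
    (fun j => if j ∈ oddVertices A then 1 else 0) fun M' h j hj => by
      simp only [NExp.val, NExp.scalar_val]
      rw [hj, h.nat 11 (by decide), hS.odd]
  have hcard : ∑ j : Fin n, (if j ∈ oddVertices A then 1 else 0) = (oddVertices A).card := by simp
  rw [hcard] at hsum
  refine (Coupled.seq_det hsum (T₂ := 900 + 900 * n) ?_).mono
    (by simp only [NExp.cost, NExp.scalar_cost]; omega) fun _ _ h => h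
  rintro M₁ ⟨hF₁', hodd₁⟩
  have hF₁ : Frame [14, 15, 16, 17, 18, 19, 20, 21, 22] [4] M M₁ :=
    hF₁'.mono (by decide) (by decide)
  have hS₁ := hS.frame hF₁ (by decide)
  have hG₁ := hG.frame hF₁ (by decide) (by decide)
  refine (Coupled.seq (pickProg_spec hG₁.card (startVertices_nonempty A)
    (Classical.arbitrary (Fin n)) ?_) (T₂ := 700 + 700 * n) ?_).mono
    (by simp only [NExp.cost, NExp.scalar_cost]; omega) fun _ _ h => h
  · intro M' hF' j hj
    simp only [NExp.val, NExp.scalar_val]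
    rw [hj, hF'.nat 11 (by decide), hF'.nat 21 (by decide), hS₁.odd, hodd₁]
    -- The flag odd(j) + (1 − |∂A|) is constantly 1 for an even subgraph and the indicator of ∂A
    -- otherwise, which is membership in the start vertices in both cases.
    by_cases h0 : oddVertices A = ∅
    · simp [h0, startVertices_of_empty h0]
    · rw [startVertices_of_ne_empty h0]
      have : 0 < (oddVertices A).card := Finset.card_pos.2 (Finset.nonempty_iff_ne_empty.2 h0)
      split_ifs <;> omega
  rintro M₂ u ⟨hF₂', hres₂, hu⟩
  have hF₂ := hF₁.trans (hpick hF₂')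
  have hodd₂ : M₂.nat 21 0 0 = (oddVertices A).card := by rw [hF₂'.nat 21 (by decide), hodd₁]
  refine (Coupled.seq_setScalar (T := 650 + 700 * n) ?_).mono
    (by simp only [NExp.scalar_cost]; omega) fun _ _ h => h
  rw [NExp.scalar_val, hres₂]
  set M₃ := M₂.writeNat 19 0 0 u with hM₃
  have hF₃ : Frame [14, 15, 16, 17, 18, 19, 20, 21, 22] [4] M M₃ :=
    hF₂.writeNat (by decide) _ _ _
  have hG₃ := hG.frame hF₃ (by decide) (by decide)
  have h19 : M₃.nat 19 0 0 = u := by simp [hM₃, Mem.writeNat_nat]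
  have hodd₃ : M₃.nat 21 0 0 = (oddVertices A).card := by
    rw [← hodd₂, hM₃]; simp [Mem.writeNat_nat]
  have hN : (G.neighborFinset u).Nonempty := by
    rw [← Finset.card_pos, G.card_neighborFinset_eq_degree]; exact hdeg u
  refine (Coupled.seq (pickProg_spec hG₃.card hN u ?_) (T₂ := 500) ?_).mono
    (by simp only [NExp.cost, NExp.scalar_cost]; omega) fun _ _ h => h
  · intro M' hF' j hj
    simp only [NExp.val, NExp.scalar_val]
    rw [hj, hF'.nat 1 (by decide), hF'.nat 19 (by decide), h19, hG₃.adj]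
    simp
  rintro M₄ v ⟨hF₄', hres₄, hv⟩
  have huv : G.Adj u v := by simpa using hv
  have hF₄ := hF₃.trans (hpick hF₄')
  refine (Coupled.seq_setScalar (T := 450) ?_).mono
    (by simp only [NExp.scalar_cost]; omega) fun _ _ h => h
  rw [NExp.scalar_val, hres₄]
  set M₅ := M₄.writeNat 20 0 0 v with hM₅
  have hF₅ : Frame [14, 15, 16, 17, 18, 19, 20, 21, 22] [4] M M₅ :=
    hF₄.writeNat (by decide) _ _ _
  have h20 : M₅.nat 20 0 0 = v := by simp [hM₅, Mem.writeNat_nat]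
  have h19₅ : M₅.nat 19 0 0 = u := by
    rw [hM₅]; simp [Mem.writeNat_nat, hF₄'.nat 19 (by decide), h19]
  have hodd₅ : M₅.nat 21 0 0 = (oddVertices A).card := by
    rw [hM₅]; simp [Mem.writeNat_nat, hF₄'.nat 21 (by decide), hodd₃]
  refine (Coupled.seq_det (acceptProg_spec hA (hG.frame hF₅ (by decide) (by decide))
    (hS.frame hF₅ (by decide)) h19₅ h20 hodd₅ hu huv) (T₂ := 300) ?_).mono (by omega)
    fun _ _ h => h
  rintro M₆ ⟨hF₆', hacc⟩
  have hF₆ : Frame [14, 15, 16, 17, 18, 19, 20, 21, 22] [4] M M₆ :=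
    hF₅.trans (hF₆'.mono (by decide) (by decide))
  have hval : (RExp.mul (.div (.ofNat (.const 1)) (.ofNat (.const 2))) (.cell 4 (.const 0))).val M₆
      = acceptance G x A u v := by
    rw [← hacc]; simp [RExp.val, NExp.val]
  have hcoin := Coupled.setCoin (a := 22) (i := .const 0) (j := .const 0)
    (e := .mul (.div (.ofNat (.const 1)) (.ofNat (.const 2))) (.cell 4 (.const 0)))
    (M := M₆) (g := id) (T := 20) (post := fun M' b =>
      Frame [14, 15, 16, 17, 18, 19, 20, 21, 22] [4] M M' ∧ M'.nat 19 0 0 = u ∧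
      M'.nat 20 0 0 = v ∧ M'.nat 22 0 0 = if b then 1 else 0)
    (by simp [NExp.cost, RExp.cost]) fun b => ⟨hF₆.writeNat (by decide) _ _ _, by
      simp [Mem.writeNat_nat, hF₆'.nat 19 (by decide), h19₅], by
      simp [Mem.writeNat_nat, hF₆'.nat 20 (by decide), h20], by
      simp [Mem.writeNat_nat, NExp.val]⟩
  rw [hval, PMF.map_id] at hcoin
  rw [← PMF.bind_pure_comp]
  refine (Coupled.seq hcoin (T₂ := 200) ?_).mono (by omega) fun _ _ h => h
  rintro M₇ b ⟨hF₇, h19₇, h20₇, h22₇⟩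
  have hF₇' : Frame [10, 11, 14, 15, 16, 17, 18, 19, 20, 21, 22] [4] M M₇ :=
    hF₇.mono (by decide) (by decide)
  refine (Coupled.ite (T := 100) ?_ ?_).mono
      (by simp [Test.cost, NExp.cost, NExp.scalar_cost]) fun _ _ h => h
  · intro h
    simp only [Test.holds, NExp.val, NExp.scalar_val, h22₇] at h
    have hb : b = true := by by_contra hb; simp [hb] at h
    subst hb
    have := Coupled.map (fun _ : Unit => A ∆ {s(u, v)})
      (post := fun M' A' => Frame [10, 11, 14, 15, 16, 17, 18, 19, 20, 21, 22] [4] M M' ∧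
        HoldsState A' M' ∧ A' ∈ wormSpace G)
      ((toggleProg_spec (hS.frame hF₇ (by decide)) huv.ne h19₇ h20₇).mono le_rfl fun M' _ h =>
        ⟨hF₇'.trans (h.1.mono (by decide) (by decide)), h.2, toggle_mem_wormSpace hA hu huv⟩)
    rw [PMF.pure_map] at this
    simpa using this
  · intro h
    simp only [Test.holds, NExp.val, NExp.scalar_val, h22₇] at h
    have hb : b = false := by by_contra hb; simp [hb] at h
    subst hb
    refine Coupled.skip (by omega) ⟨hF₇', ?_⟩
    simpa using ⟨hS.frame hF₇ (by decide), hA⟩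

/-! ### Sampling and medians as programs -/

/-- Reset the state of the chain to the empty configuration. -/
def resetProg : Prog :=
  .seq (.setScalar 26 (.const 0)) <| .loop (.scalar 0) <|
    .seq (.setScalar 27 (.const 0)) <|
    .seq (.loop (.scalar 0) (.seq (.setNat 10 (.scalar 26) (.scalar 27) (.const 0))
      (.setScalar 27 (.add (.scalar 27) (.const 1))))) <|
    .seq (.setNat 11 (.const 0) (.scalar 26) (.const 0)) <|
    .setScalar 26 (.add (.scalar 26) (.const 1))

theorem resetProg_spec {n : ℕ} {M : Mem} (hn : M.nat 0 0 0 = n) :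
    Coupled (resetProg.exec M) (PMF.pure ()) (10 + n * (50 + 50 * n)) fun M' _ =>
      Frame [10, 11, 26, 27] [] M M' ∧ HoldsState (∅ : Finset (Sym2 (Fin n))) M' := by
  have hn' : ∀ M', Frame [10, 11, 26, 27] [] M M' → M'.nat 0 0 0 = n := fun M' h => by
    rw [h.nat 0 (by decide), hn]
  have hF : Frame [10, 11, 26, 27] [] M (M.writeNat 26 0 0 0) :=
    (Frame.refl _ _ M).writeNat (by decide) 0 0 0
  refine Coupled.mono (Coupled.seq_setScalar (Coupled.loop_range (r := n) (T := 45 + 50 * n)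
    (inv := fun i M' => Frame [10, 11, 26, 27] [] M M' ∧ M'.nat 26 0 0 = i ∧
      (∀ a < i, ∀ b < n, M'.nat 10 a b = 0) ∧ ∀ a < i, M'.nat 11 0 a = 0) (hn' _ hF)
      ⟨hF, by simp [Mem.writeNat_nat, NExp.val], by simp, by simp⟩ ?_))
    (by simp only [NExp.cost, NExp.scalar_cost]; nlinarith) ?_
  · rintro i hi M₁ ⟨h1, h2, h3, h4⟩
    have hF₁ : Frame [10, 11, 26, 27] [] M (M₁.writeNat 27 0 0 0) :=
      h1.writeNat (by decide) 0 0 0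
    refine (Coupled.seq_setScalar (Coupled.seq_det (Coupled.loop_range (r := n) (T := 22)
      (inv := fun j M' => Frame [10, 11, 26, 27] [] M M' ∧ M'.nat 26 0 0 = i ∧
        M'.nat 27 0 0 = j ∧ (∀ a < i, ∀ b < n, M'.nat 10 a b = 0) ∧ (∀ b < j, M'.nat 10 i b = 0) ∧
        ∀ a < i, M'.nat 11 0 a = 0) ?_ ⟨?_, ?_, ?_, ?_, ?_, ?_⟩ ?_)
      (T₂ := 20) ?_)).mono (by simp only [NExp.cost, NExp.scalar_cost]; omega) fun _ _ h => h
    · exact hn' _ hF₁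
    · exact hF₁
    · simp [Mem.writeNat_nat, h2]
    · simp [Mem.writeNat_nat, NExp.val]
    · simpa [Mem.writeNat_nat] using h3
    · simp
    · simpa [Mem.writeNat_nat] using h4
    · rintro j hj M₂ ⟨g1, g2, g3, g4, g5, g6⟩
      refine (Coupled.seq_setNat (Coupled.setScalar le_rfl ?_)).mono
        (by simp [NExp.cost, NExp.scalar_cost]) fun _ _ h => h
      refine ⟨(g1.writeNat (by decide) _ _ _).writeNat (by decide) _ _ _, ?_, ?_, ?_, ?_, ?_⟩
      · simp [Mem.writeNat_nat, g2]
      · simp [Mem.writeNat_nat, NExp.val, NExp.scalar_val, g3]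
      · intro a ha b hb
        simp [Mem.writeNat_nat, NExp.val, g4 a ha b hb]
      · intro b hb
        by_cases hbj : b = j
        · simp [Mem.writeNat_nat, NExp.val, NExp.scalar_val, g2, g3, hbj]
        · simp [Mem.writeNat_nat, NExp.val, g5 b (by omega)]
      · intro a ha
        simp [Mem.writeNat_nat, g6 a ha]
    · rintro M₂ ⟨g1, g2, g3, g4, g5, g6⟩
      refine (Coupled.seq_setNat (Coupled.setScalar le_rfl ?_)).mono
        (by simp [NExp.cost, NExp.scalar_cost]) fun _ _ h => h
      refine ⟨(g1.writeNat (by decide) _ _ _).writeNat (by decide) _ _ _, ?_, ?_, ?_⟩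
      · simp [Mem.writeNat_nat, NExp.val, NExp.scalar_val, g2]
      · intro a ha b hb
        by_cases hai : a = i
        · simp [Mem.writeNat_nat, hai, g5 b hb]
        · simp [Mem.writeNat_nat, g4 a (by omega) b hb]
      · intro a ha
        by_cases hai : a = i
        · simp [Mem.writeNat_nat, NExp.val, NExp.scalar_val, hai, g2]
        · simp [Mem.writeNat_nat, NExp.val, g6 a (by omega)]
  · rintro M' - ⟨h1, -, h3, h4⟩
    exact ⟨h1, fun i j => by simp [h3 i i.2 j j.2], fun i => by simp [h4 i i.2]⟩

/-- Run the chain from the empty configuration for as many steps as the scalar `7` says, and add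
one to the scalar `23` if the odd vertices agree with the flags in array `13`. -/
def sampleProg : Prog :=
  .seq resetProg <| .seq (.loop (.scalar 7) stepProg) <|
  .seq (sumLoop 25 18 (.scalar 0)
    (.add (.sub (.cell 11 (.const 0) (.scalar 18)) (.cell 13 (.const 0) (.scalar 18)))
      (.sub (.cell 13 (.const 0) (.scalar 18)) (.cell 11 (.const 0) (.scalar 18))))) <|
  .setScalar 23 (.add (.scalar 23) (.sub (.const 1) (.scalar 25)))

/-- The flags in array `13` are those of the set `W`. -/
def HoldsTarget {n : ℕ} (W : Finset (Fin n)) (M : Mem) : Prop :=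
  ∀ j : Fin n, M.nat 13 0 j = if j ∈ W then 1 else 0

/-- The indicator of `∂A = W` after `R` steps of the chain from the empty configuration. -/
def indicatorLaw {n : ℕ} [Nonempty (Fin n)] (G : SimpleGraph (Fin n)) [DecidableRel G.Adj] (x : ℝ)
    (W : Finset (Fin n)) (R : ℕ) : PMF ℝ :=
  (psRun G x R ∅).map fun A => if A ∈ graphsWithBoundary G W then 1 else 0

/-- Cell 25 counts the vertices at which ∂A and W differ, so the truncated 1 − count is the
indicator of ∂A = W. The inclusion A ⊆ E, also needed for membership in the event, comes from the
loop invariant A ∈ 𝒲. -/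
theorem sampleProg_spec {n : ℕ} [Nonempty (Fin n)] {G : SimpleGraph (Fin n)} [DecidableRel G.Adj]
    {x : ℝ} (hdeg : ∀ u, 0 < G.degree u) {W : Finset (Fin n)} {R : ℕ} {M : Mem}
    (hG : HoldsGraph G x M) (hW : HoldsTarget W M) (hR : M.nat 7 0 0 = R) :
    Coupled (sampleProg.exec M) (indicatorLaw G x W R)
      (100 + 200 * n + 50 * (n * n) + R * (1001 + 1000 * n)) fun M' y =>
      Frame [10, 11, 14, 15, 16, 17, 18, 19, 20, 21, 22, 23, 25, 26, 27] [4] M M' ∧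
        (M'.nat 23 0 0 : ℝ) = M.nat 23 0 0 + y := by
  refine (Coupled.seq_det (resetProg_spec hG.card)
    (T₂ := 90 + 150 * n + R * (1001 + 1000 * n)) ?_).mono (by nlinarith) fun _ _ h => h
  rintro M₁ ⟨hF₁, hS₁⟩
  have hinv := Coupled.loop (e := .scalar 7) (p := stepProg) (κ := psStep G x)
    (T := 1000 + 1000 * n) (r := R) (M := M₁) (b := ∅)
    (inv := fun M' A => Frame [10, 11, 14, 15, 16, 17, 18, 19, 20, 21, 22, 26, 27] [4] M M' ∧
      HoldsState A M' ∧ A ∈ wormSpace G)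
    (by rw [NExp.scalar_val, hF₁.nat 7 (by decide), hR])
    ⟨hF₁.mono (by decide) (by decide), hS₁, empty_mem_wormSpace G⟩ (by
      rintro M' A ⟨h1, h2, h3⟩
      exact (stepProg_spec hdeg h3 (hG.frame h1 (by decide) (by decide)) h2).mono le_rfl
        fun M'' A' h => ⟨h1.trans (h.1.mono (by decide) (by decide)), h.2⟩)
  rw [← psRun_eq_iterKernel] at hinv
  rw [indicatorLaw]
  refine Coupled.map _ ((Coupled.seq_after hinv (T₂ := 80 + 100 * n) ?_).mono
    (by simp only [NExp.scalar_cost]; nlinarith) fun _ _ h => h)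
  rintro M₂ A ⟨hF₂, hS₂, hA⟩
  set g : Fin n → ℕ := fun j => if (j ∈ oddVertices A ↔ j ∈ W) then 0 else 1 with hg
  refine (Coupled.seq_det (sumLoop_spec (acc := 25) (ctr := 18) (by decide) (bd := .scalar 0)
    (B := n) (fun M' h => ?_) g ?_) (T₂ := 20) ?_).mono
    (by simp only [NExp.cost, NExp.scalar_cost]; omega) fun _ _ h => h
  · rw [NExp.scalar_val, h.nat 0 (by decide), hF₂.nat 0 (by decide), hG.card]
  · intro M' h j hj
    simp only [NExp.val, NExp.scalar_val]
    rw [hj, h.nat 11 (by decide), h.nat 13 (by decide), hF₂.nat 13 (by decide), hS₂.odd, hW, hg]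
    by_cases h1 : j ∈ oddVertices A <;> by_cases h2 : j ∈ W <;> simp [h1, h2]
  · rintro M₃ ⟨hF₃, h25⟩
    have hF : Frame [10, 11, 14, 15, 16, 17, 18, 19, 20, 21, 22, 23, 25, 26, 27] [4] M M₃ :=
      (hF₂.mono (by decide) (by decide)).trans (hF₃.mono (by decide) (by decide))
    refine Coupled.setScalar (by simp [NExp.cost, NExp.scalar_cost])
      ⟨hF.writeNat (by decide) _ _ _, ?_⟩
    have h23 : M₃.nat 23 0 0 = M.nat 23 0 0 := by
      rw [hF₃.nat 23 (by decide), hF₂.nat 23 (by decide)]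
    simp only [Mem.writeNat_nat, NExp.val, NExp.scalar_val, h23, h25, and_self, if_true]
    by_cases h : oddVertices A = W
    · have : ∑ j, g j = 0 := Finset.sum_eq_zero fun j _ => by simp [hg, h]
      rw [this, if_pos (mem_graphsWithBoundary.2 ⟨(mem_wormSpace.1 hA).1, h⟩)]; push_cast; ring
    · have : 0 < ∑ j, g j := by
        rw [Nat.pos_iff_ne_zero, Ne, Finset.sum_eq_zero_iff]
        intro hc
        refine h (Finset.ext fun j => ?_)
        have := hc j (Finset.mem_univ j)
        by_contra hj
        simp [hg, hj] at this
      have h0 : 1 - ∑ j, g j = 0 := by omega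
      rw [h0, if_neg fun h' => h (mem_graphsWithBoundary.1 h').2]; push_cast; ring

/-- The mean of as many indicators as the scalar `8` says, stored in the real array `2` at the
index in the scalar `24`. -/
def meanProg : Prog :=
  .seq (.setScalar 23 (.const 0)) <| .seq (.loop (.scalar 8) sampleProg) <|
  .seq (.setReal 2 (.scalar 24) (.div (.ofNat (.scalar 23)) (.ofNat (.scalar 8)))) <|
  .setScalar 24 (.add (.scalar 24) (.const 1))

/-- A bound for the number of steps of `meanProg`. -/
def meanTime (n R N : ℕ) : ℕ := 50 + N * (101 + 200 * n + 50 * (n * n) + R * (1001 + 1000 * n))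

theorem meanProg_spec {n : ℕ} [Nonempty (Fin n)] {G : SimpleGraph (Fin n)} [DecidableRel G.Adj]
    {x : ℝ} (hdeg : ∀ u, 0 < G.degree u) {W : Finset (Fin n)} {R N : ℕ} {M : Mem}
    (hG : HoldsGraph G x M) (hW : HoldsTarget W M) (hR : M.nat 7 0 0 = R)
    (hN : M.nat 8 0 0 = N) :
    Coupled (meanProg.exec M) ((iidDraws (indicatorLaw G x W R) N).map listMean)
      (meanTime n R N) fun M' y =>
      Frame [10, 11, 14, 15, 16, 17, 18, 19, 20, 21, 22, 23, 24, 25, 26, 27] [2, 4] M M' ∧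
        M'.nat 24 0 0 = M.nat 24 0 0 + 1 ∧ M'.real 2 (M.nat 24 0 0) = y ∧
        ∀ i, i ≠ M.nat 24 0 0 → M'.real 2 i = M.real 2 i := by
  have hF₁ : Frame [10, 11, 14, 15, 16, 17, 18, 19, 20, 21, 22, 23, 25, 26, 27] [4] M
    (M.writeNat 23 0 0 0) := (Frame.refl _ _ M).writeNat (by decide) 0 0 0
  have hinv := Coupled.loop (e := .scalar 8) (p := sampleProg)
    (κ := fun l => (indicatorLaw G x W R).map fun a => l ++ [a])
    (T := 100 + 200 * n + 50 * (n * n) + R * (1001 + 1000 * n)) (r := N)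
    (M := M.writeNat 23 0 0 0) (b := [])
    (inv := fun M' l =>
      Frame [10, 11, 14, 15, 16, 17, 18, 19, 20, 21, 22, 23, 25, 26, 27] [4] M M' ∧
      (M'.nat 23 0 0 : ℝ) = l.sum)
    (by rw [NExp.scalar_val, hF₁.nat 8 (by decide), hN])
    ⟨hF₁, by simp [Mem.writeNat_nat]⟩ (by
      rintro M' l ⟨h1, h2⟩
      refine Coupled.map _ ((sampleProg_spec hdeg (hG.frame h1 (by decide) (by decide))
        (W := W) (by unfold HoldsTarget; rw [h1.nat 13 (by decide)]; exact hW)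
        (by rw [h1.nat 7 (by decide), hR])).mono le_rfl
        fun M'' y h => ⟨h1.trans h.1, ?_⟩)
      rw [h.2, h2]; simp)
  rw [← iidDraws_eq_iterKernel] at hinv
  -- The support supplies the length N of the list, so that dividing the sum by the stored N gives
  -- the mean.
  refine Coupled.map _ ((Coupled.seq_setScalar (Coupled.seq_after hinv.with_support
    (T₂ := 30) ?_)).mono
    (by simp only [NExp.cost, NExp.scalar_cost, meanTime]; linarith) fun _ _ h => h)
  rintro M₂ l ⟨⟨hF₂, hsum⟩, hl⟩
  have hlen := length_of_mem_support_iidDraws _ _ l hl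
  refine (Coupled.seq_setReal (Coupled.setScalar le_rfl ?_)).mono
    (by simp [NExp.cost, RExp.cost, NExp.scalar_cost]) fun _ _ h => h
  have h24 : M₂.nat 24 0 0 = M.nat 24 0 0 := hF₂.nat 24 (by decide) ▸ rfl
  have h8 : M₂.nat 8 0 0 = N := by rw [hF₂.nat 8 (by decide), hN]
  have hF : Frame [10, 11, 14, 15, 16, 17, 18, 19, 20, 21, 22, 23, 24, 25, 26, 27] [2, 4] M M₂ :=
    hF₂.mono (by decide) (by decide)
  refine ⟨(hF.writeReal (by decide) _ _).writeNat (by decide) _ _ _, ?_, ?_, fun i hi => ?_⟩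
  · simp [Mem.writeNat_nat, Mem.writeReal_nat, NExp.val, NExp.scalar_val, h24]
  · simp [Mem.writeNat_real, Mem.writeReal_real, NExp.scalar_val, RExp.val, h24, hsum, h8,
      listMean, hlen]
  · simp [Mem.writeNat_real, Mem.writeReal_real, NExp.scalar_val, h24, hi, hF₂.real 2 (by decide)]

/-- The entries of `l` are stored in the real array `2`. -/
def HoldsList (l : List ℝ) (M : Mem) : Prop := ∀ i (h : i < l.length), M.real 2 i = l[i]

/-- As many means as the scalar `9` says. -/
def meansProg : Prog := .seq (.setScalar 24 (.const 0)) (.loop (.scalar 9) meanProg)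

theorem meansProg_spec {n : ℕ} [Nonempty (Fin n)] {G : SimpleGraph (Fin n)} [DecidableRel G.Adj]
    {x : ℝ} (hdeg : ∀ u, 0 < G.degree u) {W : Finset (Fin n)} {R N K : ℕ} {M : Mem}
    (hG : HoldsGraph G x M) (hW : HoldsTarget W M) (hR : M.nat 7 0 0 = R)
    (hN : M.nat 8 0 0 = N) (hK : M.nat 9 0 0 = K) :
    Coupled (meansProg.exec M)
      (iidDraws ((iidDraws (indicatorLaw G x W R) N).map listMean) K)
      (10 + K * (meanTime n R N + 1)) fun M' l =>
      Frame [10, 11, 14, 15, 16, 17, 18, 19, 20, 21, 22, 23, 24, 25, 26, 27] [2, 4] M M' ∧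
        HoldsList l M' ∧ l.length = K := by
  have hF₁ : Frame [10, 11, 14, 15, 16, 17, 18, 19, 20, 21, 22, 23, 24, 25, 26, 27] [2, 4] M
    (M.writeNat 24 0 0 0) := (Frame.refl _ _ M).writeNat (by decide) 0 0 0
  have hinv := Coupled.loop (e := .scalar 9) (p := meanProg)
    (κ := fun l => ((iidDraws (indicatorLaw G x W R) N).map listMean).map fun a => l ++ [a])
    (T := meanTime n R N) (r := K) (M := M.writeNat 24 0 0 0) (b := [])
    (inv := fun M' l =>
      Frame [10, 11, 14, 15, 16, 17, 18, 19, 20, 21, 22, 23, 24, 25, 26, 27] [2, 4] M M' ∧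
      M'.nat 24 0 0 = l.length ∧ HoldsList l M')
    (by rw [NExp.scalar_val, hF₁.nat 9 (by decide), hK])
    ⟨hF₁, by simp [Mem.writeNat_nat], fun i h => by simp at h⟩ (by
      rintro M' l ⟨h1, h2, h3⟩
      refine Coupled.map _ ((meanProg_spec hdeg (hG.frame h1 (by decide) (by decide))
        (W := W) (by unfold HoldsTarget; rw [h1.nat 13 (by decide)]; exact hW)
        (by rw [h1.nat 7 (by decide), hR]) (by rw [h1.nat 8 (by decide), hN])).mono le_rfl
        fun M'' y h => ⟨h1.trans h.1, by rw [h.2.1, h2]; simp, fun i hi => ?_⟩)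
      rw [h2] at h
      by_cases hil : i = l.length
      · subst hil; rw [h.2.2.1]; simp
      · rw [List.length_append, List.length_singleton] at hi
        rw [h.2.2.2 i hil, h3 i (by omega), List.getElem_append_left])
  rw [← iidDraws_eq_iterKernel] at hinv
  refine (Coupled.seq_setScalar hinv.with_support).mono
    (by simp only [NExp.cost, NExp.scalar_cost]; omega)
    fun M' l h => ⟨h.1.1, h.1.2.2, length_of_mem_support_iidDraws _ _ l h.2⟩

/-! ### Medians by counting. -/

/-- The test that `2 * #(<) ≤ T < 2 * #(≤)`, with the two counts in `28` and `29`. -/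
def rankTest (T : NExp) : Test :=
  .natLe (.add (.sub (.add (.scalar 28) (.scalar 28)) T)
    (.sub (.add T (.const 1)) (.add (.scalar 29) (.scalar 29)))) (.const 0)

/-- Count the entries of the real array `2` that are below, and at most, the entry at the index in
the scalar `26`. -/
def countProg : Prog :=
  .seq (.setScalar 28 (.const 0)) <| .seq (.setScalar 29 (.const 0)) <|
  .seq (.setScalar 27 (.const 0)) <| .loop (.scalar 9) <|
    .seq (.ite (.realLe (.cell 2 (.scalar 26)) (.cell 2 (.scalar 27))) .skip
      (.setScalar 28 (.add (.scalar 28) (.const 1)))) <|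
    .seq (.ite (.realLe (.cell 2 (.scalar 27)) (.cell 2 (.scalar 26)))
      (.setScalar 29 (.add (.scalar 29) (.const 1))) .skip) <|
    .setScalar 27 (.add (.scalar 27) (.const 1))

theorem countProg_spec {M : Mem} {l : List ℝ} (hl : HoldsList l M) (hK : M.nat 9 0 0 = l.length)
    {i : ℕ} (hi : i < l.length) (h26 : M.nat 26 0 0 = i) :
    Coupled (countProg.exec M) (PMF.pure ()) (20 + l.length * 70) fun M' _ =>
      Frame [27, 28, 29] [] M M' ∧ (M'.nat 28 0 0 = l.countP fun z => decide (z < l[i])) ∧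
        M'.nat 29 0 0 = l.countP fun z => decide (z ≤ l[i]) := by
  set inv : ℕ → Mem → Prop := fun j M' => Frame [27, 28, 29] [] M M' ∧ M'.nat 27 0 0 = j ∧
      (M'.nat 28 0 0 = (l.take j).countP fun z => decide (z < l[i])) ∧
      M'.nat 29 0 0 = (l.take j).countP fun z => decide (z ≤ l[i]) with hinv
  have hF₁ : Frame [27, 28, 29] [] M
      (((M.writeNat 28 0 0 0).writeNat 29 0 0 0).writeNat 27 0 0 0) :=
    (((Frame.refl _ _ M).writeNat (by decide) 0 0 0).writeNat (by decide) 0 0 0).writeNat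
      (by decide) 0 0 0
  refine (Coupled.seq_setScalar (Coupled.seq_setScalar (Coupled.seq_setScalar (Coupled.loop_range
    (r := l.length) (T := 65) (inv := inv) ?_ ?_ ?_)))).mono
      (by simp only [NExp.cost, NExp.scalar_cost]; omega) fun M' _ h => ⟨h.1, ?_, ?_⟩
  · rw [NExp.scalar_val]; exact (congrFun (congrFun (hF₁.nat 9 (by decide)) 0) 0).trans hK
  · exact ⟨hF₁, by simp [Mem.writeNat_nat, NExp.val], by simp [Mem.writeNat_nat, NExp.val],
      by simp [Mem.writeNat_nat, NExp.val]⟩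
  · rintro j hj M₁ ⟨h1, h2, h3, h4⟩
    have hval : ∀ M', Frame [27, 28, 29] [] M M' → M'.nat 27 0 0 = j →
        M'.real 2 (M'.nat 26 0 0) = l[i] ∧ M'.real 2 (M'.nat 27 0 0) = l[j] := by
      intro M' hF h27
      rw [hF.real 2 (by decide), hF.nat 26 (by decide), h26, h27]
      exact ⟨hl i hi, hl j hj⟩
    have htake : l.take (j + 1) = l.take j ++ [l[j]] := by rw [List.take_append_getElem]
    refine (Coupled.seq_det (T₁ := 25) (mid := fun M' => Frame [27, 28, 29] [] M M' ∧
      M'.nat 27 0 0 = j ∧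
      (M'.nat 28 0 0 = (l.take (j + 1)).countP fun z => decide (z < l[i])) ∧
      M'.nat 29 0 0 = (l.take j).countP fun z => decide (z ≤ l[i])) ?_
      (T₂ := 40) ?_).mono (by omega) fun _ _ h => h
    · refine (Coupled.ite (T := 10) ?_ ?_).mono
        (by simp [Test.cost, RExp.cost, NExp.scalar_cost]) fun _ _ h => h
      · intro h
        simp only [Test.holds, RExp.val, NExp.scalar_val, hval M₁ h1 h2] at h
        exact Coupled.skip (by omega) ⟨h1, h2, by
          rw [h3, htake, List.countP_append]; simp [h], h4⟩
      · intro h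
        simp only [Test.holds, RExp.val, NExp.scalar_val, hval M₁ h1 h2] at h
        refine Coupled.setScalar (by simp [NExp.cost, NExp.scalar_cost])
          ⟨h1.writeNat (by decide) _ _ _, ?_, ?_, ?_⟩
        · simp [Mem.writeNat_nat, h2]
        · rw [htake, List.countP_append]
          simp [Mem.writeNat_nat, NExp.val, NExp.scalar_val, h3, lt_of_not_ge h]
        · simp [Mem.writeNat_nat, h4]
    · rintro M₂ ⟨g1, g2, g3, g4⟩
      refine (Coupled.seq_det (T₁ := 25) (mid := fun M' => Frame [27, 28, 29] [] M M' ∧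
        M'.nat 27 0 0 = j ∧
        (M'.nat 28 0 0 = (l.take (j + 1)).countP fun z => decide (z < l[i])) ∧
        M'.nat 29 0 0 = (l.take (j + 1)).countP fun z => decide (z ≤ l[i])) ?_
        (T₂ := 15) ?_).mono (by omega) fun _ _ h => h
      · refine (Coupled.ite (T := 10) ?_ ?_).mono
          (by simp [Test.cost, RExp.cost, NExp.scalar_cost]) fun _ _ h => h
        · intro h
          simp only [Test.holds, RExp.val, NExp.scalar_val, hval M₂ g1 g2] at h
          refine Coupled.setScalar (by simp [NExp.cost, NExp.scalar_cost])
            ⟨g1.writeNat (by decide) _ _ _, ?_, ?_, ?_⟩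
          · simp [Mem.writeNat_nat, g2]
          · simp [Mem.writeNat_nat, g3]
          · rw [htake, List.countP_append]
            simp [Mem.writeNat_nat, NExp.val, NExp.scalar_val, g4, h]
        · intro h
          simp only [Test.holds, RExp.val, NExp.scalar_val, hval M₂ g1 g2] at h
          exact Coupled.skip (by omega) ⟨g1, g2, g3, by
            rw [g4, htake, List.countP_append]; simp [lt_of_not_ge h]⟩
      · rintro M₃ ⟨k1, k2, k3, k4⟩
        refine Coupled.setScalar (by simp [NExp.cost, NExp.scalar_cost])
          ⟨k1.writeNat (by decide) _ _ _, ?_, ?_, ?_⟩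
        · simp [Mem.writeNat_nat, NExp.val, NExp.scalar_val, k2]
        · simp [Mem.writeNat_nat, k3]
        · simp [Mem.writeNat_nat, k4]
  · rw [h.2.2.1, List.take_length]
  · rw [h.2.2.2, List.take_length]

/-- The median of the entries of the real array `2`, stored in the real array `5` at index `2`. -/
def medianProg : Prog :=
  .seq (.setScalar 26 (.const 0)) <|
  .seq (.loop (.scalar 9) <| .seq countProg <|
    .seq (.ite (rankTest (.sub (.scalar 9) (.const 1)))
      (.setReal 5 (.const 0) (.cell 2 (.scalar 26))) .skip) <|
    .seq (.ite (rankTest (.scalar 9)) (.setReal 5 (.const 1) (.cell 2 (.scalar 26))) .skip) <|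
    .setScalar 26 (.add (.scalar 26) (.const 1))) <|
  .setReal 5 (.const 2) (.div (.add (.cell 5 (.const 0)) (.cell 5 (.const 1)))
    (.ofNat (.const 2)))

/-- For naturals a ≤ t/2 < b means 2a ≤ t < 2b, so the index t/2 is handled without division and
both inequalities become vanishing truncated differences. -/
theorem rankTest_iff {l : List ℝ} {T : NExp} {M : Mem} {t i : ℕ} (hi : i < l.length)
    (ht : t / 2 < l.length) (hT : T.val M = t)
    (h28 : M.nat 28 0 0 = l.countP fun z => decide (z < l[i]))
    (h29 : M.nat 29 0 0 = l.countP fun z => decide (z ≤ l[i])) :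
    (rankTest T).holds M ↔ orderStat l (t / 2) = l[i] := by
  rw [eq_orderStat_iff ht, rankTest]
  simp only [Test.holds, NExp.val, NExp.scalar_val, hT, h28, h29]
  omega

theorem rankTest_step {l : List ℝ} {M : Mem} (hl : HoldsList l M) {t : ℕ} (ht : t / 2 < l.length)
    {T : NExp} (hT : T.val M = t) {i c : ℕ} (hi : i < l.length) (h26 : M.nat 26 0 0 = i)
    (h28 : M.nat 28 0 0 = l.countP fun z => decide (z < l[i]))
    (h29 : M.nat 29 0 0 = l.countP fun z => decide (z ≤ l[i]))
    (h : ∀ j (hj : j < l.length), j < i → l[j] = orderStat l (t / 2) →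
      M.real 5 c = orderStat l (t / 2)) :
    Coupled ((Prog.ite (rankTest T) (.setReal 5 (.const c) (.cell 2 (.scalar 26))) .skip).exec M)
      (PMF.pure ()) (50 + 2 * T.cost) fun M' _ => Frame [] [5] M M' ∧
        (∀ c', c' ≠ c → M'.real 5 c' = M.real 5 c') ∧
        ∀ j (hj : j < l.length), j < i + 1 → l[j] = orderStat l (t / 2) →
          M'.real 5 c = orderStat l (t / 2) := by
  refine (Coupled.ite (T := 10) ?_ ?_).mono
    (by simp only [Test.cost, rankTest, NExp.cost, NExp.scalar_cost]; omega) fun _ _ h => h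
  · intro ht'
    rw [rankTest_iff hi ht hT h28 h29] at ht'
    refine Coupled.setReal (by simp [NExp.cost, RExp.cost, NExp.scalar_cost])
      ⟨(Frame.refl _ _ M).writeReal (by decide) _ _, fun c' hc' => ?_, fun j hj hji h' => ?_⟩
    · simp [Mem.writeReal_real, NExp.val, hc']
    · simp [Mem.writeReal_real, NExp.val, NExp.scalar_val, RExp.val, h26, hl i hi, ht']
  · intro ht'
    rw [rankTest_iff hi ht hT h28 h29] at ht'
    refine Coupled.skip (by omega) ⟨Frame.refl _ _ M, fun _ _ => rfl, fun j hj hji h' => ?_⟩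
    rcases Nat.lt_succ_iff_lt_or_eq.1 hji with hlt | rfl
    · exact h j hj hlt h'
    · exact absurd h'.symm ht'

/-- Every order statistic is the value of some entry, so testing all entries finds it; tied entries
write the same value. The tests with t = K − 1 and t = K yield the two middle indices. -/
theorem medianProg_spec {M : Mem} {l : List ℝ} (hl : HoldsList l M)
    (hK : M.nat 9 0 0 = l.length) (hpos : 0 < l.length) :
    Coupled (medianProg.exec M) (PMF.pure ()) (50 + l.length * (200 + 70 * l.length)) fun M' _ =>
      Frame [26, 27, 28, 29] [5] M M' ∧ M'.real 5 2 = listMedian l := by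
  set o : ℕ → ℝ := fun t => orderStat l (t / 2) with ho
  have hF₁ : Frame [26, 27, 28, 29] [5] M (M.writeNat 26 0 0 0) :=
    (Frame.refl _ _ M).writeNat (by decide) 0 0 0
  refine (Coupled.seq_setScalar (Coupled.seq_det (Coupled.loop_range
    (r := l.length) (T := 190 + 70 * l.length) (inv := fun i M' =>
      Frame [26, 27, 28, 29] [5] M M' ∧ M'.nat 26 0 0 = i ∧
      (∀ j (hj : j < l.length), j < i → l[j] = o (l.length - 1) →
        M'.real 5 0 = o (l.length - 1)) ∧
      ∀ j (hj : j < l.length), j < i → l[j] = o l.length → M'.real 5 1 = o l.length)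
      ?_ ?_ ?_) (T₂ := 10) ?_)).mono
      (by simp only [NExp.cost, NExp.scalar_cost]; nlinarith) fun M' _ h => h
  · rw [NExp.scalar_val]; exact (congrFun (congrFun (hF₁.nat 9 (by decide)) 0) 0).trans hK
  · exact ⟨hF₁, by simp [Mem.writeNat_nat, NExp.val], by simp, by simp⟩
  · rintro i hi M₁ ⟨h1, h2, h3, h4⟩
    have hl' : ∀ {M'}, Frame [26, 27, 28, 29] [5] M M' → HoldsList l M' := fun hF j hj => by
      rw [hF.real 2 (by decide)]; exact hl j hj
    have hK' : ∀ {M'}, Frame [26, 27, 28, 29] [5] M M' → M'.nat 9 0 0 = l.length := fun hF => by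
      rw [hF.nat 9 (by decide), hK]
    refine (Coupled.seq_det (countProg_spec (hl' h1) (hK' h1) hi h2) (T₂ := 160) ?_).mono
      (by omega) fun _ _ h => h
    rintro M₂ ⟨hF₂', h28, h29⟩
    have hF₂ := h1.trans (hF₂'.mono (s' := [26, 27, 28, 29]) (t' := [5]) (by decide) (by decide))
    have h26₂ : M₂.nat 26 0 0 = i := by rw [hF₂'.nat 26 (by decide), h2]
    refine (Coupled.seq_det (rankTest_step (hl' hF₂) (t := l.length - 1) (c := 0) (by omega)
      (by simp only [NExp.val, NExp.scalar_val, hK' hF₂]) hi h26₂ h28 h29 ?_) (T₂ := 90) ?_).mono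
      (by simp only [NExp.cost, NExp.scalar_cost]; omega) fun _ _ h => h
    · rw [hF₂'.real 5 (by decide)]; exact h3
    rintro M₃ ⟨hF₃', hne₃, h3₃⟩
    have hF₃ := hF₂.trans (hF₃'.mono (s' := [26, 27, 28, 29]) (t' := [5]) (by decide) (by decide))
    have h26₃ : M₃.nat 26 0 0 = i := by rw [hF₃'.nat 26 (by decide), h26₂]
    refine (Coupled.seq_det (rankTest_step (hl' hF₃) (t := l.length) (c := 1) (by omega)
      (by simp only [NExp.scalar_val, hK' hF₃]) hi h26₃ (by rw [hF₃'.nat 28 (by decide), h28])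
      (by rw [hF₃'.nat 29 (by decide), h29]) ?_) (T₂ := 10) ?_).mono
      (by simp only [NExp.scalar_cost]; omega) fun _ _ h => h
    · rw [hne₃ 1 (by decide), hF₂'.real 5 (by decide)]; exact h4
    rintro M₄ ⟨hF₄', hne₄, h4₄⟩
    have hF₄ := hF₃.trans (hF₄'.mono (s' := [26, 27, 28, 29]) (t' := [5]) (by decide) (by decide))
    refine Coupled.setScalar (by simp [NExp.cost, NExp.scalar_cost])
      ⟨hF₄.writeNat (by decide) _ _ _, ?_, ?_, ?_⟩
    · simp [Mem.writeNat_nat, NExp.val, NExp.scalar_val, hF₄'.nat 26 (by decide), h26₃]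
    · rw [Mem.writeNat_real, hne₄ 0 (by decide)]; exact h3₃
    · rw [Mem.writeNat_real]; exact h4₄
  · rintro M₅ ⟨h1, -, h3, h4⟩
    refine Coupled.setReal (by simp [NExp.cost, RExp.cost]) ⟨h1.writeReal (by decide) _ _, ?_⟩
    -- The loop invariant is conditional on a hit; this supplies one for each of the two order
    -- statistics.
    have key : ∀ t, t / 2 < l.length → ∃ j, ∃ hj : j < l.length, l[j] = o t := fun t ht =>
      List.getElem_of_mem (orderStat_mem ht)
    obtain ⟨j, hj, hj'⟩ := key (l.length - 1) (by omega)
    obtain ⟨k, hk, hk'⟩ := key l.length (by omega)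
    simp only [Mem.writeReal_real, NExp.val, RExp.val, and_self, if_true, h3 j hj hj hj',
      h4 k hk hk hk', listMedian_eq, ho, Nat.cast_ofNat]

/-! ### The sampling scheme as a program -/

/-- The expression `c * e`. -/
def NExp.times (e : NExp) : ℕ → NExp
  | 0 => .const 0
  | c + 1 => .add (e.times c) e

theorem NExp.times_val (M : Mem) (e : NExp) (c : ℕ) : (e.times c).val M = c * e.val M := by
  induction c with
  | zero => simp [times, val]
  | succ c ih => rw [times, val, ih]; ring

theorem NExp.times_cost (e : NExp) (c : ℕ) : (e.times c).cost = c * (e.cost + 1) + 1 := by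
  induction c with
  | zero => simp [times, cost]
  | succ c ih => rw [times, cost, ih]; ring

/-- The expression `e ^ c`. -/
def RExp.power (e : RExp) : ℕ → RExp
  | 0 => .ofNat (.const 1)
  | c + 1 => .mul (e.power c) e

theorem RExp.power_val (M : Mem) (e : RExp) (c : ℕ) : (e.power c).val M = e.val M ^ c := by
  induction c with
  | zero => simp [power, val, NExp.val]
  | succ c ih => rw [power, val, ih, pow_succ]

theorem RExp.power_cost (e : RExp) (c : ℕ) : (e.power c).cost = c * (e.cost + 1) + 2 := by
  induction c with
  | zero => simp [power, cost, NExp.cost]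
  | succ c ih => rw [power, cost, ih]; ring

/-- The real constant `c`. -/
def RExp.const (c : ℕ) : RExp := .ofNat (.const c)

theorem RExp.const_val (M : Mem) (c : ℕ) : (RExp.const c).val M = c := rfl

theorem RExp.const_cost (c : ℕ) : (RExp.const c).cost = 2 := rfl

/-- Store the degrees in array `4`, the maximum degree in `5` and the sum of the degrees in `6`. -/
def degreeProg : Prog :=
  .seq (.setScalar 26 (.const 0)) <| .seq (.setScalar 5 (.const 0)) <|
  .seq (.setScalar 6 (.const 0)) <| .loop (.scalar 0) <|
    .seq (sumLoop 14 18 (.scalar 0) (.cell 1 (.scalar 26) (.scalar 18))) <|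
    .seq (.setNat 4 (.scalar 26) (.const 0) (.scalar 14)) <|
    .seq (.setScalar 5 (.add (.scalar 5) (.sub (.scalar 14) (.scalar 5)))) <|
    .seq (.setScalar 6 (.add (.scalar 6) (.scalar 14))) <|
    .setScalar 26 (.add (.scalar 26) (.const 1))

/-- The maximum is accumulated as a + (b − a) with truncated difference, and the handshake lemma
turns the degree sum into 2m. -/
theorem degreeProg_spec {n : ℕ} {G : SimpleGraph (Fin n)} [DecidableRel G.Adj] {M : Mem}
    (hn : M.nat 0 0 0 = n) (hadj : ∀ i j : Fin n, M.nat 1 i j = if G.Adj i j then 1 else 0) :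
    Coupled (degreeProg.exec M) (PMF.pure ()) (20 + n * (80 + 30 * n)) fun M' _ =>
      Frame [4, 5, 6, 14, 18, 26] [] M M' ∧ (∀ i : Fin n, M'.nat 4 i 0 = G.degree i) ∧
        M'.nat 5 0 0 = G.maxDegree ∧ M'.nat 6 0 0 = 2 * G.edgeFinset.card := by
  set d : ℕ → ℕ := fun i => if h : i < n then G.degree ⟨i, h⟩ else 0 with hd
  have hdi : ∀ i : Fin n, d i = G.degree i := fun i => by simp [hd]
  have hF₀ : Frame [4, 5, 6, 14, 18, 26] [] M
      (((M.writeNat 26 0 0 0).writeNat 5 0 0 0).writeNat 6 0 0 0) :=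
    (((Frame.refl _ _ M).writeNat (by decide) 0 0 0).writeNat (by decide) 0 0 0).writeNat
      (by decide) 0 0 0
  refine Coupled.mono (Coupled.seq_setScalar (Coupled.seq_setScalar (Coupled.seq_setScalar
    (Coupled.loop_range (r := n) (T := 75 + 30 * n)
      (inv := fun i M' => Frame [4, 5, 6, 14, 18, 26] [] M M' ∧ M'.nat 26 0 0 = i ∧
        (∀ j < i, M'.nat 4 j 0 = d j) ∧ (∀ j < i, d j ≤ M'.nat 5 0 0) ∧
        M'.nat 5 0 0 ≤ G.maxDegree ∧ M'.nat 6 0 0 = ∑ j ∈ Finset.range i, d j) ?_ ?_ ?_))))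
    (by simp only [NExp.cost, NExp.scalar_cost]; nlinarith) ?_
  · exact (congrFun (congrFun (hF₀.nat 0 (by decide)) 0) 0).trans hn
  · exact ⟨hF₀, by simp [Mem.writeNat_nat, NExp.val], by simp, by simp,
      by simp [Mem.writeNat_nat, NExp.val], by simp [Mem.writeNat_nat, NExp.val]⟩
  · rintro i hi M₁ ⟨h1, h2, h3, h4, h5, h6⟩
    have hdeg : d i = ∑ j, if G.Adj ⟨i, hi⟩ j then 1 else 0 := by
      simp only [hd, hi, dif_pos, ← SimpleGraph.card_neighborFinset_eq_degree,
        SimpleGraph.neighborFinset_eq_filter, Finset.card_filter]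
    refine (Coupled.seq_det (sumLoop_spec (acc := 14) (ctr := 18) (by decide) (bd := .scalar 0)
      (B := n) (fun M' h => ?_) (fun j => if G.Adj ⟨i, hi⟩ j then 1 else 0) ?_)
      (T₂ := 60) ?_).mono (by simp only [NExp.cost, NExp.scalar_cost]; omega) fun _ _ h => h
    · rw [NExp.scalar_val, h.nat 0 (by decide), h1.nat 0 (by decide), hn]
    · intro M' h j hj
      simp only [NExp.val, NExp.scalar_val]
      rw [hj, h.nat 26 (by decide), h2, h.nat 1 (by decide), h1.nat 1 (by decide)]
      exact hadj ⟨i, hi⟩ j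
    · rintro M₂ ⟨hF₂, h14⟩
      rw [← hdeg] at h14
      have g2 : M₂.nat 26 0 0 = i := by rw [hF₂.nat 26 (by decide), h2]
      have g4 : M₂.nat 4 = M₁.nat 4 := hF₂.nat 4 (by decide)
      have g5 : M₂.nat 5 = M₁.nat 5 := hF₂.nat 5 (by decide)
      have g6 : M₂.nat 6 = M₁.nat 6 := hF₂.nat 6 (by decide)
      have hle : d i ≤ G.maxDegree := by
        rw [hdi ⟨i, hi⟩]; exact G.degree_le_maxDegree _
      refine (Coupled.seq_setNat (Coupled.seq_setScalar (Coupled.seq_setScalar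
        (Coupled.setScalar le_rfl ?_)))).mono
        (by simp [NExp.cost, NExp.scalar_cost]) fun _ _ h => h
      refine ⟨((((h1.trans (hF₂.mono (by decide) (by decide))).writeNat (by decide) _ _ _).writeNat
        (by decide) _ _ _).writeNat (by decide) _ _ _).writeNat (by decide) _ _ _,
        ?_, ?_, ?_, ?_, ?_⟩
      · simp [Mem.writeNat_nat, NExp.val, NExp.scalar_val, g2]
      · intro j hj
        by_cases hji : j = i
        · simp [Mem.writeNat_nat, NExp.val, NExp.scalar_val, g2, h14, hji]
        · simp [Mem.writeNat_nat, NExp.val, NExp.scalar_val, g2, g4, hji, h3 j (by omega)]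
      · intro j hj
        simp only [Mem.writeNat_nat, NExp.val, NExp.scalar_val, h14, g5]
        by_cases hji : j = i
        · subst hji; simp; omega
        · have := h4 j (by omega)
          simp; omega
      · simp only [Mem.writeNat_nat, NExp.val, NExp.scalar_val, h14, g5]
        simp; omega
      · simp [Mem.writeNat_nat, NExp.val, NExp.scalar_val, h14, g6, h6, Finset.sum_range_succ]
  · rintro M' - ⟨h1, -, h3, h4, h5, h6⟩
    refine ⟨h1, fun i => by rw [h3 i i.2, hdi], le_antisymm h5 ?_, ?_⟩
    · exact G.maxDegree_le_of_forall_degree_le _ fun i => hdi i ▸ h4 i i.2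
    · rw [h6, Finset.sum_range, ← G.sum_degrees_eq_twice_card_edges]
      exact Finset.sum_congr rfl fun i _ => hdi i

/-- The number of runs per sample mean. -/
def runCount (S ε : ℝ) : ℕ := 20 * ⌈S * (ε ^ 2)⁻¹ + 1⌉₊

/-- The number of sample means. -/
def meanCount (η : ℝ) : ℕ := 7 * ⌈Real.log η⁻¹⌉₊ + 1

/-- The bound for the mixing time in terms of the stored parameters. -/
def mixingExp : RExp :=
  let x : RExp := .cell 0 (.const 0)
  let m : RExp := .div (.ofNat (.scalar 6)) (.const 2)
  let δ : RExp := .div (.cell 3 (.const 1)) (.mul (.const 16) (.cell 3 (.const 0)))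
  .mul (.mul (.mul (.mul (.mul (.div (.const 1) (.mul (.const 2) x))
    (.sub (.log (.div (.const 8) x)) (.div (.log δ) m)))
    (.add (.const 3) (.div (.const 1) (.mul m x)))) (.ofNat (.scalar 5)))
    (RExp.power (.ofNat (.scalar 0)) 6)) (m.power 2)

/-- Compute the numbers of steps, runs and means in the scalars `7`, `8` and `9`. -/
def countsProg : Prog :=
  .seq (.setCeil 7 (.const 0) (.const 0) mixingExp) <|
  .seq (.setCeil 8 (.const 0) (.const 0) (.add (.mul (.cell 3 (.const 0))
    (.div (.const 1) (RExp.power (.cell 3 (.const 1)) 2))) (.const 1))) <|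
  .seq (.setScalar 8 (NExp.times (.scalar 8) 20)) <|
  .seq (.setCeil 9 (.const 0) (.const 0) (.log (.div (.const 1) (.cell 3 (.const 2))))) <|
  .setScalar 9 (.add (NExp.times (.scalar 9) 7) (.const 1))

theorem Coupled.seq_setCeil {β : Type*} {a : ℕ} {i j : NExp} {e : RExp} {q : Prog} {M : Mem}
    {μ : PMF β} {T : ℕ} {post : Mem → β → Prop} {c : ℕ} (hc : ⌈e.val M⌉₊ = c)
    (h : Coupled (q.exec (M.writeNat a (i.val M) (j.val M) c)) μ T post) :
    Coupled ((Prog.seq (Prog.setCeil a i j e) q).exec M) μ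
      (i.cost + j.cost + e.cost + c + 1 + T) post :=
  Coupled.seq_det (mid := fun M' => M' = M.writeNat a (i.val M) (j.val M) c)
    (Coupled.setCeil (by rw [hc]) (by rw [hc])) fun _ hM => hM ▸ h

theorem countsProg_spec {n : ℕ} {G : SimpleGraph (Fin n)} [DecidableRel G.Adj] {M : Mem}
    {x S ε η : ℝ} (hn : M.nat 0 0 0 = n) (hx : M.real 0 0 = x) (hS : M.real 3 0 = S)
    (hε : M.real 3 1 = ε) (hη : M.real 3 2 = η) (h5 : M.nat 5 0 0 = G.maxDegree)
    (h6 : M.nat 6 0 0 = 2 * G.edgeFinset.card) {R : ℕ}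
    (hR : ⌈mixingBound G x (ε / (16 * S))⌉₊ = R) :
    Coupled (countsProg.exec M) (PMF.pure ()) (300 + R + runCount S ε + meanCount η) fun M' _ =>
      Frame [7, 8, 9] [] M M' ∧ M'.nat 7 0 0 = R ∧ M'.nat 8 0 0 = runCount S ε ∧
        M'.nat 9 0 0 = meanCount η := by
  have hm : ((2 * G.edgeFinset.card : ℕ) : ℝ) / (2 : ℕ) = G.edgeFinset.card := by
    push_cast; ring
  refine Coupled.mono (Coupled.seq_setCeil (c := R) ?_ (Coupled.seq_setCeil
    (c := ⌈S * (ε ^ 2)⁻¹ + 1⌉₊) ?_ (Coupled.seq_setScalar (Coupled.seq_setCeil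
    (c := ⌈Real.log η⁻¹⌉₊) ?_ (Coupled.setScalar le_rfl ?_))))) ?_ fun _ _ h => h
  · rw [← hR]
    congr 1
    simp only [mixingExp, RExp.val, RExp.const_val, RExp.power_val, NExp.val, NExp.scalar_val, hx,
      hS, hε, h5, h6, hn, hm, mixingBound, Fintype.card_fin]
    norm_num
  · congr 1
    simp only [RExp.val, RExp.const_val, RExp.power_val, NExp.val, Mem.writeNat_real, hS, hε]
    norm_num
  · congr 1
    simp only [RExp.val, RExp.const_val, NExp.val, Mem.writeNat_real, hη]
    norm_num
  · refine ⟨((((((Frame.refl _ _ M).writeNat (by decide) _ _ _).writeNat (by decide) _ _ _).writeNat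
      (by decide) _ _ _).writeNat (by decide) _ _ _).writeNat (by decide) _ _ _), ?_, ?_, ?_⟩
    · simp [Mem.writeNat_nat, NExp.val]
    · simp [Mem.writeNat_nat, NExp.val, NExp.scalar_val, NExp.times_val, runCount]
    · simp [Mem.writeNat_nat, NExp.val, NExp.scalar_val, NExp.times_val, meanCount]
  · simp only [mixingExp, NExp.cost, RExp.cost, RExp.const_cost, RExp.power_cost, NExp.times_cost,
      NExp.scalar_cost, runCount, meanCount]
    omega

/-- The sampling scheme for the event `∂A = W`, with flags of `W` in array `13` and `S, ε, η` in
the real array `3`; the result is stored in the real array `5` at index `2`. -/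
def schemeProg : Prog :=
  .seq degreeProg <| .seq countsProg <| .seq meansProg medianProg

/-- A bound for the number of steps of `schemeProg`. -/
def schemeTime (n R N K : ℕ) : ℕ :=
  400 + n * (80 + 30 * n) + R + N + K + K * (meanTime n R N + 1) + K * (200 + 70 * K)

/-- Nothing is assumed about the working arrays, which the subroutines initialise themselves, so the
program may be run twice on the same memory. -/
theorem schemeProg_spec {n : ℕ} [Nonempty (Fin n)] {G : SimpleGraph (Fin n)} [DecidableRel G.Adj]
    (hdeg : ∀ u, 0 < G.degree u) {W : Finset (Fin n)} {M : Mem} {x S ε η : ℝ}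
    (hn : M.nat 0 0 0 = n) (hadj : ∀ i j : Fin n, M.nat 1 i j = if G.Adj i j then 1 else 0)
    (hW : HoldsTarget W M) (hx : M.real 0 0 = x) (hS : M.real 3 0 = S)
    (hε : M.real 3 1 = ε) (hη : M.real 3 2 = η) :
    Coupled (schemeProg.exec M) (samplingScheme G x (graphsWithBoundary G W) S ε η ∅)
      (schemeTime n ⌈mixingBound G x (ε / (16 * S))⌉₊ (runCount S ε) (meanCount η)) fun M' y =>
      Frame [4, 5, 6, 7, 8, 9, 10, 11, 14, 15, 16, 17, 18, 19, 20, 21, 22, 23, 24, 25, 26, 27, 28,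
        29] [2, 4, 5] M M' ∧ M'.real 5 2 = y := by
  set R := ⌈mixingBound G x (ε / (16 * S))⌉₊ with hR
  set N := runCount S ε with hN
  set K := meanCount η with hK
  refine (Coupled.seq_det (degreeProg_spec hn hadj) (T₂ := 375 + R + N + K +
    K * (meanTime n R N + 1) + K * (200 + 70 * K)) ?_).mono (by rw [schemeTime]; omega)
    fun _ _ h => h
  rintro M₁ ⟨hF₁, h4, h5, h6⟩
  refine (Coupled.seq_det (countsProg_spec (G := G) (x := x) (S := S) (ε := ε) (η := η)
    (by rw [hF₁.nat 0 (by decide), hn])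
    (by rw [hF₁.real 0 (by decide), hx]) (by rw [hF₁.real 3 (by decide), hS])
    (by rw [hF₁.real 3 (by decide), hε]) (by rw [hF₁.real 3 (by decide), hη]) h5 h6 hR.symm)
    (T₂ := 60 + K * (meanTime n R N + 1) + K * (200 + 70 * K)) ?_).mono (by omega) fun _ _ h => h
  rintro M₂ ⟨hF₂', h7, h8, h9⟩
  rw [← hN] at h8
  rw [← hK] at h9
  have hF₂ : Frame [4, 5, 6, 7, 8, 9, 14, 18, 26] [] M M₂ :=
    (hF₁.mono (by decide) (by decide)).trans (hF₂'.mono (by decide) (by decide))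
  have hG : HoldsGraph G x M₂ :=
    ⟨by rw [hF₂.nat 0 (by decide), hn], by rw [hF₂.nat 1 (by decide)]; exact hadj,
      by rw [hF₂'.nat 4 (by decide)]; exact h4, by rw [hF₂.real 0 (by decide), hx]⟩
  have hW₂ : HoldsTarget W M₂ := by
    unfold HoldsTarget; rw [hF₂.nat 13 (by decide)]; exact hW
  refine Coupled.map _ ((Coupled.seq_after (meansProg_spec hdeg hG hW₂ h7 h8 h9)
    (T₂ := 50 + K * (200 + 70 * K)) ?_).mono (by omega) fun _ _ h => h)
  rintro M₃ l ⟨hF₃, hl, hlen⟩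
  rw [← hlen]
  refine (medianProg_spec hl ?_ (by rw [hlen, hK, meanCount]; omega)).mono le_rfl
    fun M₄ _ h => ⟨((hF₂.mono (by decide) (by decide)).trans
      (hF₃.mono (by decide) (by decide))).trans (h.1.mono (by decide) (by decide)), h.2⟩
  rw [hF₃.nat 9 (by decide), h9, hlen]

/-! ### The approximation programs -/

/-- The parameter `S` of the scheme for `𝒞_uv`. -/
def pairParam (n : ℕ) (x : ℝ) (k : ℕ) : ℝ := (n : ℝ) * ((n : ℝ) + 1) * (x ^ k)⁻¹ / 2

/-- The sampling scheme for `𝒞_uv` with accuracy `ε / c` and failure probability `η / d`. -/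
def pairScheme (k c d : ℕ) : Prog :=
  .seq (.setReal 3 (.const 0) (.div (.mul (.mul (.ofNat (.scalar 0))
    (.add (.ofNat (.scalar 0)) (.const 1)))
    (.div (.const 1) (RExp.power (.cell 0 (.const 0)) k))) (.const 2))) <|
  .seq (.setReal 3 (.const 1) (.div (.cell 0 (.const 1)) (.const c))) <|
  .seq (.setReal 3 (.const 2) (.div (.cell 0 (.const 2)) (.const d))) <|
  .seq (.setNat 13 (.const 0) (.scalar 2) (.const 1)) <|
  .seq (.setNat 13 (.const 0) (.scalar 3) (.const 1)) schemeProg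

/-- A bound for the number of steps of the sampling scheme. -/
def samplingTime {n : ℕ} (G : SimpleGraph (Fin n)) [DecidableRel G.Adj] (x S ε η : ℝ) : ℕ :=
  schemeTime n ⌈mixingBound G x (ε / (16 * S))⌉₊ (runCount S ε) (meanCount η)

/-- Besides the estimate, the conclusion records that the input and the rescaled accuracies survive,
as a second run of the scheme needs them. -/
theorem pairScheme_spec {n : ℕ} [Nonempty (Fin n)] {G : SimpleGraph (Fin n)} [DecidableRel G.Adj]
    (hdeg : ∀ u, 0 < G.degree u) {x ε η : ℝ} (u v : Fin n) (k c d : ℕ) :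
    Coupled ((pairScheme k c d).exec (inputMem G x u v ε η))
      (samplingScheme G x (graphsWithBoundary G {u, v}) (pairParam n x k) (ε / c) (η / d) ∅)
      (100 + 10 * k + samplingTime G x (pairParam n x k) (ε / c) (η / d)) fun M' y =>
      M'.real 5 2 = y ∧ M'.nat 0 0 0 = n ∧
        (∀ i j : Fin n, M'.nat 1 i j = if G.Adj i j then 1 else 0) ∧ M'.nat 2 0 0 = u ∧
        M'.nat 3 0 0 = v ∧ HoldsTarget {u, v} M' ∧ M'.real 0 0 = x ∧ M'.real 3 1 = ε / c ∧
        M'.real 3 2 = η / d := by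
  set M := inputMem G x u v ε η with hM
  have hadj : ∀ i j : Fin n, M.nat 1 i j = if G.Adj i j then 1 else 0 := fun i j => by
    simp [hM, inputMem]
  have h0 : M.nat 0 0 0 = n := by simp [hM, inputMem]
  have h2 : M.nat 2 0 0 = u := by simp [hM, inputMem]
  have h3 : M.nat 3 0 0 = v := by simp [hM, inputMem]
  have h13 : ∀ i j, M.nat 13 i j = 0 := fun i j => by simp [hM, inputMem]
  have g0 : M.real 0 0 = x := rfl
  have g1 : M.real 0 1 = ε := rfl
  have g2 : M.real 0 2 = η := rfl
  refine (Coupled.seq_setReal (Coupled.seq_setReal (Coupled.seq_setReal (Coupled.seq_setNat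
    (Coupled.seq_setNat (T := samplingTime G x (pairParam n x k) (ε / c) (η / d)) ?_))))).mono
    (by simp only [NExp.cost, RExp.cost, RExp.const_cost, RExp.power_cost, NExp.scalar_cost]; omega)
    fun _ _ h => h
  set M₅ := (((((M.writeReal _ _ _).writeReal _ _ _).writeReal _ _ _).writeNat _ _ _ _).writeNat
    _ _ _ _) with hM₅
  have hF : Frame [13] [3] M M₅ := (((((Frame.refl _ _ M).writeReal (by decide) _ _).writeReal
    (by decide) _ _).writeReal (by decide) _ _).writeNat (by decide) _ _ _).writeNat
    (by decide) _ _ _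
  have hn : M₅.nat 0 0 0 = n := by rw [hF.nat 0 (by decide), h0]
  have hadj' : ∀ i j : Fin n, M₅.nat 1 i j = if G.Adj i j then 1 else 0 := by
    rw [hF.nat 1 (by decide)]; exact hadj
  have hW : HoldsTarget {u, v} M₅ := fun j => by
    simp only [hM₅, Mem.writeNat_nat, Mem.writeReal_nat, NExp.val, NExp.scalar_val, h2, h3, h13]
    simp only [Finset.mem_insert, Finset.mem_singleton, Fin.ext_iff, true_and]
    split_ifs <;> first | rfl | omega
  have hx : M₅.real 0 0 = x := by rw [hF.real 0 (by decide), g0]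
  have hS : M₅.real 3 0 = pairParam n x k := by
    simp [hM₅, Mem.writeNat_real, Mem.writeReal_real, NExp.val, RExp.val, RExp.const_val,
      RExp.power_val, NExp.scalar_val, h0, g0, pairParam]
  have hε : M₅.real 3 1 = ε / c := by
    simp [hM₅, Mem.writeNat_real, Mem.writeReal_real, NExp.val, RExp.val, RExp.const_val, g1]
  have hη : M₅.real 3 2 = η / d := by
    simp [hM₅, Mem.writeNat_real, Mem.writeReal_real, NExp.val, RExp.val, RExp.const_val, g2]
  refine (schemeProg_spec hdeg hn hadj' hW hx hS hε hη).mono le_rfl fun M' y h =>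
    ⟨h.2, ?_, ?_, ?_, ?_, ?_, ?_, ?_, ?_⟩
  · rw [h.1.nat 0 (by decide), hn]
  · rw [h.1.nat 1 (by decide)]; exact hadj'
  · rw [h.1.nat 2 (by decide), hF.nat 2 (by decide), h2]
  · rw [h.1.nat 3 (by decide), hF.nat 3 (by decide), h3]
  · unfold HoldsTarget; rw [h.1.nat 13 (by decide)]; exact hW
  · rw [h.1.real 0 (by decide), hx]
  · rw [h.1.real 3 (by decide), hε]
  · rw [h.1.real 3 (by decide), hη]

/-- The program for `π(𝒞_uv)`. -/
def pairProg (k : ℕ) : Prog :=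
  .seq (pairScheme k 1 1) (.setReal 1 (.const 0) (.cell 5 (.const 2)))

theorem pairProg_spec {n : ℕ} [Nonempty (Fin n)] {G : SimpleGraph (Fin n)} [DecidableRel G.Adj]
    (hdeg : ∀ u, 0 < G.degree u) {x ε η : ℝ} (u v : Fin n) (k : ℕ) :
    Coupled ((pairProg k).exec (inputMem G x u v ε η))
      (samplingScheme G x (graphsWithBoundary G {u, v}) (pairParam n x k) ε η ∅)
      (110 + 10 * k + samplingTime G x (pairParam n x k) ε η) fun M' y => M'.real 1 0 = y := by
  have h := pairScheme_spec (x := x) (ε := ε) (η := η) hdeg u v k 1 1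
  simp only [Nat.cast_one, div_one] at h
  refine (Coupled.seq_after h (T₂ := 10) fun M' y h' => Coupled.setReal
    (by simp [NExp.cost, RExp.cost]) ?_).mono (by omega) fun _ _ h => h
  simp [Mem.writeReal_real, NExp.val, RExp.val, h'.1]

/-- The program for the two-point function. -/
def corrProg (k : ℕ) : Prog :=
  .seq (pairScheme k 4 2) <| .seq (.setReal 6 (.const 0) (.cell 5 (.const 2))) <|
  .seq (.setNat 13 (.const 0) (.scalar 2) (.const 0)) <|
  .seq (.setNat 13 (.const 0) (.scalar 3) (.const 0)) <|
  .seq (.setReal 3 (.const 0) (.ofNat (.scalar 0))) <|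
  .seq schemeProg <|
  .setReal 1 (.const 0) (.mul (.div (.ofNat (.scalar 0)) (.const 2))
    (.div (.cell 6 (.const 0)) (.cell 5 (.const 2))))

/-- The first estimate is kept in real array 6, which the scheme leaves alone. Clearing the flags of
u and v changes the target to 𝒞_0, and S = n is justified by π(𝒞_0) ≥ 1/n. -/
theorem corrProg_spec {n : ℕ} [Nonempty (Fin n)] {G : SimpleGraph (Fin n)} [DecidableRel G.Adj]
    (hdeg : ∀ u, 0 < G.degree u) {x ε η : ℝ} (u v : Fin n) (k : ℕ) :
    Coupled ((corrProg k).exec (inputMem G x u v ε η))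
      ((samplingScheme G x (graphsWithBoundary G {u, v}) (pairParam n x k) (ε / 4) (η / 2) ∅).bind
        fun y => (samplingScheme G x (graphsWithBoundary G ∅) n (ε / 4) (η / 2) ∅).map
          fun z => (n : ℝ) / 2 * (y / z))
      (200 + 10 * k + samplingTime G x (pairParam n x k) (ε / 4) (η / 2) +
        samplingTime G x n (ε / 4) (η / 2)) fun M' y => M'.real 1 0 = y := by
  have h := pairScheme_spec (x := x) (ε := ε) (η := η) hdeg u v k 4 2
  simp only [Nat.cast_ofNat] at h
  refine (Coupled.seq h (T₂ := 100 + samplingTime G x n (ε / 4) (η / 2)) ?_).mono (by omega)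
    fun _ _ h => h
  rintro M y ⟨h5, hn, hadj, h2, h3, hW, hx, hε, hη⟩
  refine (Coupled.seq_setReal (Coupled.seq_setNat (Coupled.seq_setNat (Coupled.seq_setReal
    (T := 30 + samplingTime G x n (ε / 4) (η / 2)) ?_)))).mono
    (by simp only [NExp.cost, RExp.cost, NExp.scalar_cost]; omega) fun _ _ h => h
  set M₄ := ((((M.writeReal _ _ _).writeNat _ _ _ _).writeNat _ _ _ _).writeReal _ _ _) with hM₄
  have hF : Frame [13] [3, 6] M M₄ := ((((Frame.refl _ _ M).writeReal (by decide) _ _).writeNat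
    (by decide) _ _ _).writeNat (by decide) _ _ _).writeReal (by decide) _ _
  have hn' : M₄.nat 0 0 0 = n := by rw [hF.nat 0 (by decide), hn]
  have hadj' : ∀ i j : Fin n, M₄.nat 1 i j = if G.Adj i j then 1 else 0 := by
    rw [hF.nat 1 (by decide)]; exact hadj
  have hW' : HoldsTarget (∅ : Finset (Fin n)) M₄ := fun j => by
    simp only [hM₄, Mem.writeNat_nat, Mem.writeReal_nat, NExp.val, NExp.scalar_val, h2, h3, hW j]
    simp only [Finset.mem_insert, Finset.mem_singleton, Fin.ext_iff, true_and,
      Finset.notMem_empty, if_false]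
    split_ifs <;> first | rfl | omega
  have hx' : M₄.real 0 0 = x := by rw [hF.real 0 (by decide), hx]
  have hS' : M₄.real 3 0 = n := by
    simp [hM₄, Mem.writeReal_real, Mem.writeNat_nat, Mem.writeReal_nat,
      NExp.val, RExp.val, NExp.scalar_val, hn]
  have hε' : M₄.real 3 1 = ε / 4 := by
    simp [hM₄, Mem.writeNat_real, Mem.writeReal_real, NExp.val, hε]
  have hη' : M₄.real 3 2 = η / 2 := by
    simp [hM₄, Mem.writeNat_real, Mem.writeReal_real, NExp.val, hη]
  have h6 : M₄.real 6 0 = y := by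
    simp [hM₄, Mem.writeNat_real, Mem.writeReal_real, NExp.val, RExp.val, h5]
  refine Coupled.map _ ((Coupled.seq_after (schemeProg_spec hdeg hn' hadj' hW' hx' hS' hε' hη')
    (T₂ := 30) ?_).mono (by rw [samplingTime]; omega) fun _ _ h => h)
  rintro M₅ z ⟨hF₅, hz⟩
  refine Coupled.setReal (by simp [NExp.cost, RExp.cost, RExp.const_cost, NExp.scalar_cost]) ?_
  simp only [Mem.writeReal_real, NExp.val, RExp.val, RExp.const_val, NExp.scalar_val, and_self,
    if_true, hz]
  rw [hF₅.real 6 (by decide), h6, hF₅.nat 0 (by decide), hn']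
  norm_num

/-! ### Polynomial bounds -/

/-- The leading term is K·N·R·n: means, runs, steps of the chain, and work per step. -/
theorem schemeTime_le {n R N K : ℕ} {B : ℝ} (hB : 1 ≤ B) (hn : (n : ℝ) ≤ B) (hR : (R : ℝ) ≤ B)
    (hN : (N : ℝ) ≤ B) (hK : (K : ℝ) ≤ B) : (schemeTime n R N K : ℝ) ≤ 4000 * B ^ 4 := by
  have h0 : 0 ≤ B := by linarith
  have h1 : B ≤ B ^ 4 := le_self_pow₀ hB (by norm_num)
  have h2 : B ^ 2 ≤ B ^ 4 := pow_le_pow_right₀ hB (by norm_num)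
  have h3 : B ^ 3 ≤ B ^ 4 := pow_le_pow_right₀ hB (by norm_num)
  calc (schemeTime n R N K : ℝ)
      = 400 + n * (80 + 30 * n) + R + N + K + K * ((50 + N * (101 + 200 * n + 50 * (n * n) +
          R * (1001 + 1000 * n))) + 1) + K * (200 + 70 * K) := by
        simp only [schemeTime, meanTime]; push_cast; ring
    _ ≤ 400 + B * (80 + 30 * B) + B + B + B + B * ((50 + B * (101 + 200 * B + 50 * (B * B) +
          B * (1001 + 1000 * B))) + 1) + B * (200 + 70 * B) := by gcongr
    _ ≤ 4000 * B ^ 4 := by nlinarith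

section Bounds

variable {n : ℕ} {G : SimpleGraph (Fin n)} [DecidableRel G.Adj] {x S ε η z : ℝ} {k : ℕ}

theorem mixingBound_le (hm : 0 < G.edgeFinset.card) (hx0 : 0 < x) (hx1 : x < 1) (hS : 1 ≤ S)
    (hε0 : 0 < ε) (hε1 : ε < 1) (hnz : (n : ℝ) ≤ z) (hxz : x⁻¹ ≤ z) (hεz : ε⁻¹ ≤ z)
    (hSz : S ≤ z ^ (k + 2)) : mixingBound G x (ε / (16 * S)) ≤ 96 * z ^ (k + 16) := by
  have hz : 1 ≤ z := ((one_le_inv₀ hx0).2 hx1.le).trans hxz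
  have hz0 : 0 ≤ z := by linarith
  have hm1 : (1 : ℝ) ≤ G.edgeFinset.card := by exact_mod_cast hm
  have hδ0 : 0 < ε / (16 * S) := by positivity
  have hδ1 : ε / (16 * S) ≤ 1 := by rw [div_le_one (by positivity)]; linarith
  have e1 : 1 / (2 * x) ≤ z := by
    rw [one_div, mul_inv]
    have : 0 < x⁻¹ := inv_pos.2 hx0
    linarith
  have e2 : Real.log (8 / x) ≤ 8 * z := by
    refine (Real.log_le_self (by positivity)).trans ?_
    rw [div_eq_mul_inv]; linarith
  -- Crudely, log y ≤ y with y = 16 S / ε.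
  have e3 : -Real.log (ε / (16 * S)) ≤ 16 * z ^ (k + 3) := by
    rw [← Real.log_inv]
    refine (Real.log_le_self (by positivity)).trans ?_
    rw [inv_div, div_eq_mul_inv, show k + 3 = k + 2 + 1 by ring, pow_succ, mul_assoc]
    gcongr
  have e4 : -Real.log (ε / (16 * S)) / G.edgeFinset.card ≤ 16 * z ^ (k + 3) :=
    (div_le_self (neg_nonneg.2 (Real.log_nonpos hδ0.le hδ1)) hm1).trans e3
  have e5 : z ≤ z ^ (k + 3) := le_self_pow₀ hz (by omega)
  have e6 : Real.log (8 / x) - Real.log (ε / (16 * S)) / G.edgeFinset.card ≤ 24 * z ^ (k + 3) := by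
    rw [neg_div] at e4; linarith
  have e7 : 0 ≤ Real.log (8 / x) - Real.log (ε / (16 * S)) / G.edgeFinset.card := by
    have h1 : 0 ≤ Real.log (8 / x) := Real.log_nonneg (by rw [le_div_iff₀ hx0]; linarith)
    have h2 : Real.log (ε / (16 * S)) / G.edgeFinset.card ≤ 0 :=
      div_nonpos_of_nonpos_of_nonneg (Real.log_nonpos hδ0.le hδ1) (by linarith)
    linarith
  have e8 : 3 + 1 / (G.edgeFinset.card * x) ≤ 4 * z := by
    have : 1 / (G.edgeFinset.card * x) ≤ z := by
      rw [one_div, mul_inv]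
      exact (mul_le_of_le_one_left (inv_nonneg.2 hx0.le) (inv_le_one_of_one_le₀ hm1)).trans hxz
    linarith
  have e9 : (G.maxDegree : ℝ) ≤ z := by
    refine le_trans ?_ hnz
    have : G.maxDegree ≤ n := G.maxDegree_le_of_forall_degree_le n fun v =>
      (G.degree_lt_card_verts v).le.trans_eq (Fintype.card_fin n)
    exact_mod_cast this
  have e10 : (G.edgeFinset.card : ℝ) ≤ z ^ 2 := by
    have h1 : G.edgeFinset.card ≤ n ^ 2 := by
      refine G.card_edgeFinset_le_card_choose_two.trans ?_
      rw [Fintype.card_fin]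
      exact Nat.choose_le_pow n 2
    calc (G.edgeFinset.card : ℝ) ≤ (n : ℝ) ^ 2 := by exact_mod_cast h1
      _ ≤ z ^ 2 := by gcongr
  rw [mixingBound, Fintype.card_fin]
  calc 1 / (2 * x) * (Real.log (8 / x) - Real.log (ε / (16 * S)) / G.edgeFinset.card) *
        (3 + 1 / (G.edgeFinset.card * x)) * G.maxDegree * (n : ℝ) ^ 6 * (G.edgeFinset.card : ℝ) ^ 2
      ≤ z * (24 * z ^ (k + 3)) * (4 * z) * z * z ^ 6 * (z ^ 2) ^ 2 := by gcongr
    _ = 96 * z ^ (k + 16) := by ring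

theorem runCount_le (hz : 1 ≤ z) (hε0 : 0 < ε) (hεz : ε⁻¹ ≤ z) (hS : 1 ≤ S)
    (hSz : S ≤ z ^ (k + 2)) : (runCount S ε : ℝ) ≤ 60 * z ^ (k + 4) := by
  have h1 : S * (ε ^ 2)⁻¹ ≤ z ^ (k + 4) := by
    rw [show k + 4 = k + 2 + 2 by ring, pow_add z (k + 2), ← inv_pow]
    gcongr
  have h2 := (Nat.ceil_lt_add_one (a := S * (ε ^ 2)⁻¹ + 1) (by positivity)).le
  have h3 : 1 ≤ z ^ (k + 4) := one_le_pow₀ hz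
  rw [runCount]; push_cast; linarith

theorem meanCount_le (hz : 1 ≤ z) (hη0 : 0 < η) (hη1 : η < 1) (hηz : η⁻¹ ≤ z) :
    (meanCount η : ℝ) ≤ 15 * z := by
  have h1 : 0 ≤ Real.log η⁻¹ := Real.log_nonneg ((one_le_inv₀ hη0).2 hη1.le)
  have h2 := (Real.log_le_self (x := η⁻¹) (by positivity)).trans hηz
  have h3 := (Nat.ceil_lt_add_one h1).le
  rw [meanCount]; push_cast; linarith

theorem samplingTime_le (hm : 0 < G.edgeFinset.card) (hx0 : 0 < x) (hx1 : x < 1) (hS : 1 ≤ S)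
    (hε0 : 0 < ε) (hε1 : ε < 1) (hη0 : 0 < η) (hη1 : η < 1) (hnz : (n : ℝ) ≤ z) (hxz : x⁻¹ ≤ z)
    (hεz : ε⁻¹ ≤ z) (hηz : η⁻¹ ≤ z) (hSz : S ≤ z ^ (k + 2)) :
    (samplingTime G x S ε η : ℝ) ≤ 4000 * (100 * z ^ (k + 16)) ^ 4 := by
  have hz : 1 ≤ z := ((one_le_inv₀ hx0).2 hx1.le).trans hxz
  have h1 : 1 ≤ z ^ (k + 16) := one_le_pow₀ hz
  have h2 : z ≤ z ^ (k + 16) := le_self_pow₀ hz (by omega)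
  refine schemeTime_le (by linarith) (by linarith) ?_ ?_ ?_
  · have h3 := mixingBound_le hm hx0 hx1 hS hε0 hε1 hnz hxz hεz hSz
    refine (Nat.cast_le.2 (Nat.ceil_mono h3)).trans
      ((Nat.ceil_lt_add_one (by positivity)).le.trans ?_)
    linarith
  · have h3 := runCount_le hz hε0 hεz hS hSz
    have h4 : z ^ (k + 4) ≤ z ^ (k + 16) := pow_le_pow_right₀ hz (by omega)
    linarith
  · have h3 := meanCount_le hz hη0 hη1 hηz
    linarith

theorem one_le_pairParam (hn : 2 ≤ n) (hx0 : 0 < x) (hx1 : x < 1) : 1 ≤ pairParam n x k := by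
  have h1 : (2 : ℝ) ≤ n := by exact_mod_cast hn
  have h2 : 1 ≤ (x ^ k)⁻¹ := (one_le_inv₀ (by positivity)).2 (pow_le_one₀ hx0.le hx1.le)
  have h3 : (2 : ℝ) ≤ n * (n + 1) := by nlinarith
  rw [pairParam]; nlinarith

theorem pairParam_le (hn : 1 ≤ n) (hx0 : 0 < x) (hnz : (n : ℝ) ≤ z) (hxz : x⁻¹ ≤ z) :
    pairParam n x k ≤ z ^ (k + 2) := by
  have h1 : (1 : ℝ) ≤ n := by exact_mod_cast hn
  have hxi : 0 < x⁻¹ := inv_pos.2 hx0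
  have hz : 0 ≤ z := by linarith
  calc pairParam n x k = (n * ((n + 1) / 2)) * (x⁻¹) ^ k := by rw [pairParam, inv_pow]; ring
    _ ≤ (z * z) * z ^ k := by
      gcongr
      linarith
    _ = z ^ (k + 2) := by ring

theorem one_div_pairParam (n : ℕ) (x : ℝ) (k : ℕ) :
    1 / pairParam n x k = 2 * x ^ k / ((n : ℝ) * ((n : ℝ) + 1)) := by
  rw [pairParam, one_div, inv_div, div_mul_eq_div_div_swap, div_inv_eq_mul]

end Bounds

/-! ### Correctness -/

namespace IsInstance

variable {k n : ℕ} {G : SimpleGraph (Fin n)} {β : ℝ} {u v : Fin n}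

theorem tanh_pos (h : IsInstance k G β u v) : 0 < Real.tanh β := by
  rw [Real.tanh_eq_sinh_div_cosh]
  exact div_pos (Real.sinh_pos_iff.2 h.pos) (Real.cosh_pos β)

theorem two_le (h : IsInstance k G β u v) : 2 ≤ n := by
  have h1 : Nontrivial (Fin n) := ⟨u, v, h.ne⟩
  simpa [Nat.succ_le_iff] using Fintype.one_lt_card_iff_nontrivial.2 h1

variable [DecidableRel G.Adj]

theorem degree_pos (h : IsInstance k G β u v) (w : Fin n) : 0 < G.degree w :=
  degree_pos_of_connected h.connected (by simpa using h.two_le) w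

theorem card_edgeFinset_pos (h : IsInstance k G β u v) : 0 < G.edgeFinset.card := by
  have h1 := G.degree_le_card_edgeFinset (v := u)
  exact (h.degree_pos u).trans_le h1

theorem pair_ge (h : IsInstance k G β u v) :
    2 * Real.tanh β ^ k / ((n : ℝ) * ((n : ℝ) + 1)) ≤
      wormProb G (Real.tanh β) (graphsWithBoundary G {u, v}) := by
  simpa using wormProb_pair_ge h.tanh_pos (Real.tanh_lt_one β) h.ne h.connected h.dist_le

theorem empty_ge (h : IsInstance k G β u v) :
    (n : ℝ)⁻¹ ≤ wormProb G (Real.tanh β) (graphsWithBoundary G ∅) := by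
  have : Nonempty (Fin n) := ⟨u⟩
  simpa using wormProb_empty_ge (G := G) h.tanh_pos (Real.tanh_lt_one β)

theorem empty_pos (h : IsInstance k G β u v) :
    0 < wormProb G (Real.tanh β) (graphsWithBoundary G ∅) := by
  have h1 : (0 : ℝ) < n := by exact_mod_cast (by have := h.two_le; omega : 0 < n)
  exact (inv_pos.2 h1).trans_le h.empty_ge

theorem pair_pos (h : IsInstance k G β u v) :
    0 < wormProb G (Real.tanh β) (graphsWithBoundary G {u, v}) := by
  have h1 : (0 : ℝ) < n := by exact_mod_cast (by have := h.two_le; omega : 0 < n)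
  have h2 := h.tanh_pos
  exact lt_of_lt_of_le (by positivity) h.pair_ge

theorem scheme_pair [Nonempty (Fin n)] (h : IsInstance k G β u v) {ε η : ℝ}
    (hε : ε ∈ Set.Ioo (0 : ℝ) (1 / 4)) (hη : η ∈ Set.Ioo (0 : ℝ) (1 / 4))
    {A₀ : Finset (Sym2 (Fin n))} (hA₀ : A₀ ∈ wormSpace G) :
    Approximates (samplingScheme G (Real.tanh β) (graphsWithBoundary G {u, v})
      (pairParam n (Real.tanh β) k) ε η A₀)
      (wormProb G (Real.tanh β) (graphsWithBoundary G {u, v})) ε η :=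
  samplingScheme_approximates h.tanh_pos (Real.tanh_lt_one β) h.connected (by simpa using h.two_le)
    _ (one_le_pairParam h.two_le h.tanh_pos (Real.tanh_lt_one β))
    (by rw [one_div_pairParam]; exact h.pair_ge) hε hη hA₀

theorem scheme_empty [Nonempty (Fin n)] (h : IsInstance k G β u v) {ε η : ℝ}
    (hε : ε ∈ Set.Ioo (0 : ℝ) (1 / 4)) (hη : η ∈ Set.Ioo (0 : ℝ) (1 / 4)) :
    Approximates (samplingScheme G (Real.tanh β) (graphsWithBoundary G ∅) n ε η ∅)
      (wormProb G (Real.tanh β) (graphsWithBoundary G ∅)) ε η :=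
  samplingScheme_approximates h.tanh_pos (Real.tanh_lt_one β) h.connected (by simpa using h.two_le)
    _ (by exact_mod_cast one_le_two.trans h.two_le) (by rw [one_div]; exact h.empty_ge) hε hη
    (empty_mem_wormSpace G)

end IsInstance

/-- A polynomial that bounds the running times of both programs. -/
def timePoly (k : ℕ) : MvPolynomial (Fin 4) ℝ :=
  MvPolynomial.C (10000 + 10 * (k : ℝ)) *
    (MvPolynomial.C 100 * (MvPolynomial.C 4 * MvPolynomial.X 0 * MvPolynomial.X 1 *
      MvPolynomial.X 2 * MvPolynomial.X 3) ^ (k + 16)) ^ 4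

theorem eval_timePoly (k : ℕ) (a b c d : ℝ) : MvPolynomial.eval ![a, b, c, d] (timePoly k) =
    (10000 + 10 * (k : ℝ)) * (100 * (4 * a * b * c * d) ^ (k + 16)) ^ 4 := by
  simp [timePoly]

/-- Stated for two runs with a choice of S', so that it serves both programs: the correlation
program takes S' = n, and the other simply discards the second run. -/
theorem le_timePoly {k n : ℕ} {G : SimpleGraph (Fin n)} [DecidableRel G.Adj] {β : ℝ} {u v : Fin n}
    (h : IsInstance k G β u v) {ε η : ℝ} (hε : ε ∈ Set.Ioo (0 : ℝ) (1 / 4))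
    (hη : η ∈ Set.Ioo (0 : ℝ) (1 / 4)) {ε' η' S S' : ℝ} (hε' : ε / 4 ≤ ε') (hε'' : ε' ≤ ε)
    (hη' : η / 2 ≤ η') (hη'' : η' ≤ η)
    (hS : S = pairParam n (Real.tanh β) k) (hS' : S' = pairParam n (Real.tanh β) k ∨ S' = n) :
    200 + 10 * (k : ℝ) + samplingTime G (Real.tanh β) S ε' η' +
      samplingTime G (Real.tanh β) S' ε' η' ≤
      MvPolynomial.eval ![(n : ℝ), (Real.tanh β)⁻¹, ε⁻¹, η⁻¹] (timePoly k) := by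
  obtain ⟨hε0, hε1⟩ := hε
  obtain ⟨hη0, hη1⟩ := hη
  have hx0 := h.tanh_pos
  have hx1 := Real.tanh_lt_one β
  have hn := h.two_le
  have hn1 : (1 : ℝ) ≤ n := by exact_mod_cast one_le_two.trans hn
  rw [eval_timePoly]
  set x := Real.tanh β
  -- Each of n, x⁻¹, ε⁻¹, η⁻¹ is at least 1, so the product dominates each of them; the factor 4
  -- absorbs ε/4 and η/2.
  set z := 4 * (n : ℝ) * x⁻¹ * ε⁻¹ * η⁻¹ with hz
  have hx : 1 ≤ x⁻¹ := (one_le_inv₀ hx0).2 hx1.le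
  have he : 1 ≤ ε⁻¹ := (one_le_inv₀ hε0).2 (by linarith)
  have hh : 1 ≤ η⁻¹ := (one_le_inv₀ hη0).2 (by linarith)
  have hnz : (n : ℝ) ≤ z := by
    calc (n : ℝ) = 1 * n * 1 * 1 * 1 := by ring
      _ ≤ z := by rw [hz]; gcongr; norm_num
  have hxz : x⁻¹ ≤ z := by
    calc x⁻¹ = 1 * 1 * x⁻¹ * 1 * 1 := by ring
      _ ≤ z := by rw [hz]; gcongr; norm_num
  have hεz : ε'⁻¹ ≤ z := by
    calc ε'⁻¹ ≤ (ε / 4)⁻¹ := by gcongr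
      _ = 4 * 1 * 1 * ε⁻¹ * 1 := by rw [inv_div]; ring
      _ ≤ z := by rw [hz]; gcongr
  have hηz : η'⁻¹ ≤ z := by
    calc η'⁻¹ ≤ (η / 2)⁻¹ := by gcongr
      _ = 2 * 1 * 1 * 1 * η⁻¹ := by rw [inv_div]; ring
      _ ≤ z := by rw [hz]; gcongr; norm_num
  have hz1 : 1 ≤ z := hx.trans hxz
  have hp := pairParam_le (k := k) (one_le_two.trans hn) hx0 hnz hxz
  have hp1 := one_le_pairParam (k := k) hn hx0 hx1
  have t1 := samplingTime_le (S := S) (k := k) (η := η') h.card_edgeFinset_pos hx0 hx1 (hS ▸ hp1)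
    (by linarith) (by linarith) (by linarith) (by linarith) hnz hxz hεz hηz (hS ▸ hp)
  have hS1 : 1 ≤ S' := by rcases hS' with rfl | rfl; exacts [hp1, hn1]
  have hS2 : S' ≤ z ^ (k + 2) := by
    rcases hS' with rfl | rfl
    exacts [hp, hnz.trans (le_self_pow₀ hz1 (by omega))]
  have t2 := samplingTime_le (S := S') (k := k) (η := η') h.card_edgeFinset_pos hx0 hx1 hS1
    (by linarith) (by linarith) (by linarith) (by linarith) hnz hxz hεz hηz hS2
  -- With w this power, the two runs cost at most 8000 w, and w ≥ 1 absorbs the additive 200 + 10k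
  -- into (10000 + 10k) w.
  have hw : 1 ≤ (100 * z ^ (k + 16)) ^ 4 :=
    one_le_pow₀ (by linarith [one_le_pow₀ hz1 (n := k + 16)])
  have hk : (0 : ℝ) ≤ k := Nat.cast_nonneg k
  nlinarith

theorem output_pairProg {k n : ℕ} [Nonempty (Fin n)] {G : SimpleGraph (Fin n)} [DecidableRel G.Adj]
    {β : ℝ} {u v : Fin n} (h : IsInstance k G β u v) (ε η : ℝ) :
    (pairProg k).output (inputMem G (Real.tanh β) u v ε η) =
      samplingScheme G (Real.tanh β) (graphsWithBoundary G {u, v})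
        (pairParam n (Real.tanh β) k) ε η ∅ :=
  (pairProg_spec h.degree_pos u v k).output_eq

theorem isFPRAS_pairProg (k : ℕ) : IsFPRAS k (pairProg k) fun _ G _ β u v =>
    wormProb G (Real.tanh β) (graphsWithBoundary G {u, v}) := by
  refine ⟨timePoly k, fun n G _ β u v h ε hε η hη => ?_⟩
  have : Nonempty (Fin n) := ⟨u⟩
  refine ⟨(pairProg_spec h.degree_pos u v k).runsWithin ((le_timePoly h hε hη
    (by linarith [hε.1]) le_rfl (by linarith [hη.1]) le_rfl rfl (Or.inl rfl)).trans' ?_), ?_⟩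
  · push_cast
    linarith [Nat.cast_nonneg (α := ℝ)
      (samplingTime G (Real.tanh β) (pairParam n (Real.tanh β) k) ε η)]
  · rw [output_pairProg h]
    exact h.scheme_pair hε hη (empty_mem_wormSpace G)

theorem isFPRAS_corrProg (k : ℕ) :
    IsFPRAS k (corrProg k) fun _ G _ β u v => isingCorr G β {u, v} := by
  refine ⟨timePoly k, fun n G _ β u v h ε hε η hη => ?_⟩
  have : Nonempty (Fin n) := ⟨u⟩
  have hspec := corrProg_spec (x := Real.tanh β) (ε := ε) (η := η) h.degree_pos u v k
  refine ⟨hspec.runsWithin ((le_timePoly h hε hη (ε' := ε / 4) (η' := η / 2)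
    le_rfl (by linarith [hε.1]) le_rfl (by linarith [hη.1]) rfl (Or.inr rfl)).trans' ?_), ?_⟩
  · push_cast; exact le_rfl
  · beta_reduce
    rw [hspec.output_eq, isingCorr_pair_eq h.tanh_pos h.ne, Fintype.card_fin]
    have hε' : ε / 4 ∈ Set.Ioo (0 : ℝ) (1 / 4) := ⟨by linarith [hε.1], by linarith [hε.1, hε.2]⟩
    have hη' : η / 2 ∈ Set.Ioo (0 : ℝ) (1 / 4) := ⟨by linarith [hη.1], by linarith [hη.1, hη.2]⟩
    exact Approximates.div h.pair_pos h.empty_pos (by positivity) hε hη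
      (h.scheme_pair hε' hη' (empty_mem_wormSpace G)) (h.scheme_empty hε' hη')

end

theorem mainTheorem3 (k : ℕ) :
    -- the bijection, the lower bound, the correlation identity and the accuracy of the scheme
    (∀ (n : ℕ) [NeZero n] (G : SimpleGraph (Fin n)) [DecidableRel G.Adj] (β : ℝ) (u v : Fin n),
      IsInstance k G β u v →
      (∀ p : G.Walk u v, p.length = G.dist u v →
        Set.BijOn (fun A : Finset (Sym2 (Fin n)) => A ∆ p.edges.toFinset)
          (graphsWithBoundary G {u, v}) (graphsWithBoundary G ∅)) ∧
      2 * Real.tanh β ^ k / ((n : ℝ) * ((n : ℝ) + 1)) ≤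
        wormProb G (Real.tanh β) (graphsWithBoundary G {u, v}) ∧
      0 < wormProb G (Real.tanh β) (graphsWithBoundary G ∅) ∧
      isingCorr G β {u, v} =
        (n : ℝ) / 2 * (wormProb G (Real.tanh β) (graphsWithBoundary G {u, v}) /
          wormProb G (Real.tanh β) (graphsWithBoundary G ∅)) ∧
      ∀ ε ∈ Set.Ioo (0 : ℝ) (1 / 4), ∀ η ∈ Set.Ioo (0 : ℝ) (1 / 4), ∀ A₀ ∈ wormSpace G,
        Approximates
          (samplingScheme G (Real.tanh β) (graphsWithBoundary G {u, v})
            ((n : ℝ) * ((n : ℝ) + 1) * (Real.tanh β ^ k)⁻¹ / 2) ε η A₀)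
          (wormProb G (Real.tanh β) (graphsWithBoundary G {u, v})) ε η) ∧
    -- the scheme, implemented as a program, is an fpras for `π(𝒞_uv)`
    (∃ p : Prog,
      (∀ (n : ℕ) [NeZero n] (G : SimpleGraph (Fin n)) [DecidableRel G.Adj] (β : ℝ) (u v : Fin n),
        IsInstance k G β u v →
        ∀ ε ∈ Set.Ioo (0 : ℝ) (1 / 4), ∀ η ∈ Set.Ioo (0 : ℝ) (1 / 4),
          p.output (inputMem G (Real.tanh β) u v ε η) =
            samplingScheme G (Real.tanh β) (graphsWithBoundary G {u, v})
              ((n : ℝ) * ((n : ℝ) + 1) * (Real.tanh β ^ k)⁻¹ / 2) ε η ∅) ∧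
      IsFPRAS k p fun _ G _ β u v =>
        wormProb G (Real.tanh β) (graphsWithBoundary G {u, v})) ∧
    -- there is an fpras for the two-point correlation function
    (∃ p : Prog, IsFPRAS k p fun _ G _ β u v => isingCorr G β {u, v}) := by
  refine ⟨fun n _ G _ β u v h => ⟨fun p hp => ?_, h.pair_ge, h.empty_pos, ?_,
    fun ε hε η hη A₀ hA₀ => h.scheme_pair hε hη hA₀⟩,
    ⟨pairProg k, fun n _ G _ β u v h ε _ η _ => output_pairProg h ε η, isFPRAS_pairProg k⟩,
    corrProg k, isFPRAS_corrProg k⟩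
  · exact bijOn_symmDiff_path G h.ne (p.isPath_of_length_eq_dist hp).isTrail
  · simpa using isingCorr_pair_eq h.tanh_pos h.ne
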